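/- There is an absolute constant $C>0$ such that the following holds. Let $G$ be a finite abelian group of odd order, let $A\subset G$, and suppose that its density $\alpha:=|A|/|G|$ is positive. Then $$\langle 1_A * 1_{-2\cdot A},\,1_{-A}\rangle_{L^2(\mu_G)}\ \ge\ \exp\!\left(-C\,\alpha^{-1}\left(\log\frac{2}{\alpha}\right)^{5}\right).$$ Here $\mu_G$ is the uniform probability measure on $G$, $1_S$ is the indicator function of $S\subset G$, $-A=\{-a:a\in A\}$, $-2\cdot A=\{-2a:a\in A\}$, $f*g(x)=\int f(y)g(x-y)\,d\mu_G(y)$ and $\langle f,g\rangle_{L^2(\mu_G)}=\int f(x)\overline{g(x)}\,d\mu_G(x)$. (Thus the left-hand side is the number of triples $(a,b,c)\in A^3$ with $a+c=2b$, including the trivial ones, divided by $|G|^2$.) -/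

import Mathlib

open scoped BigOperators Pointwise

namespace Roth

/-- The indicator function `1_S` of a subset `S` of `G`, with real values. -/
noncomputable def ind {G : Type*} (S : Set G) : G → ℝ :=
  S.indicator (fun _ => 1)

/-- The normalized convolution
`f * g (x) = ∫ f(y) g(x - y) dμ_G(y)`, where `μ_G` is the uniform probability measure on `G`
(`𝔼` is the average over `G`). -/
noncomputable def conv {G : Type*} [AddCommGroup G] [Fintype G] (f g : G → ℝ) : G → ℝ :=
  fun x => 𝔼 y : G, f y * g (x - y)

/-- The inner product `⟨f, g⟩ = ∫ f(x) g(x) dμ_G(x)` of `L²(μ_G)` (real-valued functions), where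
`μ_G` is the uniform probability measure on `G`. -/
noncomputable def innerL2 {G : Type*} [Fintype G] (f g : G → ℝ) : ℝ :=
  RCLike.wInner (𝕜 := ℝ) RCLike.cWeight f g

/-- The dilate `k.A = {k a : a ∈ A}` (not the `k`-fold sumset). -/
def dilate {G : Type*} [AddCommGroup G] (k : ℤ) (A : Set G) : Set G :=
  (fun a => k • a) '' A

end Roth

/-! The proof is a Kelley–Meka density increment on Bohr sets. Put `L = log (2/α)` and let `ℓ` be of
order `L`. The argument gives at least `2^(-O(ℓ^19)) |G|²` progressions; the stated bound follows
only at the very end, from `L^14 ≤ 14! exp L`.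

Let `A` have density `a ≥ 2^(-ℓ)` on a translate of a regular Bohr set. One translation makes `A`
dense both on a Bohr set `B` and on a much smaller one; call the pieces `A₁` and `A₂`. As `|G|` is
odd, doubling is an automorphism, so `2·A₂` is dense in a doubled Bohr set. Suppose that `1_{A₁} *
1_{A₁}` averages at most a quarter of its expected size `a²|B|` there, `a` now being the density of
`A₁`. Then the self-convolution of the balanced function is very negative on average, so its even
moments are large. Moments of a convolution are dominated by those of the correlation
(`sum_sconv_pow_mul_sconv_le`), and all the latter are nonnegative, so a high moment of the
correlation of `A₁` itself is too large (`two_pow_le_sum_add_corr_pow`). Sifting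
(`exists_sifted_of_few`) then produces a set `D` of density `2^(-O(ℓ²))` in a Bohr set, almost all
of whose differences are popular, that is, have correlation above `1.02` times the expected value.

Almost-periodicity by random sampling, with a Chang-type theorem relative to a Bohr set, turns this
into a translate of a Bohr set with `O(ℓ^8)` further characters, `99%` of which is popular
(`exists_bohr_translate`). Hence `A` gains a factor `1.001` in density on some translate
(`density_step`). This can happen only `O(ℓ)` times, so at some stage progressions are not scarce
(`exists_bohr_of_iteration`). The Bohr set reached has rank `O(ℓ^9)` and radius `2^(-O(ℓ^10))`,
hence density `2^(-O(ℓ^19))`. -/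

namespace Roth

open Finset

set_option linter.unusedSectionVars false

/-! ### Bohr sets: size, doubling and regular radii. -/

section Bohr

variable {G : Type*} [AddCommGroup G] [Fintype G] [DecidableEq G]

/-- The Bohr set of radius `r` attached to the finite set of characters `Γ`. -/
noncomputable def bohr (Γ : Finset (AddChar G ℂ)) (r : ℝ) : Finset G :=
  univ.filter fun x => ∀ γ ∈ Γ, ‖γ x - 1‖ ≤ r

theorem mem_bohr {Γ : Finset (AddChar G ℂ)} {r : ℝ} {x : G} :
    x ∈ bohr Γ r ↔ ∀ γ ∈ Γ, ‖γ x - 1‖ ≤ r := by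
  simp [bohr]

theorem norm_char_add_sub_one_le (γ : AddChar G ℂ) (x y : G) :
    ‖γ (x + y) - 1‖ ≤ ‖γ x - 1‖ + ‖γ y - 1‖ := by
  have h : γ (x + y) - 1 = γ x * (γ y - 1) + (γ x - 1) := by
    rw [AddChar.map_add_eq_mul]; ring
  rw [h]
  refine (norm_add_le _ _).trans ?_
  rw [norm_mul, AddChar.norm_apply, one_mul, add_comm]

theorem norm_char_sub_sub_one (γ : AddChar G ℂ) (x y : G) :
    ‖γ (x - y) - 1‖ = ‖γ x - γ y‖ := by
  have h : γ x - γ y = γ y * (γ (x - y) - 1) := by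
    rw [mul_sub, ← AddChar.map_add_eq_mul]; simp
  rw [h, norm_mul, AddChar.norm_apply, one_mul]

theorem norm_char_neg_sub_one (γ : AddChar G ℂ) (x : G) : ‖γ (-x) - 1‖ = ‖γ x - 1‖ := by
  have h := norm_char_sub_sub_one γ 0 x
  rw [zero_sub, AddChar.map_zero_eq_one] at h
  rw [h, norm_sub_rev]

theorem zero_mem_bohr (Γ : Finset (AddChar G ℂ)) {r : ℝ} (hr : 0 ≤ r) : (0 : G) ∈ bohr Γ r := by
  rw [mem_bohr]; intro γ _; simpa using hr

theorem bohr_nonempty (Γ : Finset (AddChar G ℂ)) {r : ℝ} (hr : 0 ≤ r) : (bohr Γ r).Nonempty :=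
  ⟨0, zero_mem_bohr Γ hr⟩

theorem card_bohr_pos (Γ : Finset (AddChar G ℂ)) {r : ℝ} (hr : 0 ≤ r) :
    (0 : ℝ) < (bohr Γ r).card := by
  exact_mod_cast (bohr_nonempty Γ hr).card_pos

theorem neg_mem_bohr {Γ : Finset (AddChar G ℂ)} {r : ℝ} {x : G} (hx : x ∈ bohr Γ r) :
    -x ∈ bohr Γ r := by
  rw [mem_bohr] at *
  intro γ hγ
  rw [norm_char_neg_sub_one]
  exact hx γ hγ

theorem bohr_mono {Γ Δ : Finset (AddChar G ℂ)} {r s : ℝ} (h : Δ ⊆ Γ) (hrs : r ≤ s) :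
    bohr Γ r ⊆ bohr Δ s := by
  intro x hx
  rw [mem_bohr] at *
  exact fun γ hγ => (hx γ (h hγ)).trans hrs

theorem add_mem_bohr {Γ : Finset (AddChar G ℂ)} {r s t : ℝ} {x y : G} (hx : x ∈ bohr Γ r)
    (hy : y ∈ bohr Γ s) (hrs : r + s ≤ t) : x + y ∈ bohr Γ t := by
  rw [mem_bohr] at *
  exact fun γ hγ => (norm_char_add_sub_one_le γ x y).trans
    ((add_le_add (hx γ hγ) (hy γ hγ)).trans hrs)

theorem sub_mem_bohr {Γ : Finset (AddChar G ℂ)} {r s t : ℝ} {x y : G} (hx : x ∈ bohr Γ r)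
    (hy : y ∈ bohr Γ s) (hrs : r + s ≤ t) : x - y ∈ bohr Γ t := by
  rw [sub_eq_add_neg]
  exact add_mem_bohr hx (neg_mem_bohr hy) hrs

theorem bohr_two (Γ : Finset (AddChar G ℂ)) : bohr Γ 2 = univ := by
  ext x
  simp only [mem_bohr, mem_univ, iff_true]
  intro γ _
  calc ‖γ x - 1‖ ≤ ‖γ x‖ + ‖(1 : ℂ)‖ := norm_sub_le _ _
    _ = 2 := by rw [AddChar.norm_apply, norm_one]; norm_num

theorem bohr_empty (r : ℝ) : bohr (∅ : Finset (AddChar G ℂ)) r = univ := by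
  ext x; simp [mem_bohr]

theorem abs_sub_lt_of_floor_eq {a b r : ℝ} (hr : 0 < r) (h : ⌊2 * a / r⌋ = ⌊2 * b / r⌋) :
    |a - b| < r / 2 := by
  have h1 := Int.abs_sub_lt_one_of_floor_eq_floor h
  have h2 : 2 * a / r - 2 * b / r = (a - b) * (2 / r) := by ring
  rw [h2, abs_mul, abs_of_pos (show 0 < 2 / r by positivity)] at h1
  have h3 : |a - b| * (2 / r) * (r / 2) = |a - b| := by field_simp
  nlinarith [mul_lt_mul_of_pos_right h1 (show 0 < r / 2 by positivity)]

theorem floor_mem_Icc {a r : ℝ} (hr : 0 < r) (h : |a| ≤ 2 * r) :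
    ⌊2 * a / r⌋ ∈ Icc (-4 : ℤ) 4 := by
  rw [abs_le] at h
  rw [Finset.mem_Icc]
  constructor
  · rw [Int.le_floor, le_div_iff₀ hr]; push_cast; linarith
  · have : 2 * a / r ≤ 4 := by rw [div_le_iff₀ hr]; linarith
    have h2 := (Int.floor_le (2 * a / r)).trans this
    exact_mod_cast h2

/-- Sort the points by the square of side `r / 2` containing each `γ x - 1`. At radius `2 * r` there
are `9 * 9` squares per character, and two points in the same squares differ by an element of the
smaller Bohr set. -/
theorem card_bohr_two_mul_le (Γ : Finset (AddChar G ℂ)) {r : ℝ} (hr : 0 < r) :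
    (bohr Γ (2 * r)).card ≤ 81 ^ Γ.card * (bohr Γ r).card := by
  classical
  let Φ : G → (Γ → ℤ × ℤ) := fun x γ =>
    (⌊2 * ((γ : AddChar G ℂ) x - 1).re / r⌋, ⌊2 * ((γ : AddChar G ℂ) x - 1).im / r⌋)
  let t : Finset (Γ → ℤ × ℤ) := Fintype.piFinset fun _ => Icc (-4 : ℤ) 4 ×ˢ Icc (-4 : ℤ) 4
  have ht : t.card = 81 ^ Γ.card := by
    simp [t, Fintype.card_piFinset, Finset.card_product]
  rw [← ht, mul_comm t.card]
  refine Finset.card_le_mul_card_image_of_maps_to (f := Φ) ?_ _ ?_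
  · intro x hx
    rw [mem_bohr] at hx
    simp only [t, Fintype.mem_piFinset, Finset.mem_product]
    intro γ
    exact ⟨floor_mem_Icc hr ((Complex.abs_re_le_norm _).trans (hx γ γ.2)),
      floor_mem_Icc hr ((Complex.abs_im_le_norm _).trans (hx γ γ.2))⟩
  · intro b _
    rcases Finset.eq_empty_or_nonempty ((bohr Γ (2 * r)).filter fun a => Φ a = b) with h | ⟨a₀, h₀⟩
    · rw [h]; simp
    · refine Finset.card_le_card_of_injOn (fun a => a - a₀) ?_ (fun x _ y _ h => by simpa using h)
      intro a ha
      have ha' := (Finset.mem_filter.1 ha).2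
      have h₀' := (Finset.mem_filter.1 h₀).2
      refine mem_bohr.2 fun γ hγ => ?_
      have hΦ : Φ a ⟨γ, hγ⟩ = Φ a₀ ⟨γ, hγ⟩ := by rw [ha', h₀']
      have h1 := abs_sub_lt_of_floor_eq hr (congrArg Prod.fst hΦ)
      have h2 := abs_sub_lt_of_floor_eq hr (congrArg Prod.snd hΦ)
      rw [norm_char_sub_sub_one]
      refine (Complex.norm_le_abs_re_add_abs_im _).trans ?_
      simp only [Complex.sub_re, Complex.sub_im, sub_sub_sub_cancel_right] at h1 h2 ⊢
      linarith

theorem card_univ_le_card_bohr (Γ : Finset (AddChar G ℂ)) (k : ℕ) :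
    Fintype.card G ≤ 81 ^ (Γ.card * k) * (bohr Γ (2 / 2 ^ k)).card := by
  induction k with
  | zero => simp [bohr_two]
  | succ k ih =>
    have h := card_bohr_two_mul_le Γ (r := 2 / 2 ^ (k + 1)) (by positivity)
    have h2 : (2 : ℝ) * (2 / 2 ^ (k + 1)) = 2 / 2 ^ k := by rw [pow_succ]; field_simp
    rw [h2] at h
    calc _ ≤ _ := ih
      _ ≤ 81 ^ (Γ.card * k) * (81 ^ Γ.card * (bohr Γ (2 / 2 ^ (k + 1))).card) := by gcongr
      _ = _ := by ring

/-- If every radius between `r` and `2 * r` were irregular, the size would gain a factor `1 + ε` at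
each of many small steps, contradicting the doubling bound. -/
theorem exists_regular_radius (Γ : Finset (AddChar G ℂ)) {d : ℕ} (hd : Γ.card ≤ d) {r ε : ℝ}
    (hr : 0 < r) (hε : 0 < ε) (hε1 : ε ≤ 1) :
    ∃ r', r ≤ r' ∧ r' ≤ 2 * r ∧
      ((bohr Γ (r' + ε * r' / (28 * (d + 1)))).card : ℝ) ≤ (1 + ε) * (bohr Γ r').card := by
  by_contra! hcon
  set k := ⌈1 / ε⌉₊ with hk
  have hk1 : 1 / ε ≤ k := Nat.le_ceil _
  have hk2 : (k : ℝ) ≤ 2 / ε := by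
    have := (Nat.ceil_lt_add_one (show 0 ≤ 1 / ε by positivity)).le
    have h1 : 1 ≤ 1 / ε := by rw [le_div_iff₀ hε]; linarith
    calc (k : ℝ) ≤ 1 / ε + 1 := this
      _ ≤ 1 / ε + 1 / ε := by linarith
      _ = 2 / ε := by ring
  have hk0 : (0 : ℝ) < k := lt_of_lt_of_le (by positivity) hk1
  have hd0 : (0 : ℝ) < (d : ℝ) + 1 := by positivity
  -- Since `(1 + ε)^k ≥ 2`, these `7 (d + 1)` blocks of `k` steps force growth by `128^(d + 1)`,
  -- more than the permitted `81^d`.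
  set N := k * (7 * (d + 1)) with hN
  have hNr : (N : ℝ) = k * (7 * (d + 1)) := by rw [hN]; push_cast; ring
  have hN0 : (0 : ℝ) < N := by rw [hNr]; positivity
  have hscale : ∀ w, 0 ≤ w → w ≤ 2 * r → ε * w / (28 * (d + 1)) ≤ r / N := by
    intro w hw0 hw
    rw [div_le_div_iff₀ (by positivity) hN0, hNr]
    have h4 : ε * k ≤ 2 := by rw [le_div_iff₀ hε] at hk2; linarith
    calc ε * w * (k * (7 * (d + 1))) = (ε * k) * (7 * (d + 1)) * w := by ring
      _ ≤ 2 * (7 * (d + 1)) * (2 * r) := by gcongr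
      _ = r * (28 * (d + 1)) := by ring
  have hstep : ∀ j : ℕ, j ≤ N →
      (1 + ε) ^ j * (bohr Γ r).card ≤ (bohr Γ (r + j * (r / N))).card := by
    intro j
    induction j with
    | zero => intro _; simp
    | succ j ih =>
      intro hj
      have hj' : (j : ℝ) + 1 ≤ N := by exact_mod_cast hj
      have h1 : (j : ℝ) * (r / N) ≤ r := by
        rw [mul_div_assoc', div_le_iff₀ hN0]; nlinarith
      have h2 := hcon (r + j * (r / N)) (by have : 0 ≤ j * (r / N) := by positivity
                                            linarith) (by linarith)
      have h3 := hscale (r + j * (r / N)) (by positivity) (by linarith)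
      have h5 : bohr Γ (r + j * (r / N) + ε * (r + j * (r / N)) / (28 * (d + 1))) ⊆
          bohr Γ (r + (j + 1 : ℕ) * (r / N)) := by
        apply bohr_mono (Finset.Subset.refl _)
        push_cast; linarith
      have h6 : ((bohr Γ (r + j * (r / N) + ε * (r + j * (r / N)) / (28 * (d + 1)))).card : ℝ) ≤
          (bohr Γ (r + (j + 1 : ℕ) * (r / N))).card := by exact_mod_cast Finset.card_le_card h5
      have h7 := ih (by omega)
      rw [pow_succ]
      nlinarith
  have hfin := hstep N le_rfl
  have h8 : r + N * (r / N) = 2 * r := by field_simp; ring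
  rw [h8] at hfin
  have h9 : ((bohr Γ (2 * r)).card : ℝ) ≤ 81 ^ d * (bohr Γ r).card := by
    have := card_bohr_two_mul_le Γ hr
    calc ((bohr Γ (2 * r)).card : ℝ) ≤ 81 ^ Γ.card * (bohr Γ r).card := by exact_mod_cast this
      _ ≤ _ := by gcongr; norm_num
  have h10 : (2 : ℝ) ≤ (1 + ε) ^ k := by
    have := one_add_mul_le_pow (show (-2 : ℝ) ≤ ε by linarith) k
    have h11 : 1 ≤ k * ε := by rw [div_le_iff₀ hε] at hk1; exact hk1
    linarith
  have h12 : (128 : ℝ) ^ (d + 1) ≤ (1 + ε) ^ N := by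
    calc (128 : ℝ) ^ (d + 1) = 2 ^ (7 * (d + 1)) := by rw [pow_mul]; norm_num
      _ ≤ ((1 + ε) ^ k) ^ (7 * (d + 1)) := by gcongr
      _ = _ := by rw [← pow_mul]
  have h13 : (81 : ℝ) ^ d < 128 ^ (d + 1) := by
    calc (81 : ℝ) ^ d ≤ 128 ^ d := by gcongr; norm_num
      _ < 128 ^ (d + 1) := by apply pow_lt_pow_right₀ <;> simp
  have h14 := card_bohr_pos Γ hr.le
  nlinarith

theorem card_filter_add_notMem_bohr_le (Γ : Finset (AddChar G ℂ)) {r s ε : ℝ} {y : G}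
    (hs : 0 ≤ s) (hy : y ∈ bohr Γ s)
    (h : ((bohr Γ (r + s)).card : ℝ) ≤ (1 + ε) * (bohr Γ r).card) :
    (((bohr Γ r).filter fun b => b + y ∉ bohr Γ r).card : ℝ) ≤ ε * (bohr Γ r).card := by
  have h1 : ((bohr Γ r).filter fun b => b + y ∉ bohr Γ r).card ≤
      (bohr Γ (r + s) \ bohr Γ r).card := by
    refine Finset.card_le_card_of_injOn (fun b => b + y) ?_ (fun x _ y _ h => by simpa using h)
    intro b hb
    have hb' := Finset.mem_filter.1 hb
    exact Finset.mem_sdiff.2 ⟨add_mem_bohr hb'.1 hy le_rfl, hb'.2⟩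
  have h2 : bohr Γ r ⊆ bohr Γ (r + s) := bohr_mono (Finset.Subset.refl _) (by linarith)
  have h3 := Finset.card_sdiff_add_card_eq_card h2
  have h4 : ((bohr Γ (r + s) \ bohr Γ r).card : ℝ) + (bohr Γ r).card = (bohr Γ (r + s)).card := by
    exact_mod_cast h3
  have h5 : (((bohr Γ r).filter fun b => b + y ∉ bohr Γ r).card : ℝ) ≤
      (bohr Γ (r + s) \ bohr Γ r).card := by exact_mod_cast h1
  linarith

end Bohr

/-! ### Moments of correlations and sifting. -/

section Moments

variable {G : Type*} [AddCommGroup G] [Fintype G] [DecidableEq G]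

/-- The unnormalised correlation `x ↦ ∑ y, f y * g (y + x)`. -/
def corr (f g : G → ℝ) (x : G) : ℝ := ∑ y, f y * g (y + x)

/-- The unnormalised convolution `x ↦ ∑ y, f y * g (x - y)`. -/
def sconv (f g : G → ℝ) (x : G) : ℝ := ∑ y, f y * g (x - y)

/-- The indicator function of a finite set. -/
def ofSet (A : Finset G) (x : G) : ℝ := if x ∈ A then 1 else 0

theorem ofSet_nonneg (A : Finset G) (x : G) : 0 ≤ ofSet A x := by
  unfold ofSet; split_ifs <;> norm_num

theorem sum_ofSet_mul (A : Finset G) (f : G → ℝ) : ∑ x, ofSet A x * f x = ∑ x ∈ A, f x := by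
  simp [ofSet]

theorem sum_ofSet (A : Finset G) : ∑ x, ofSet A x = A.card := by
  simp [ofSet]

/-- The free base point `z` will become the summation variable of a second correlation; each tuple
`u` then contributes a function of `z` times the same function of `z + x`. -/
theorem corr_pow (g : G → ℝ) (q : ℕ) (z x : G) :
    corr g g x ^ q = ∑ u : Fin q → G, (∏ i, g (z + u i)) * ∏ i, g (z + x + u i) := by
  have h : corr g g x = ∑ y, g (z + y) * g (z + x + y) := by
    unfold corr
    rw [← Equiv.sum_comp (Equiv.addLeft z)]
    refine Finset.sum_congr rfl fun y _ => ?_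
    simp only [Equiv.coe_addLeft]
    rw [add_right_comm]
  rw [h, Fintype.sum_pow]
  simp only [Finset.prod_mul_distrib]

theorem sconv_pow (g : G → ℝ) (q : ℕ) (z x t : G) :
    sconv g g (x + t) ^ q =
      ∑ u : Fin q → G, (∏ i, g (z + u i)) * ∏ i, g (x - z + (t - u i)) := by
  have h : sconv g g (x + t) = ∑ y, g (z + y) * g (x - z + (t - y)) := by
    unfold sconv
    rw [← Equiv.sum_comp (Equiv.addLeft z)]
    refine Finset.sum_congr rfl fun y _ => ?_
    simp only [Equiv.coe_addLeft]
    congr 2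
    abel
  rw [h, Fintype.sum_pow]
  simp only [Finset.prod_mul_distrib]

theorem sum_mul_corr_pow_mul_corr (w g h : G → ℝ) (q : ℕ) :
    ∑ x, w x * corr g g x ^ q * corr h h x =
      ∑ u : Fin q → G, ∑ z, ∑ z', w (z' - z) * (h z * ∏ i, g (z + u i)) *
        (h z' * ∏ i, g (z' + u i)) := by
  calc _ = ∑ x, ∑ z, ∑ u : Fin q → G, w x * (h z * ∏ i, g (z + u i)) *
        (h (z + x) * ∏ i, g (z + x + u i)) := by
        refine Finset.sum_congr rfl fun x _ => ?_
        conv_lhs => rw [show corr h h x = ∑ z, h z * h (z + x) from rfl, Finset.mul_sum]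
        refine Finset.sum_congr rfl fun z _ => ?_
        rw [corr_pow g q z x, Finset.mul_sum, Finset.sum_mul]
        refine Finset.sum_congr rfl fun u _ => ?_
        ring
    _ = ∑ z, ∑ u : Fin q → G, ∑ x, w x * (h z * ∏ i, g (z + u i)) *
        (h (z + x) * ∏ i, g (z + x + u i)) := by
        rw [Finset.sum_comm]
        exact Finset.sum_congr rfl fun z _ => Finset.sum_comm
    _ = ∑ u : Fin q → G, ∑ z, ∑ x, w x * (h z * ∏ i, g (z + u i)) *
        (h (z + x) * ∏ i, g (z + x + u i)) := Finset.sum_comm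
    _ = _ := by
        refine Finset.sum_congr rfl fun u _ => Finset.sum_congr rfl fun z _ => ?_
        conv_rhs => rw [← Equiv.sum_comp (Equiv.addLeft z)]
        simp

/-- This identity plays the part of positive-definiteness on the Fourier side: it makes every moment
nonnegative, including the odd ones. -/
theorem sum_corr_pow_mul_corr (g h : G → ℝ) (q : ℕ) :
    ∑ x, corr g g x ^ q * corr h h x =
      ∑ u : Fin q → G, (∑ z, h z * ∏ i, g (z + u i)) ^ 2 := by
  have := sum_mul_corr_pow_mul_corr (fun _ => 1) g h q
  simp only [one_mul] at this
  rw [this]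
  refine Finset.sum_congr rfl fun u _ => ?_
  rw [sq, Finset.sum_mul_sum]

theorem sum_corr_pow_mul_corr_nonneg (g h : G → ℝ) (q : ℕ) :
    0 ≤ ∑ x, corr g g x ^ q * corr h h x := by
  rw [sum_corr_pow_mul_corr]; positivity

/-- Expanding as for correlations gives `∑ H u * H (t - u)` in place of `∑ H u ^ 2`; apply `2xy ≤ x²
+ y²` and the bijection `u ↦ t - u`. -/
theorem sum_sconv_pow_mul_sconv_le (g h : G → ℝ) (q : ℕ) (t : G) :
    ∑ x, sconv g g (x + t) ^ q * sconv h h x ≤ ∑ x, corr g g x ^ q * corr h h x := by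
  let H : (Fin q → G) → ℝ := fun u => ∑ z, h z * ∏ i, g (z + u i)
  have h1 : ∑ x, sconv g g (x + t) ^ q * sconv h h x =
      ∑ u : Fin q → G, H u * H (fun i => t - u i) := by
    calc _ = ∑ x, ∑ z, ∑ u : Fin q → G, (h z * ∏ i, g (z + u i)) *
          (h (x - z) * ∏ i, g (x - z + (t - u i))) := by
          refine Finset.sum_congr rfl fun x _ => ?_
          conv_lhs => rw [show sconv h h x = ∑ z, h z * h (x - z) from rfl, Finset.mul_sum]
          refine Finset.sum_congr rfl fun z _ => ?_
          rw [sconv_pow g q z x, Finset.sum_mul]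
          refine Finset.sum_congr rfl fun u _ => ?_
          ring
      _ = ∑ z, ∑ u : Fin q → G, ∑ x, (h z * ∏ i, g (z + u i)) *
          (h (x - z) * ∏ i, g (x - z + (t - u i))) := by
          rw [Finset.sum_comm]
          exact Finset.sum_congr rfl fun z _ => Finset.sum_comm
      _ = ∑ u : Fin q → G, ∑ z, ∑ x, (h z * ∏ i, g (z + u i)) *
          (h (x - z) * ∏ i, g (x - z + (t - u i))) := Finset.sum_comm
      _ = _ := by
          refine Finset.sum_congr rfl fun u _ => ?_
          rw [Finset.sum_mul]
          refine Finset.sum_congr rfl fun z _ => ?_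
          rw [← Finset.mul_sum]
          congr 1
          rw [← Equiv.sum_comp (Equiv.addRight z)]
          simp only [Equiv.coe_addRight, add_sub_cancel_right]
          rfl
  have h2 : ∑ u : Fin q → G, H (fun i => t - u i) ^ 2 = ∑ u : Fin q → G, H u ^ 2 :=
    Equiv.sum_comp (Equiv.piCongrRight fun _ : Fin q => Equiv.subLeft t) fun u => H u ^ 2
  rw [h1, sum_corr_pow_mul_corr]
  change _ ≤ ∑ u : Fin q → G, H u ^ 2
  have h3 : ∑ u : Fin q → G, H u * H (fun i => t - u i) ≤
      ∑ u : Fin q → G, (H u ^ 2 + H (fun i => t - u i) ^ 2) / 2 :=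
    Finset.sum_le_sum fun u _ => by nlinarith [sq_nonneg (H u - H fun i => t - u i)]
  rw [← Finset.sum_div, Finset.sum_add_distrib, h2] at h3
  linarith

theorem pow_le_choose_nine_mul (p : ℕ) : (8 : ℝ) ^ p ≤ (9 * p).choose p := by
  have h1 := Nat.pow_le_choose (α := ℝ) p (9 * p)
  refine le_trans ?_ h1
  rw [le_div_iff₀ (by positivity)]
  have h2 : (p.factorial : ℝ) ≤ p ^ p := by exact_mod_cast Nat.factorial_le_pow p
  calc (8 : ℝ) ^ p * p.factorial ≤ 8 ^ p * p ^ p := by gcongr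
    _ = (8 * p : ℝ) ^ p := by rw [mul_pow]
    _ ≤ _ := by
      gcongr
      have : 8 * p ≤ 9 * p + 1 - p := by omega
      exact_mod_cast this

/-- Unbalancing: every term of the binomial expansion is nonnegative, so the term of degree `p` may
be kept alone. Its coefficient, at least `8^p`, beats the loss `4^p` in the hypothesis. -/
theorem two_pow_le_sum_add_corr_pow (g h : G → ℝ) {N S : ℝ} (hN : 0 ≤ N) (p : ℕ)
    (hp : N ^ p * S ≤ 4 ^ p * ∑ x, corr g g x ^ p * corr h h x) :
    2 ^ p * N ^ (9 * p) * S ≤ ∑ x, (corr g g x + N) ^ (9 * p) * corr h h x := by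
  have h1 : ∑ x, (corr g g x + N) ^ (9 * p) * corr h h x =
      ∑ k ∈ Finset.range (9 * p + 1), N ^ (9 * p - k) * (9 * p).choose k *
        ∑ x, corr g g x ^ k * corr h h x := by
    simp only [add_pow, Finset.sum_mul, Finset.mul_sum]
    rw [Finset.sum_comm]
    refine Finset.sum_congr rfl fun k _ => Finset.sum_congr rfl fun x _ => ?_
    ring
  rw [h1]
  have h2 : N ^ (9 * p - p) * (9 * p).choose p * ∑ x, corr g g x ^ p * corr h h x ≤
      ∑ k ∈ Finset.range (9 * p + 1), N ^ (9 * p - k) * (9 * p).choose k *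
        ∑ x, corr g g x ^ k * corr h h x := by
    refine Finset.single_le_sum (f := fun k => N ^ (9 * p - k) * ((9 * p).choose k : ℝ) *
      ∑ x, corr g g x ^ k * corr h h x) (fun k _ => ?_) (by simp; omega)
    have := sum_corr_pow_mul_corr_nonneg g h k
    positivity
  refine le_trans ?_ h2
  have h3 := sum_corr_pow_mul_corr_nonneg g h p
  have h4 : (9 * p - p) + p = 9 * p := by omega
  have h5 : (8 : ℝ) ^ p = 2 ^ p * 4 ^ p := by rw [← mul_pow]; norm_num
  calc 2 ^ p * N ^ (9 * p) * S = N ^ (9 * p - p) * 2 ^ p * (N ^ p * S) := by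
        rw [← h4, pow_add]; simp only [h4]; ring
    _ ≤ N ^ (9 * p - p) * 2 ^ p * (4 ^ p * ∑ x, corr g g x ^ p * corr h h x) := by gcongr
    _ = N ^ (9 * p - p) * 8 ^ p * ∑ x, corr g g x ^ p * corr h h x := by rw [h5]; ring
    _ ≤ _ := by
      gcongr
      exact pow_le_choose_nine_mul p

/-- Take `D u` to be `Y` intersected with the translates `A - u i`. The moments are sums over `u` of
pair counts in `D u`, while `∑ |D u| = |Y| |A|^q`. The hypothesis therefore yields some `u` for
which the weighted pair count plus `θ |Y| |D u|` is below `|D u|²`; this bounds the weight and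
forces `D u` to be large. -/
theorem exists_sifted (A Y : Finset G) (w : G → ℝ) (q : ℕ) (θ : ℝ)
    (h : ∑ x, w x * corr (ofSet A) (ofSet A) x ^ q * corr (ofSet Y) (ofSet Y) x +
        θ * Y.card ^ 2 * A.card ^ q <
      ∑ x, corr (ofSet A) (ofSet A) x ^ q * corr (ofSet Y) (ofSet Y) x)
    (hw : ∀ x, 0 ≤ w x) (hθ : 0 ≤ θ) :
    ∃ D ⊆ Y, θ * Y.card ≤ D.card ∧ 0 < D.card ∧
      ∑ z ∈ D, ∑ z' ∈ D, w (z' - z) ≤ D.card ^ 2 := by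
  let D : (Fin q → G) → Finset G := fun u => Y.filter fun z => ∀ i, z + u i ∈ A
  have hD : ∀ u z, ofSet Y z * ∏ i, ofSet A (z + u i) = ofSet (D u) z := by
    intro u z
    simp only [ofSet, Finset.prod_boole, D, Finset.mem_filter, Finset.mem_univ, true_imp_iff]
    by_cases h1 : z ∈ Y <;> by_cases h2 : ∀ i, z + u i ∈ A <;> simp [h1, h2]
  rw [sum_mul_corr_pow_mul_corr, sum_corr_pow_mul_corr] at h
  simp only [hD, sum_ofSet] at h
  have h1 : ∑ u : Fin q → G, ((D u).card : ℝ) = Y.card * A.card ^ q := by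
    calc ∑ u : Fin q → G, ((D u).card : ℝ) = ∑ u : Fin q → G, ∑ z, ofSet (D u) z := by
          simp only [sum_ofSet]
      _ = ∑ z, ∑ u : Fin q → G, ofSet Y z * ∏ i, ofSet A (z + u i) := by
          rw [Finset.sum_comm]; simp only [hD]
      _ = ∑ z, ofSet Y z * A.card ^ q := by
          refine Finset.sum_congr rfl fun z _ => ?_
          rw [← Finset.mul_sum, ← Fintype.sum_pow fun y => ofSet A (z + y),
            ← sum_ofSet A, ← Equiv.sum_comp (Equiv.addLeft z) (ofSet A)]
          rfl
      _ = _ := by rw [← Finset.sum_mul, sum_ofSet]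
  have h2 : θ * Y.card ^ 2 * A.card ^ q = ∑ u : Fin q → G, θ * Y.card * ((D u).card : ℝ) := by
    rw [← Finset.mul_sum, h1]; ring
  rw [h2, ← Finset.sum_add_distrib] at h
  obtain ⟨u, -, hu⟩ := Finset.exists_lt_of_sum_lt h
  have h3 : ∑ z, ∑ z', w (z' - z) * ofSet (D u) z * ofSet (D u) z' =
      ∑ z ∈ D u, ∑ z' ∈ D u, w (z' - z) := by
    rw [← sum_ofSet_mul (D u) fun z => ∑ z' ∈ D u, w (z' - z)]
    refine Finset.sum_congr rfl fun z _ => ?_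
    rw [← sum_ofSet_mul (D u) fun z' => w (z' - z), Finset.mul_sum]
    refine Finset.sum_congr rfl fun z' _ => ?_
    ring
  rw [h3] at hu
  have h4 : 0 ≤ ∑ z ∈ D u, ∑ z' ∈ D u, w (z' - z) :=
    Finset.sum_nonneg fun z _ => Finset.sum_nonneg fun z' _ => hw _
  have h5 : 0 ≤ θ * Y.card * ((D u).card : ℝ) := by positivity
  have h6 : (0 : ℝ) < (D u).card := by
    rcases (Nat.cast_nonneg (α := ℝ) (D u).card).eq_or_lt with h0 | h0
    · rw [← h0] at hu h5; nlinarith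
    · exact h0
  refine ⟨D u, Finset.filter_subset _ _, ?_, by exact_mod_cast h6, by linarith⟩
  by_contra! hlt
  nlinarith

end Moments

/-! ### From scarcity of progressions to a set with popular differences. -/

section Lift

variable {G : Type*} [AddCommGroup G] [Fintype G] [DecidableEq G]

theorem corr_ofSet (A B : Finset G) (x : G) :
    corr (ofSet A) (ofSet B) x = (A.filter fun y => y + x ∈ B).card := by
  unfold corr
  rw [sum_ofSet_mul]
  simp [ofSet]

theorem corr_ofSet_bounds {A B : Finset G} (hAB : A ⊆ B) {ε : ℝ} {x : G}
    (hx : ((B.filter fun b => b + x ∉ B).card : ℝ) ≤ ε * B.card) :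
    (A.card : ℝ) - ε * B.card ≤ corr (ofSet A) (ofSet B) x ∧
      corr (ofSet A) (ofSet B) x ≤ A.card := by
  rw [corr_ofSet]
  have h1 := Finset.card_filter_add_card_filter_not (s := A) (fun y => y + x ∈ B)
  have h2 : ((A.filter fun y => y + x ∈ B).card : ℝ) + (A.filter fun y => y + x ∉ B).card =
      A.card := by exact_mod_cast h1
  have h3 : ((A.filter fun y => y + x ∉ B).card : ℝ) ≤ (B.filter fun y => y + x ∉ B).card := by
    exact_mod_cast Finset.card_le_card (Finset.filter_subset_filter _ hAB)
  have h4 : (0 : ℝ) ≤ (A.filter fun y => y + x ∉ B).card := by positivity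
  constructor <;> linarith

theorem corr_symm (f g : G → ℝ) (x : G) : corr f g x = corr g f (-x) := by
  unfold corr
  rw [← Equiv.sum_comp (Equiv.addRight x) fun y => g y * f (y + -x)]
  refine Finset.sum_congr rfl fun y _ => ?_
  simp [mul_comm]

theorem sconv_comm (f g : G → ℝ) (x : G) : sconv f g x = sconv g f x := by
  unfold sconv
  rw [← Equiv.sum_comp (Equiv.subLeft x) fun y => g y * f (x - y)]
  refine Finset.sum_congr rfl fun y _ => ?_
  simp [mul_comm]

theorem sconv_ofSet_eq_corr (f : G → ℝ) {B : Finset G} (hB : ∀ x ∈ B, -x ∈ B) (x : G) :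
    sconv f (ofSet B) x = corr f (ofSet B) (-x) := by
  unfold sconv corr ofSet
  refine Finset.sum_congr rfl fun y _ => ?_
  have : x - y ∈ B ↔ y + -x ∈ B := by
    constructor
    · intro h; have := hB _ h; rwa [neg_sub, sub_eq_add_neg] at this
    · intro h; have := hB _ h; rwa [neg_add_rev, neg_neg, ← sub_eq_add_neg] at this
  simp only [this]

/-- The balanced function of `A` relative to `B`, where `a` stands for the density. -/
def balanced (A B : Finset G) (a : ℝ) (x : G) : ℝ := ofSet A x - a * ofSet B x

theorem corr_balanced (A B : Finset G) (a : ℝ) (x : G) :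
    corr (balanced A B a) (balanced A B a) x = corr (ofSet A) (ofSet A) x -
      a * (corr (ofSet A) (ofSet B) x + corr (ofSet A) (ofSet B) (-x)) +
        a ^ 2 * corr (ofSet B) (ofSet B) x := by
  rw [← corr_symm (ofSet B) (ofSet A) x]
  simp only [corr, balanced, Finset.mul_sum, ← Finset.sum_sub_distrib, ← Finset.sum_add_distrib]
  refine Finset.sum_congr rfl fun y _ => ?_
  ring

theorem sconv_balanced (A B : Finset G) (a : ℝ) (x : G) :
    sconv (balanced A B a) (balanced A B a) x = sconv (ofSet A) (ofSet A) x -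
      a * (2 * sconv (ofSet A) (ofSet B) x) + a ^ 2 * sconv (ofSet B) (ofSet B) x := by
  rw [two_mul]
  nth_rw 3 [sconv_comm]
  simp only [sconv, balanced, Finset.mul_sum, ← Finset.sum_sub_distrib, ← Finset.sum_add_distrib]
  refine Finset.sum_congr rfl fun y _ => ?_
  ring

/-- For shifts almost preserving `B`, the mixed correlations of `A` with `B` are nearly `a |B|`, so
balancing subtracts about `a² |B|`. -/
theorem corr_balanced_bounds {A B : Finset G} (hAB : A ⊆ B) {a ε : ℝ} (ha : 0 ≤ a)
    (hA : (A.card : ℝ) = a * B.card) {x : G}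
    (hx : ((B.filter fun b => b + x ∉ B).card : ℝ) ≤ ε * B.card)
    (hx' : ((B.filter fun b => b + -x ∉ B).card : ℝ) ≤ ε * B.card) :
    corr (ofSet A) (ofSet A) x - a ^ 2 * B.card - a ^ 2 * ε * B.card ≤
        corr (balanced A B a) (balanced A B a) x ∧
      corr (balanced A B a) (balanced A B a) x ≤
        corr (ofSet A) (ofSet A) x - a ^ 2 * B.card + 2 * a * ε * B.card := by
  have h1 := corr_ofSet_bounds hAB hx
  have h2 := corr_ofSet_bounds hAB hx'
  have h3 := corr_ofSet_bounds (Finset.Subset.refl B) hx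
  rw [corr_balanced]
  rw [hA] at h1 h2
  constructor
  · nlinarith [mul_le_mul_of_nonneg_left h1.2 ha, mul_le_mul_of_nonneg_left h2.2 ha,
      mul_le_mul_of_nonneg_left h3.1 (sq_nonneg a)]
  · nlinarith [mul_le_mul_of_nonneg_left h1.1 ha, mul_le_mul_of_nonneg_left h2.1 ha,
      mul_le_mul_of_nonneg_left h3.2 (sq_nonneg a)]

theorem sconv_balanced_le {A B : Finset G} (hAB : A ⊆ B) (hB : ∀ x ∈ B, -x ∈ B) {a ε : ℝ}
    (ha : 0 ≤ a) (hA : (A.card : ℝ) = a * B.card) {x : G}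
    (hx : ((B.filter fun b => b + -x ∉ B).card : ℝ) ≤ ε * B.card) :
    sconv (balanced A B a) (balanced A B a) x ≤
      sconv (ofSet A) (ofSet A) x - a ^ 2 * B.card + 2 * a * ε * B.card := by
  have h2 := corr_ofSet_bounds hAB hx
  have h3 := corr_ofSet_bounds (Finset.Subset.refl B) hx
  rw [sconv_balanced, sconv_ofSet_eq_corr _ hB, sconv_ofSet_eq_corr _ hB]
  rw [hA] at h2
  nlinarith [mul_le_mul_of_nonneg_left h2.1 ha, mul_le_mul_of_nonneg_left h3.2 (sq_nonneg a)]

theorem sum_corr_ofSet (Y : Finset G) : ∑ x, corr (ofSet Y) (ofSet Y) x = (Y.card : ℝ) ^ 2 := by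
  unfold corr
  rw [Finset.sum_comm]
  have : ∀ y : G, ∑ x, ofSet Y y * ofSet Y (y + x) = ofSet Y y * Y.card := by
    intro y
    rw [← Finset.mul_sum, ← sum_ofSet Y, ← Equiv.sum_comp (Equiv.addLeft y) (ofSet Y)]
    rfl
  simp only [this]
  rw [← Finset.sum_mul, sum_ofSet, sq]

theorem sconv_nonneg (A B : Finset G) (x : G) : 0 ≤ sconv (ofSet A) (ofSet B) x :=
  Finset.sum_nonneg fun _ _ => mul_nonneg (ofSet_nonneg _ _) (ofSet_nonneg _ _)

theorem corr_nonneg (A B : Finset G) (x : G) : 0 ≤ corr (ofSet A) (ofSet B) x :=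
  Finset.sum_nonneg fun _ _ => mul_nonneg (ofSet_nonneg _ _) (ofSet_nonneg _ _)

theorem sum_sconv_sub_eq {Y X : Finset G} {x : G}
    (hX : ∀ y ∈ Y, ∀ y' ∈ Y, x - y - y' ∈ X) :
    ∑ z ∈ X, sconv (ofSet Y) (ofSet Y) (x - z) = (Y.card : ℝ) ^ 2 := by
  unfold sconv
  rw [Finset.sum_comm]
  have : ∀ y : G, ∑ z ∈ X, ofSet Y y * ofSet Y (x - z - y) = ofSet Y y * Y.card := by
    intro y
    by_cases hy : y ∈ Y
    · rw [← Finset.mul_sum, ← sum_ofSet Y, ← Equiv.sum_comp (Equiv.subLeft (x - y)) (ofSet Y)]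
      congr 1
      have h1 : ∑ z ∈ X, ofSet Y (x - z - y) = ∑ z, ofSet Y (x - z - y) := by
        refine Finset.sum_subset (Finset.subset_univ _) fun z _ hz => ?_
        unfold ofSet
        rw [if_neg]
        intro h
        apply hz
        have := hX y hy _ h
        rwa [show x - y - (x - z - y) = z by abel] at this
      rw [h1]
      refine Finset.sum_congr rfl fun z _ => ?_
      simp only [Equiv.subLeft_apply]
      congr 1; abel
    · simp [ofSet, hy]
  simp only [this]
  rw [← Finset.sum_mul, sum_ofSet, sq]

/-- On `C` the balanced self-convolution averages at most `-N / 2`, so Jensen with the even exponent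
`p` bounds its `p`-th moment below. To pass to correlations, the uniform weight on `C` is dominated
by translates of `1_Y * 1_Y` over `X`, at the cost `|X| / |C| ≤ 2^p`; each translate is handled by
`sum_sconv_pow_mul_sconv_le`. -/
theorem moment_lower_bound {A B Y C X : Finset G} (hAB : A ⊆ B) (hB : ∀ x ∈ B, -x ∈ B)
    {a ε : ℝ} (ha : 0 ≤ a) (hεa : ε ≤ a / 8)
    (hA : (A.card : ℝ) = a * B.card)
    (hC : ∀ x ∈ C, ((B.filter fun b => b + -x ∉ B).card : ℝ) ≤ ε * B.card)
    (hC0 : C.Nonempty)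
    (hX : ∀ x ∈ C, ∀ y ∈ Y, ∀ y' ∈ Y, x - y - y' ∈ X) {p : ℕ} (hp : Even p)
    (hXC : (X.card : ℝ) ≤ 2 ^ p * C.card)
    (hfew : ∑ x ∈ C, sconv (ofSet A) (ofSet A) x ≤ a ^ 2 * B.card * C.card / 4) :
    (a ^ 2 * B.card) ^ p * (Y.card : ℝ) ^ 2 ≤ 4 ^ p *
      ∑ x, corr (balanced A B a) (balanced A B a) x ^ p * corr (ofSet Y) (ofSet Y) x := by
  set g := balanced A B a with hg
  set N : ℝ := a ^ 2 * B.card with hN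
  have hN0 : 0 ≤ N := by positivity
  have hc : (0 : ℝ) < C.card := by exact_mod_cast hC0.card_pos
  have h1 : N / 2 ≤ ∑ x ∈ C, (1 / C.card : ℝ) * (- sconv g g x) := by
    rw [← Finset.mul_sum, one_div, inv_mul_eq_div, le_div_iff₀ hc, Finset.sum_neg_distrib]
    have h2 : ∑ x ∈ C, sconv g g x ≤ ∑ x ∈ C, (sconv (ofSet A) (ofSet A) x - 3 / 4 * N) := by
      refine Finset.sum_le_sum fun x hx => ?_
      refine (sconv_balanced_le hAB hB ha hA (hC x hx)).trans ?_
      have : a * ε * B.card ≤ a * (a / 8) * B.card := by gcongr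
      rw [hN]; nlinarith
    rw [Finset.sum_sub_distrib, Finset.sum_const, nsmul_eq_mul] at h2
    linarith
  have h3 : (N / 2) ^ p * C.card ≤ ∑ x ∈ C, sconv g g x ^ p := by
    have h4 := Real.pow_arith_mean_le_arith_mean_pow_of_even C (fun _ => (1 / C.card : ℝ))
      (fun x => - sconv g g x) (fun _ _ => by positivity) (by simp [hc.ne']) hp
    simp only [hp.neg_pow] at h4
    have h5 := (pow_le_pow_left₀ (by positivity) h1 p).trans h4
    rwa [← Finset.mul_sum, one_div, inv_mul_eq_div, le_div_iff₀ hc] at h5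
  set ν : G → ℝ := sconv (ofSet Y) (ofSet Y) with hν
  set Mom : ℝ := ∑ x, corr g g x ^ p * corr (ofSet Y) (ofSet Y) x with hMom
  have h6 : (∑ x ∈ C, sconv g g x ^ p) * (Y.card : ℝ) ^ 2 ≤ X.card * Mom := by
    calc (∑ x ∈ C, sconv g g x ^ p) * (Y.card : ℝ) ^ 2
        = ∑ x ∈ C, ∑ z ∈ X, sconv g g x ^ p * ν (x - z) := by
          rw [Finset.sum_mul]
          refine Finset.sum_congr rfl fun x hx => ?_
          rw [← Finset.mul_sum, sum_sconv_sub_eq (hX x hx)]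
      _ = ∑ z ∈ X, ∑ x ∈ C, sconv g g x ^ p * ν (x - z) := Finset.sum_comm
      _ ≤ ∑ z ∈ X, ∑ x, sconv g g x ^ p * ν (x - z) := by
          refine Finset.sum_le_sum fun z _ =>
            Finset.sum_le_sum_of_subset_of_nonneg (Finset.subset_univ _) fun x _ _ => ?_
          exact mul_nonneg (hp.pow_nonneg _) (sconv_nonneg _ _ _)
      _ = ∑ z ∈ X, ∑ x, sconv g g (x + z) ^ p * ν x := by
          refine Finset.sum_congr rfl fun z _ => ?_
          rw [← Equiv.sum_comp (Equiv.addRight z)]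
          simp
      _ ≤ ∑ z ∈ X, Mom := Finset.sum_le_sum fun z _ => sum_sconv_pow_mul_sconv_le _ _ _ _
      _ = X.card * Mom := by rw [Finset.sum_const, nsmul_eq_mul]
  have hMom0 : 0 ≤ Mom := sum_corr_pow_mul_corr_nonneg _ _ _
  have h7 : (N / 2) ^ p * C.card * (Y.card : ℝ) ^ 2 ≤ 2 ^ p * C.card * Mom :=
    (mul_le_mul_of_nonneg_right h3 (by positivity)).trans
      (h6.trans (mul_le_mul_of_nonneg_right hXC hMom0))
  have h8 : (N / 2) ^ p * (Y.card : ℝ) ^ 2 ≤ 2 ^ p * Mom := by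
    have : ((N / 2) ^ p * (Y.card : ℝ) ^ 2) * C.card ≤ (2 ^ p * Mom) * C.card := by linarith
    exact le_of_mul_le_mul_right this hc
  calc N ^ p * (Y.card : ℝ) ^ 2 = 2 ^ p * ((N / 2) ^ p * (Y.card : ℝ) ^ 2) := by
        rw [div_pow]; field_simp
    _ ≤ 2 ^ p * (2 ^ p * Mom) := by gcongr
    _ = 4 ^ p * Mom := by rw [← mul_assoc, ← mul_pow]; norm_num

theorem numeric_gap {p : ℕ} (hp : 40 ≤ p) :
    (1.01 : ℝ) ^ (9 * p) * (1000 * 1.02 ^ (9 * p) + 1 / 2) + 1.03 ^ (9 * p) < 2 ^ p := by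
  have h1 : (1.01 : ℝ) ^ (9 * p) * 1.02 ^ (9 * p) ≤ 1.31 ^ p := by
    rw [← mul_pow, pow_mul]; gcongr; norm_num
  have h2 : (1.01 : ℝ) ^ (9 * p) ≤ 1.31 ^ p := by rw [pow_mul]; gcongr; norm_num
  have h3 : (1.03 : ℝ) ^ (9 * p) ≤ 1.31 ^ p := by rw [pow_mul]; gcongr; norm_num
  have h4 : (1.31 : ℝ) ^ p * 1.5 ^ p ≤ 2 ^ p := by rw [← mul_pow]; gcongr; norm_num
  have h5 : (1.5 : ℝ) ^ 40 ≤ 1.5 ^ p := pow_le_pow_right₀ (by norm_num) hp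
  have h6 : (2000 : ℝ) < 1.5 ^ 40 := by norm_num
  have h7 : (0 : ℝ) < 1.31 ^ p := by positivity
  nlinarith

/-- Unbalancing gains `2^p`, while `0.01 N` errors and unpopular differences cost only powers such
as `1.03^(9p)`. The large moment thus comes from popular differences, and sifting with weight `1000`
on the unpopular ones leaves at most a proportion `1/1000` of them among pairs from `D`. -/
theorem exists_sifted_of_few {A B Y C X : Finset G} (hAB : A ⊆ B) (hB : ∀ x ∈ B, -x ∈ B)
    (hY0 : Y.Nonempty) {a ε : ℝ} (ha : 0 < a) (hεa : ε ≤ a / 200)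
    (ha1 : a ≤ 1) (hA : (A.card : ℝ) = a * B.card) (hB0 : B.Nonempty)
    (hC : ∀ x ∈ C, ((B.filter fun b => b + -x ∉ B).card : ℝ) ≤ ε * B.card)
    (hYB : ∀ y ∈ Y, ∀ y' ∈ Y, ((B.filter fun b => b + (y - y') ∉ B).card : ℝ) ≤ ε * B.card)
    (hC0 : C.Nonempty)
    (hX : ∀ x ∈ C, ∀ y ∈ Y, ∀ y' ∈ Y, x - y - y' ∈ X) {p : ℕ} (hp : Even p) (hp40 : 40 ≤ p)
    (hXC : (X.card : ℝ) ≤ 2 ^ p * C.card)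
    (hfew : ∑ x ∈ C, sconv (ofSet A) (ofSet A) x ≤ a ^ 2 * B.card * C.card / 4) :
    ∃ D ⊆ Y, a ^ (9 * p) / 2 * Y.card ≤ D.card ∧ 0 < D.card ∧
      ∑ z ∈ D, ∑ z' ∈ D, (if corr (ofSet A) (ofSet A) (z' - z) ≤ 1.02 * (a * A.card)
        then (1000 : ℝ) else 0) ≤ D.card ^ 2 := by
  have hb : (0 : ℝ) < B.card := by exact_mod_cast hB0.card_pos
  have hy : (0 : ℝ) < Y.card := by exact_mod_cast hY0.card_pos
  set N : ℝ := a ^ 2 * B.card with hN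
  have hN0 : 0 < N := by positivity
  have hNA : a * A.card = N := by rw [hA, hN]; ring
  rw [hNA]
  set g := balanced A B a with hg
  set ν : G → ℝ := corr (ofSet Y) (ofSet Y) with hν
  set cA : G → ℝ := corr (ofSet A) (ofSet A) with hcA
  have hν0 : ∀ x, 0 ≤ ν x := corr_nonneg Y Y
  have hcA0 : ∀ x, 0 ≤ cA x := corr_nonneg A A
  set q := 9 * p with hq
  have hqe : Even q := hp.mul_left 9
  have hmom := moment_lower_bound hAB hB ha.le (by linarith) hA hC hC0 hX hp hXC hfew
  have hunb := two_pow_le_sum_add_corr_pow g (ofSet Y) hN0.le p hmom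
  set w : G → ℝ := fun x => if cA x ≤ 1.02 * N then 1000 else 0 with hw
  -- The factor `1 - w x / 1000` is the indicator of the popular `x`. At unpopular `x` the shifted
  -- correlation is at most `1.03 N`; at popular ones the error `N / 100` is absorbed into `1.01 *
  -- cA x`.
  have hpt : ∀ x, (corr g g x + N) ^ q * ν x ≤
      (1.03 * N) ^ q * ν x + 1.01 ^ q * ((1 - w x / 1000) * cA x ^ q * ν x) := by
    intro x
    rcases (hν0 x).eq_or_lt with h0 | h0
    · rw [← h0]; simp
    have hx : ∃ y ∈ Y, ∃ y' ∈ Y, x = y' - y := by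
      rw [hν, corr_ofSet] at h0
      have h1 : 0 < (Y.filter fun y => y + x ∈ Y).card := by exact_mod_cast h0
      obtain ⟨y, hy⟩ := Finset.card_pos.1 h1
      rw [Finset.mem_filter] at hy
      exact ⟨y, hy.1, y + x, hy.2, by abel⟩
    obtain ⟨y, hy, y', hy', rfl⟩ := hx
    have hbd := corr_balanced_bounds hAB ha.le hA (hYB y' hy' y hy)
      (by rw [neg_sub]; exact hYB y hy y' hy')
    have e1 : 2 * a * ε * B.card ≤ N / 100 := by
      have : a * ε * B.card ≤ a * (a / 200) * B.card := by gcongr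
      rw [hN]; nlinarith
    have e2 : a ^ 2 * ε * B.card ≤ N / 100 := by
      have : a ^ 2 * ε * B.card ≤ a ^ 2 * (1 / 200) * B.card := by gcongr; linarith
      rw [hN]; nlinarith
    have h2 : |corr g g (y' - y) + N| ≤ cA (y' - y) + N / 100 := by
      rw [abs_le]
      constructor
      · have := hcA0 (y' - y); linarith [hbd.1]
      · linarith [hbd.2]
    have h3 : (corr g g (y' - y) + N) ^ q ≤ (cA (y' - y) + N / 100) ^ q := by
      rw [← hqe.pow_abs]
      exact pow_le_pow_left₀ (abs_nonneg _) h2 q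
    by_cases hs : cA (y' - y) ≤ 1.02 * N
    · have h4 : w (y' - y) = 1000 := if_pos hs
      rw [h4]
      have h5 : (cA (y' - y) + N / 100) ^ q ≤ (1.03 * N) ^ q :=
        pow_le_pow_left₀ (add_nonneg (hcA0 _) (by positivity)) (by linarith) q
      have := mul_le_mul_of_nonneg_right (h3.trans h5) h0.le
      linarith
    · have h4 : w (y' - y) = 0 := if_neg hs
      rw [h4]
      push Not at hs
      have h5 : (cA (y' - y) + N / 100) ^ q ≤ (1.01 * cA (y' - y)) ^ q :=
        pow_le_pow_left₀ (add_nonneg (hcA0 _) (by positivity)) (by linarith) q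
      rw [mul_pow] at h5
      have h6 := mul_le_mul_of_nonneg_right (h3.trans h5) h0.le
      have h7 : 0 ≤ (1.03 * N) ^ q * ν (y' - y) := by positivity
      linarith
  have hsum := Finset.sum_le_sum fun x (_ : x ∈ univ) => hpt x
  rw [Finset.sum_add_distrib, ← Finset.mul_sum, ← Finset.mul_sum, sum_corr_ofSet] at hsum
  have hsplit : ∑ x, (1 - w x / 1000) * cA x ^ q * ν x ≤ ∑ x, cA x ^ q * ν x := by
    refine Finset.sum_le_sum fun x _ => ?_
    have h1 : 0 ≤ w x := by simp only [hw]; split_ifs <;> norm_num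
    have h2 : 0 ≤ cA x ^ q * ν x := mul_nonneg (pow_nonneg (hcA0 x) _) (hν0 x)
    nlinarith
  have hbad : ∑ x, w x * cA x ^ q * ν x ≤ 1000 * (1.02 * N) ^ q * (Y.card : ℝ) ^ 2 := by
    rw [← sum_corr_ofSet, Finset.mul_sum]
    refine Finset.sum_le_sum fun x _ => ?_
    refine mul_le_mul_of_nonneg_right ?_ (hν0 x)
    simp only [hw]
    split_ifs with hs
    · have := pow_le_pow_left₀ (hcA0 x) hs q
      linarith
    · rw [zero_mul]; positivity
  refine exists_sifted A Y w q (a ^ q / 2) ?_ ?_ (by positivity)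
  · have hnum := numeric_gap hp40
    rw [← hq] at hnum
    set T : ℝ := ∑ x, cA x ^ q * ν x with hT
    change ∑ x, w x * cA x ^ q * ν x + _ < T
    have h1 : a ^ q / 2 * (Y.card : ℝ) ^ 2 * (A.card : ℝ) ^ q = N ^ q * (Y.card : ℝ) ^ 2 / 2 := by
      rw [← hNA, mul_pow]; ring
    rw [h1]
    rw [mul_pow] at hbad hsum
    have hZ : 0 < N ^ q * (Y.card : ℝ) ^ 2 := by positivity
    have h2 := mul_lt_mul_of_pos_right hnum hZ
    have h101 : (0 : ℝ) < 1.01 ^ q := by positivity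
    have h3 : (1.01 : ℝ) ^ q * (∑ x, w x * cA x ^ q * ν x + N ^ q * (Y.card : ℝ) ^ 2 / 2) <
        1.01 ^ q * T := by
      nlinarith [mul_le_mul_of_nonneg_left hbad h101.le, mul_le_mul_of_nonneg_left hsplit h101.le]
    exact lt_of_mul_lt_mul_left h3 h101.le
  · intro x; simp only [hw]; split_ifs <;> norm_num

end Lift

/-! ### Almost-periodicity by random sampling. -/

section Sampling

variable {G : Type*} [AddCommGroup G] [Fintype G] [DecidableEq G]

theorem exp_mul_le_cosh_add_mul_sinh {x : ℝ} (hx : |x| ≤ 1) (l : ℝ) :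
    Real.exp (l * x) ≤ Real.cosh l + x * Real.sinh l := by
  rw [abs_le] at hx
  have h := convexOn_exp.2 (Set.mem_univ l) (Set.mem_univ (-l))
    (show 0 ≤ (1 + x) / 2 by linarith) (show 0 ≤ (1 - x) / 2 by linarith) (by ring)
  simp only [smul_eq_mul] at h
  rw [show (1 + x) / 2 * l + (1 - x) / 2 * -l = l * x by ring] at h
  rw [Real.cosh_eq, Real.sinh_eq]
  linarith

/-- Hoeffding's lemma: bound the exponential by its chord on `[-1, 1]`; the linear part cancels by
the zero mean. -/
theorem sum_exp_mul_le {D : Finset G} {X : G → ℝ} (hX : ∀ d ∈ D, |X d| ≤ 1)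
    (h0 : ∑ d ∈ D, X d = 0) (l : ℝ) :
    ∑ d ∈ D, Real.exp (l * X d) ≤ D.card * Real.exp (l ^ 2 / 2) := by
  calc ∑ d ∈ D, Real.exp (l * X d) ≤ ∑ d ∈ D, (Real.cosh l + X d * Real.sinh l) :=
        Finset.sum_le_sum fun d hd => exp_mul_le_cosh_add_mul_sinh (hX d hd) l
    _ = D.card * Real.cosh l := by
        rw [Finset.sum_add_distrib, ← Finset.sum_mul, h0, zero_mul, add_zero, Finset.sum_const,
          nsmul_eq_mul]
    _ ≤ _ := by gcongr; exact Real.cosh_le_exp_half_sq l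

theorem card_filter_lt_sum_le {D : Finset G} {X : G → ℝ} (hX : ∀ d ∈ D, |X d| ≤ 1)
    (h0 : ∑ d ∈ D, X d = 0) (n : ℕ) {ε : ℝ} (hε : 0 ≤ ε) :
    (((Fintype.piFinset fun _ : Fin n => D).filter fun v => n * ε < ∑ i, X (v i)).card : ℝ) ≤
      Real.exp (-(n * ε ^ 2 / 2)) * D.card ^ n := by
  set P := Fintype.piFinset fun _ : Fin n => D with hP
  have h1 : ∑ v ∈ P, Real.exp (ε * ∑ i, X (v i)) ≤ (D.card * Real.exp (ε ^ 2 / 2)) ^ n := by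
    calc ∑ v ∈ P, Real.exp (ε * ∑ i, X (v i)) = ∑ v ∈ P, ∏ i, Real.exp (ε * X (v i)) := by
          refine Finset.sum_congr rfl fun v _ => ?_
          rw [Finset.mul_sum, Real.exp_sum]
      _ = ∏ _i : Fin n, ∑ d ∈ D, Real.exp (ε * X d) := by
          rw [hP, Finset.sum_prod_piFinset D fun _ d => Real.exp (ε * X d)]
      _ = (∑ d ∈ D, Real.exp (ε * X d)) ^ n := by simp
      _ ≤ _ := by
          refine pow_le_pow_left₀ (Finset.sum_nonneg fun _ _ => (Real.exp_pos _).le) ?_ n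
          exact sum_exp_mul_le hX h0 ε
  have h2 : ((P.filter fun v => n * ε < ∑ i, X (v i)).card : ℝ) * Real.exp (ε * (n * ε)) ≤
      ∑ v ∈ P, Real.exp (ε * ∑ i, X (v i)) := by
    rw [← nsmul_eq_mul, ← Finset.sum_const]
    calc _ ≤ ∑ v ∈ P.filter fun v => n * ε < ∑ i, X (v i), Real.exp (ε * ∑ i, X (v i)) := by
          refine Finset.sum_le_sum fun v hv => ?_
          have := (Finset.mem_filter.1 hv).2
          gcongr
      _ ≤ _ := Finset.sum_le_sum_of_subset_of_nonneg (Finset.filter_subset _ _)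
          fun _ _ _ => (Real.exp_pos _).le
  have h3 : (D.card * Real.exp (ε ^ 2 / 2)) ^ n =
      (Real.exp (-(n * ε ^ 2 / 2)) * (D.card : ℝ) ^ n) * Real.exp (ε * (n * ε)) := by
    rw [mul_pow, ← Real.exp_nat_mul]
    rw [mul_assoc, mul_comm ((D.card : ℝ) ^ n) (Real.exp (ε * (n * ε))), ← mul_assoc,
      ← Real.exp_add, mul_comm]
    congr 2
    ring
  have h4 := h2.trans h1
  rw [h3] at h4
  exact le_of_mul_le_mul_right h4 (Real.exp_pos _)

theorem card_filter_lt_abs_sum_le {D : Finset G} {X : G → ℝ} (hX : ∀ d ∈ D, |X d| ≤ 1)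
    (h0 : ∑ d ∈ D, X d = 0) (n : ℕ) {ε : ℝ} (hε : 0 ≤ ε) :
    (((Fintype.piFinset fun _ : Fin n => D).filter fun v => n * ε < |∑ i, X (v i)|).card : ℝ) ≤
      2 * Real.exp (-(n * ε ^ 2 / 2)) * D.card ^ n := by
  have h1 := card_filter_lt_sum_le hX h0 n hε
  have h2 := card_filter_lt_sum_le (X := fun d => - X d) (D := D)
    (fun d hd => by rw [abs_neg]; exact hX d hd) (by rw [Finset.sum_neg_distrib, h0, neg_zero]) n hε
  have h3 : ((Fintype.piFinset fun _ : Fin n => D).filter fun v => n * ε < |∑ i, X (v i)|) ⊆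
      ((Fintype.piFinset fun _ : Fin n => D).filter fun v => n * ε < ∑ i, X (v i)) ∪
      ((Fintype.piFinset fun _ : Fin n => D).filter fun v => n * ε < ∑ i, - X (v i)) := by
    intro v hv
    rw [Finset.mem_filter, lt_abs] at hv
    rw [Finset.mem_union, Finset.mem_filter, Finset.mem_filter, Finset.sum_neg_distrib]
    tauto
  have h4 := (Finset.card_le_card h3).trans (Finset.card_union_le _ _)
  have h5 : (((Fintype.piFinset fun _ : Fin n => D).filter fun v =>
      n * ε < |∑ i, X (v i)|).card : ℝ) ≤
      ((Fintype.piFinset fun _ : Fin n => D).filter fun v => n * ε < ∑ i, X (v i)).card +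
      ((Fintype.piFinset fun _ : Fin n => D).filter fun v => n * ε < ∑ i, - X (v i)).card := by
    exact_mod_cast h4
  linarith

/-- The average of `s` over the translate `D + z`. -/
noncomputable def localAvg (D : Finset G) (s : G → ℝ) (z : G) : ℝ :=
  (∑ d ∈ D, s (d + z)) / D.card

theorem localAvg_mem_Icc (D : Finset G) {s : G → ℝ} (hs0 : ∀ x, 0 ≤ s x) (hs1 : ∀ x, s x ≤ 1)
    (z : G) : 0 ≤ localAvg D s z ∧ localAvg D s z ≤ 1 := by
  unfold localAvg
  refine ⟨div_nonneg (Finset.sum_nonneg fun _ _ => hs0 _) (Nat.cast_nonneg _),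
    div_le_one_of_le₀ ?_ (Nat.cast_nonneg _)⟩
  calc ∑ d ∈ D, s (d + z) ≤ ∑ d ∈ D, 1 := Finset.sum_le_sum fun _ _ => hs1 _
    _ = D.card := by simp

/-- Hoeffding's bound holds at each `z`; Markov's inequality over the samples then makes at least
half of them accurate at nearly every point of `Z`. -/
theorem card_le_two_mul_card_good {D : Finset G} (hD : D.Nonempty) (Z : Finset G) {s : G → ℝ}
    (hs0 : ∀ x, 0 ≤ s x) (hs1 : ∀ x, s x ≤ 1) (n : ℕ) {ε : ℝ} (hε : 0 ≤ ε) :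
    ((Fintype.piFinset fun _ : Fin n => D).card : ℝ) ≤
      2 * ((Fintype.piFinset fun _ : Fin n => D).filter fun v =>
        ((Z.filter fun z => n * ε < |∑ i, (s (v i + z) - localAvg D s z)|).card : ℝ) ≤
          4 * Real.exp (-(n * ε ^ 2 / 2)) * Z.card).card := by
  set P := Fintype.piFinset fun _ : Fin n => D with hP
  set η := Real.exp (-(n * ε ^ 2 / 2)) with hη
  have hη0 : 0 < η := Real.exp_pos _
  have hPc : (P.card : ℝ) = (D.card : ℝ) ^ n := by simp [hP]
  have hDc : (0 : ℝ) < D.card := by exact_mod_cast hD.card_pos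
  have h1 : ∀ z, ((P.filter fun v => n * ε < |∑ i, (s (v i + z) - localAvg D s z)|).card : ℝ) ≤
      2 * η * P.card := by
    intro z
    rw [hPc]
    refine card_filter_lt_abs_sum_le (X := fun d => s (d + z) - localAvg D s z) ?_ ?_ n hε
    · intro d _
      have h := localAvg_mem_Icc D hs0 hs1 z
      rw [abs_le]
      constructor
      · linarith [hs0 (d + z)]
      · linarith [hs1 (d + z)]
    · rw [Finset.sum_sub_distrib, Finset.sum_const, nsmul_eq_mul, localAvg]
      field_simp
      simp
  set bz : (Fin n → G) → ℕ := fun v =>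
    (Z.filter fun z => n * ε < |∑ i, (s (v i + z) - localAvg D s z)|).card with hbz
  have h2 : ∑ v ∈ P, (bz v : ℝ) ≤ Z.card * (2 * η * P.card) := by
    have h3 : ∑ v ∈ P, bz v =
        ∑ z ∈ Z, (P.filter fun v => n * ε < |∑ i, (s (v i + z) - localAvg D s z)|).card :=
      Finset.sum_card_bipartiteAbove_eq_sum_card_bipartiteBelow _
    rw [← Nat.cast_sum, h3, Nat.cast_sum, ← nsmul_eq_mul Z.card (2 * η * P.card),
      ← Finset.sum_const]
    exact Finset.sum_le_sum fun z _ => h1 z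
  have h4 := Finset.card_filter_add_card_filter_not (s := P)
    (fun v => (bz v : ℝ) ≤ 4 * η * Z.card)
  have h5 : ((P.filter fun v => (bz v : ℝ) ≤ 4 * η * Z.card).card : ℝ) +
      (P.filter fun v => ¬ (bz v : ℝ) ≤ 4 * η * Z.card).card = P.card := by exact_mod_cast h4
  have h6 : ((P.filter fun v => ¬ (bz v : ℝ) ≤ 4 * η * Z.card).card : ℝ) * (4 * η * Z.card) ≤
      ∑ v ∈ P, (bz v : ℝ) := by
    rw [← nsmul_eq_mul, ← Finset.sum_const]
    refine (Finset.sum_le_sum fun v hv => ?_).trans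
      (Finset.sum_le_sum_of_subset_of_nonneg (Finset.filter_subset _ _)
        fun _ _ _ => Nat.cast_nonneg _)
    exact (not_le.1 (Finset.mem_filter.1 hv).2).le
  have h7 : ((P.filter fun v => ¬ (bz v : ℝ) ≤ 4 * η * Z.card).card : ℝ) ≤ P.card / 2 := by
    rcases Z.eq_empty_or_nonempty with rfl | hZ
    · simp [hbz]; positivity
    · have hZc : (0 : ℝ) < Z.card := by exact_mod_cast hZ.card_pos
      have h8 := h6.trans h2
      have h9 : 0 < 4 * η * Z.card := by positivity
      refine le_of_mul_le_mul_right (h8.trans (le_of_eq ?_)) h9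
      ring
  linarith

/-- The Croot–Sisask argument. Good samples shifted by elements of `U` lie in `(D + U)^n`, so some
tuple `v` is a shift of a good sample by many `t ∈ U`. For each such `t`, the single sum `∑ s (v i +
z)` approximates `n` times the local average at `z + t`, so these averages agree with one another up
to few exceptional `z`. -/
theorem exists_almost_periods {D U : Finset G} (hD : D.Nonempty) (hU : U.Nonempty) (Z : Finset G)
    {s : G → ℝ} (hs0 : ∀ x, 0 ≤ s x) (hs1 : ∀ x, s x ≤ 1) {n : ℕ} (hn : 0 < n) {ε K : ℝ}
    (hε : 0 ≤ ε) (hK : ((D + U).card : ℝ) ≤ K * D.card) :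
    ∃ T ⊆ U, (U.card : ℝ) ≤ 2 * K ^ n * T.card ∧ ∀ t ∈ T, ∀ t' ∈ T,
      ((univ.filter fun z => z + t ∈ Z ∧ z + t' ∈ Z ∧
        2 * ε < |localAvg D s (z + t) - localAvg D s (z + t')|).card : ℝ) ≤
        8 * Real.exp (-(n * ε ^ 2 / 2)) * Z.card := by
  set P := Fintype.piFinset fun _ : Fin n => D with hP
  set η := Real.exp (-(n * ε ^ 2 / 2)) with hη
  set bs : (Fin n → G) → Finset G := fun v =>
    Z.filter fun z => n * ε < |∑ i, (s (v i + z) - localAvg D s z)| with hbs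
  set L := P.filter fun v => ((bs v).card : ℝ) ≤ 4 * η * Z.card with hL
  have hPL : (P.card : ℝ) ≤ 2 * L.card := card_le_two_mul_card_good hD Z hs0 hs1 n hε
  set Q := Fintype.piFinset fun _ : Fin n => D + U with hQ
  have hn' : (0 : ℝ) < n := by exact_mod_cast hn
  have hDc : (0 : ℝ) < D.card := by exact_mod_cast hD.card_pos
  have hQ0 : Q.Nonempty := by
    rw [hQ, Fintype.piFinset_nonempty]
    exact fun _ => hD.add hU
  have hQc : (0 : ℝ) < Q.card := by exact_mod_cast hQ0.card_pos
  have hQP : (Q.card : ℝ) ≤ K ^ n * P.card := by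
    have h1 : (Q.card : ℝ) = ((D + U).card : ℝ) ^ n := by simp [hQ]
    have h2 : (P.card : ℝ) = (D.card : ℝ) ^ n := by simp [hP]
    rw [h1, h2, ← mul_pow]
    exact pow_le_pow_left₀ (Nat.cast_nonneg _) hK n
  set Tv : (Fin n → G) → Finset G := fun v => U.filter fun u => (fun i => v i - u) ∈ L with hTv
  have h1 : (U.card : ℝ) * L.card ≤ ∑ v ∈ Q, ((Tv v).card : ℝ) := by
    have h3 : ∑ v ∈ Q, (Tv v).card =
        ∑ u ∈ U, (Q.filter fun v => (fun i => v i - u) ∈ L).card :=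
      Finset.sum_card_bipartiteAbove_eq_sum_card_bipartiteBelow _
    rw [← Nat.cast_sum, h3, ← nsmul_eq_mul, ← Finset.sum_const, Nat.cast_sum]
    refine Finset.sum_le_sum fun u hu => ?_
    norm_cast
    refine Finset.card_le_card_of_injOn (fun v i => v i + u) ?_ ?_
    · intro v hv
      have hv' : v ∈ L := hv
      have hvP : v ∈ P := (Finset.mem_filter.1 hv').1
      rw [hP, Fintype.mem_piFinset] at hvP
      simp only [Finset.coe_filter, Set.mem_ofPred_eq, hQ, Fintype.mem_piFinset,
        add_sub_cancel_right]
      exact ⟨fun i => Finset.add_mem_add (hvP i) hu, hv'⟩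
    · intro v _ v' _ h
      funext i
      simpa using congrFun h i
  have h2 : ∑ _v ∈ Q, ((U.card : ℝ) * L.card / Q.card) ≤ ∑ v ∈ Q, ((Tv v).card : ℝ) := by
    rw [Finset.sum_const, nsmul_eq_mul]
    refine le_trans (le_of_eq ?_) h1
    field_simp
  obtain ⟨v, -, hv⟩ := Finset.exists_le_of_sum_le hQ0 h2
  rw [div_le_iff₀ hQc] at hv
  refine ⟨Tv v, Finset.filter_subset _ _, ?_, ?_⟩
  · have hPc : (0 : ℝ) < P.card := by
      have h2 : (P.card : ℝ) = (D.card : ℝ) ^ n := by simp [hP]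
      rw [h2]; positivity
    have h4 : (U.card : ℝ) * P.card ≤ (2 * K ^ n * (Tv v).card) * P.card := by
      calc (U.card : ℝ) * P.card ≤ U.card * (2 * L.card) := by gcongr
        _ = 2 * (U.card * L.card) := by ring
        _ ≤ 2 * ((Tv v).card * Q.card) := by gcongr
        _ ≤ 2 * ((Tv v).card * (K ^ n * P.card)) := by gcongr
        _ = _ := by ring
    exact le_of_mul_le_mul_right h4 hPc
  · have key : ∀ t ∈ Tv v, ∀ z, z + t ∈ Z → z + t ∉ bs (fun i => v i - t) →
        |∑ i, s (v i + z) - n * localAvg D s (z + t)| ≤ n * ε := by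
      intro t _ z hz hzb
      simp only [hbs, Finset.mem_filter, not_and, not_lt] at hzb
      have := hzb hz
      rw [Finset.sum_sub_distrib, Finset.sum_const, Finset.card_univ, Fintype.card_fin,
        nsmul_eq_mul] at this
      have e : ∀ i, v i - t + (z + t) = v i + z := fun i => by abel
      simpa only [e] using this
    intro t ht t' ht'
    have hsub : (univ.filter fun z => z + t ∈ Z ∧ z + t' ∈ Z ∧
        2 * ε < |localAvg D s (z + t) - localAvg D s (z + t')|) ⊆
        ((bs fun i => v i - t).image fun z => z - t) ∪
          ((bs fun i => v i - t').image fun z => z - t') := by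
      intro z hz
      simp only [Finset.mem_filter, Finset.mem_univ, true_and] at hz
      rw [Finset.mem_union, Finset.mem_image, Finset.mem_image]
      by_contra! hcon
      have h5 := key t ht z hz.1 fun h => hcon.1 _ h (by abel)
      have h6 := key t' ht' z hz.2.1 fun h => hcon.2 _ h (by abel)
      have h7 : n * |localAvg D s (z + t) - localAvg D s (z + t')| ≤ n * (2 * ε) := by
        rw [← abs_of_pos hn', ← abs_mul, abs_of_pos hn']
        rw [abs_le] at *
        constructor <;> linarith
      have := le_of_mul_le_mul_left h7 hn'
      linarith [hz.2.2]
    have hb : ∀ t ∈ Tv v, ((bs fun i => v i - t).card : ℝ) ≤ 4 * η * Z.card := by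
      intro t ht
      exact (Finset.mem_filter.1 (Finset.mem_filter.1 ht).2).2
    have h8 := (Finset.card_le_card hsub).trans ((Finset.card_union_le _ _).trans
      (add_le_add Finset.card_image_le Finset.card_image_le))
    have h9 : ((univ.filter fun z => z + t ∈ Z ∧ z + t' ∈ Z ∧
        2 * ε < |localAvg D s (z + t) - localAvg D s (z + t')|).card : ℝ) ≤
        (bs fun i => v i - t).card + (bs fun i => v i - t').card := by exact_mod_cast h8
    linarith [hb t ht, hb t' ht']

/-- Iterated averaging over the shifts `t - t₀` with `t ∈ T`. -/
noncomputable def iterShift (T : Finset G) (t₀ : G) (f : G → ℝ) : ℕ → G → ℝ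
  | 0 => f
  | j + 1 => fun y => (∑ t ∈ T, iterShift T t₀ f j (y + (t - t₀))) / T.card

/-- The regions `V j` leave room for the remaining shifts: a shift carries `V (j + 1)` into `V j`,
where the bound for `j` averagings is available. -/
theorem abs_iterShift_sub_le {T : Finset G} (hT : T.Nonempty) (t₀ : G) (f : G → ℝ) (V : ℕ → Set G)
    (m : ℕ) {κ : ℝ} (hV : ∀ j < m, ∀ y ∈ V (j + 1), ∀ t ∈ T, y + (t - t₀) ∈ V j)
    (hf : ∀ j < m, ∀ y ∈ V (j + 1), ∀ t ∈ T, |f (y + (t - t₀)) - f y| ≤ κ) :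
    ∀ j ≤ m, ∀ y ∈ V j, |iterShift T t₀ f j y - f y| ≤ j * κ := by
  have hTc : (0 : ℝ) < T.card := by exact_mod_cast hT.card_pos
  intro j
  induction j with
  | zero => intro _ y _; simp [iterShift]
  | succ j ih =>
    intro hj y hy
    have h1 : iterShift T t₀ f (j + 1) y - f y =
        (∑ t ∈ T, (iterShift T t₀ f j (y + (t - t₀)) - f y)) / T.card := by
      rw [Finset.sum_sub_distrib, Finset.sum_const, nsmul_eq_mul, iterShift]
      field_simp
    rw [h1, abs_div, abs_of_pos hTc, div_le_iff₀ hTc]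
    refine (Finset.abs_sum_le_sum_abs _ _).trans ?_
    calc _ ≤ ∑ t ∈ T, ((j + 1 : ℕ) * κ) := by
          refine Finset.sum_le_sum fun t ht => ?_
          have h2 := ih (by omega) _ (hV j (by omega) y hy t ht)
          have h3 := hf j (by omega) y hy t ht
          have h4 := abs_add_le (iterShift T t₀ f j (y + (t - t₀)) - f (y + (t - t₀)))
            (f (y + (t - t₀)) - f y)
          rw [sub_add_sub_cancel] at h4
          push_cast
          linarith
      _ = _ := by rw [Finset.sum_const, nsmul_eq_mul]; ring

/-- An upper bound valid on all translates survives averaging; read contrapositively, a large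
average on `W` yields a good translate for the original function. -/
theorem sum_iterShift_le {T : Finset G} (hT : T.Nonempty) (t₀ : G) {f : G → ℝ} {W : Finset G}
    {κ : ℝ} (hf : ∀ x, ∑ w ∈ W, f (x + w) ≤ κ) (j : ℕ) (x : G) :
    ∑ w ∈ W, iterShift T t₀ f j (x + w) ≤ κ := by
  have hTc : (0 : ℝ) < T.card := by exact_mod_cast hT.card_pos
  induction j generalizing x with
  | zero => exact hf x
  | succ j ih =>
    simp only [iterShift]
    rw [← Finset.sum_div, div_le_iff₀ hTc, Finset.sum_comm, mul_comm, ← nsmul_eq_mul]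
    refine Finset.sum_le_card_nsmul _ _ _ fun t _ => ?_
    have := ih (x + (t - t₀))
    refine le_trans (le_of_eq ?_) this
    refine Finset.sum_congr rfl fun w _ => ?_
    congr 1
    abel

/-- The average of `s` over the translate `D - D' + y` of the difference multiset. -/
noncomputable def diffAvg (D D' : Finset G) (s : G → ℝ) (y : G) : ℝ :=
  (∑ d' ∈ D', localAvg D s (y - d')) / D'.card

/-- Averaging over `D'` turns closeness outside few points into closeness everywhere: at most `β`
elements of `D'` are exceptional, and each costs at most `1`. -/
theorem abs_diffAvg_sub_le {D D' Z : Finset G} (hD' : D'.Nonempty) {s : G → ℝ}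
    (hs0 : ∀ x, 0 ≤ s x) (hs1 : ∀ x, s x ≤ 1) {ε β : ℝ} {t t₀ y : G} (hε : 0 ≤ ε)
    (h : ((univ.filter fun z => z + t ∈ Z ∧ z + t₀ ∈ Z ∧
        2 * ε < |localAvg D s (z + t) - localAvg D s (z + t₀)|).card : ℝ) ≤ β)
    (h1 : ∀ d ∈ D', y - d ∈ Z) (h2 : ∀ d ∈ D', y + (t - t₀) - d ∈ Z) :
    |diffAvg D D' s (y + (t - t₀)) - diffAvg D D' s y| ≤ 2 * ε + β / D'.card := by
  have hc : (0 : ℝ) < D'.card := by exact_mod_cast hD'.card_pos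
  unfold diffAvg
  rw [← sub_div, ← Finset.sum_sub_distrib, abs_div, abs_of_pos hc, div_le_iff₀ hc, add_mul,
    div_mul_cancel₀ _ hc.ne']
  refine (Finset.abs_sum_le_sum_abs _ _).trans ?_
  set bad := D'.filter fun d =>
    2 * ε < |localAvg D s (y + (t - t₀) - d) - localAvg D s (y - d)| with hbad
  have h3 : (bad.card : ℝ) ≤ β := by
    refine le_trans ?_ h
    norm_cast
    refine Finset.card_le_card_of_injOn (fun d => y - t₀ - d) ?_ ?_
    · intro d hd
      have hd' := Finset.mem_filter.1 hd
      have e1 : y - t₀ - d + t = y + (t - t₀) - d := by abel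
      have e2 : y - t₀ - d + t₀ = y - d := by abel
      simp only [Finset.coe_filter, Finset.mem_univ, true_and, Set.mem_ofPred_eq, e1, e2]
      exact ⟨h2 d hd'.1, h1 d hd'.1, hd'.2⟩
    · intro d _ d' _ hdd
      simpa using hdd
  calc _ ≤ ∑ d ∈ D', (2 * ε + if 2 * ε < |localAvg D s (y + (t - t₀) - d) - localAvg D s (y - d)|
        then (1 : ℝ) else 0) := by
        refine Finset.sum_le_sum fun d _ => ?_
        split_ifs with hlt
        · have e1 := localAvg_mem_Icc D hs0 hs1 (y + (t - t₀) - d)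
          have e2 := localAvg_mem_Icc D hs0 hs1 (y - d)
          rw [abs_le]
          constructor <;> linarith [e1.1, e1.2, e2.1, e2.2]
        · linarith
    _ = 2 * ε * D'.card + bad.card := by
        rw [Finset.sum_add_distrib, Finset.sum_const, nsmul_eq_mul, Finset.sum_boole]
        ring
    _ ≤ _ := by linarith

theorem sum_diffAvg_le {D D' W : Finset G} (hD : D.Nonempty) (hD' : D'.Nonempty) {s : G → ℝ} {κ : ℝ}
    (hs : ∀ x, ∑ w ∈ W, s (x + w) ≤ κ) (x : G) : ∑ w ∈ W, diffAvg D D' s (x + w) ≤ κ := by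
  have hc : (0 : ℝ) < D.card := by exact_mod_cast hD.card_pos
  have hc' : (0 : ℝ) < D'.card := by exact_mod_cast hD'.card_pos
  simp only [diffAvg, localAvg]
  rw [← Finset.sum_div, div_le_iff₀ hc', Finset.sum_comm, mul_comm, ← nsmul_eq_mul]
  refine Finset.sum_le_card_nsmul _ _ _ fun d' _ => ?_
  rw [← Finset.sum_div, div_le_iff₀ hc, Finset.sum_comm, mul_comm, ← nsmul_eq_mul]
  refine Finset.sum_le_card_nsmul _ _ _ fun d _ => ?_
  refine le_trans (le_of_eq ?_) (hs (d + x - d'))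
  refine Finset.sum_congr rfl fun w _ => ?_
  congr 1
  abel

end Sampling

/-! ### Fourier analysis of the iterated averages. -/

section Fourier

variable {G : Type*} [AddCommGroup G] [Fintype G] [DecidableEq G]

/-- The unnormalised Fourier transform. -/
noncomputable def dft (f : G → ℝ) (χ : AddChar G ℂ) : ℂ := ∑ x, (f x : ℂ) * χ x

theorem sum_dft_mul (f : G → ℝ) (y : G) :
    ∑ χ : AddChar G ℂ, dft f χ * χ (-y) = Fintype.card G * f y := by
  simp only [dft, Finset.sum_mul]
  rw [Finset.sum_comm]
  have : ∀ x, ∑ χ : AddChar G ℂ, (f x : ℂ) * χ x * χ (-y) =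
      if x = y then (Fintype.card G : ℂ) * f x else 0 := by
    intro x
    simp only [mul_assoc, ← AddChar.map_add_eq_mul]
    rw [← Finset.mul_sum, AddChar.sum_apply_eq_ite]
    simp only [← sub_eq_add_neg, sub_eq_zero]
    split_ifs <;> ring
  simp [this]

theorem sum_norm_dft_sq (f : G → ℝ) :
    ∑ χ : AddChar G ℂ, ‖dft f χ‖ ^ 2 = Fintype.card G * ∑ x, f x ^ 2 := by
  have h : ((∑ χ : AddChar G ℂ, ‖dft f χ‖ ^ 2 : ℝ) : ℂ) =
      ((Fintype.card G * ∑ x, f x ^ 2 : ℝ) : ℂ) := by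
    push_cast
    calc ∑ χ : AddChar G ℂ, (‖dft f χ‖ : ℂ) ^ 2
        = ∑ χ : AddChar G ℂ, ∑ y, (f y : ℂ) * (dft f χ * χ (-y)) := by
          refine Finset.sum_congr rfl fun χ _ => ?_
          rw [← Complex.mul_conj']
          conv_lhs => rw [show (starRingEnd ℂ) (dft f χ) = ∑ y, (f y : ℂ) * χ (-y) by
            simp [dft, AddChar.map_neg_eq_conj]]
          rw [Finset.mul_sum]
          exact Finset.sum_congr rfl fun y _ => by ring
      _ = ∑ y, (f y : ℂ) * ∑ χ : AddChar G ℂ, dft f χ * χ (-y) := by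
          rw [Finset.sum_comm]
          simp only [Finset.mul_sum]
      _ = _ := by
          simp only [sum_dft_mul]
          rw [Finset.mul_sum]
          exact Finset.sum_congr rfl fun y _ => by ring
  exact_mod_cast h

theorem dft_average (S : Finset G) (c : G → G) (f : G → ℝ) (N : ℝ) (χ : AddChar G ℂ) :
    dft (fun y => (∑ i ∈ S, f (y + c i)) / N) χ = (∑ i ∈ S, χ (-c i)) * dft f χ / N := by
  unfold dft
  push_cast
  simp only [div_mul_eq_mul_div, ← Finset.sum_div, Finset.sum_mul]
  rw [Finset.sum_comm]
  congr 1
  refine Finset.sum_congr rfl fun i _ => ?_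
  rw [← Equiv.sum_comp (Equiv.addRight (c i)) fun x => (f x : ℂ) * χ x, Finset.mul_sum]
  refine Finset.sum_congr rfl fun x _ => ?_
  simp only [Equiv.coe_addRight, AddChar.map_add_eq_mul]
  have : χ (-c i) * χ (c i) = 1 := by rw [← AddChar.map_add_eq_mul]; simp
  linear_combination (-(f (x + c i) : ℂ) * χ x) * this

theorem norm_sum_char_neg (S : Finset G) (χ : AddChar G ℂ) :
    ‖∑ i ∈ S, χ (-i)‖ = ‖∑ i ∈ S, χ i‖ := by
  simp only [AddChar.map_neg_eq_conj]
  rw [← map_sum, RCLike.norm_conj]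

theorem norm_sum_char_le (S : Finset G) (χ : AddChar G ℂ) : ‖∑ i ∈ S, χ i‖ ≤ S.card := by
  refine (norm_sum_le _ _).trans ?_
  simp [AddChar.norm_apply]

theorem norm_dft_localAvg (D : Finset G) (s : G → ℝ) (χ : AddChar G ℂ) :
    ‖dft (localAvg D s) χ‖ = ‖∑ d ∈ D, χ d‖ * ‖dft s χ‖ / D.card := by
  have h : localAvg D s = fun z => (∑ d ∈ D, s (z + d)) / (D.card : ℝ) := by
    funext z; simp only [localAvg, add_comm]
  rw [h, dft_average D (fun d => d), norm_div, norm_mul, norm_sum_char_neg]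
  simp

theorem norm_dft_diffAvg_le (D D' : Finset G) (s : G → ℝ) (χ : AddChar G ℂ) :
    ‖dft (diffAvg D D' s) χ‖ ≤ ‖∑ d ∈ D, χ d‖ * ‖dft s χ‖ / D.card := by
  have h : diffAvg D D' s = fun z => (∑ d ∈ D', localAvg D s (z + -d)) / (D'.card : ℝ) := by
    funext z; simp only [diffAvg, sub_eq_add_neg]
  rw [h, dft_average D' (fun d => -d), norm_div, norm_mul, ← norm_dft_localAvg]
  simp only [neg_neg, Complex.ofReal_natCast, Complex.norm_natCast]
  refine div_le_of_le_mul₀ (Nat.cast_nonneg _) (norm_nonneg _) ?_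
  rw [mul_comm]
  gcongr
  exact norm_sum_char_le _ _

theorem norm_dft_iterShift (T : Finset G) (t₀ : G) (f : G → ℝ) (j : ℕ) (χ : AddChar G ℂ) :
    ‖dft (iterShift T t₀ f j) χ‖ = (‖∑ t ∈ T, χ t‖ / T.card) ^ j * ‖dft f χ‖ := by
  induction j with
  | zero => simp [iterShift]
  | succ j ih =>
    have h1 : ‖∑ t ∈ T, χ (-(t - t₀))‖ = ‖∑ t ∈ T, χ t‖ := by
      rw [← norm_sum_char_neg]
      have : ∀ t, χ (-(t - t₀)) = χ t₀ * χ (-t) := by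
        intro t
        rw [← AddChar.map_add_eq_mul]
        congr 1; abel
      simp only [this]
      rw [← Finset.mul_sum, norm_mul, AddChar.norm_apply, one_mul]
    simp only [iterShift]
    rw [dft_average T (fun t => t - t₀), norm_div, norm_mul, h1, ih]
    simp only [Complex.ofReal_natCast, Complex.norm_natCast]
    ring

theorem dft_ofSet (D : Finset G) (χ : AddChar G ℂ) : dft (ofSet D) χ = ∑ d ∈ D, χ d := by
  have h : ∀ x, ((ofSet D x : ℝ) : ℂ) * χ x = if x ∈ D then χ x else 0 := by
    intro x; unfold ofSet; split_ifs <;> simp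
  simp [dft, h]

/-- By Fourier inversion it suffices to bound each coefficient times `|χ y - 1|`. On the large
spectrum of `T` the second factor is at most `ε`; off it the `m` averagings give `(1/2)^m`. The sum
of the remaining coefficients is controlled by `2xy ≤ x² + y²` and Parseval, the factor from `D'`
being bounded by `1`. -/
theorem abs_iterShift_diffAvg_sub_le {D D' T : Finset G} (hD : D.Nonempty) (hT : T.Nonempty) (t₀ : G)
    (s : G → ℝ) (m : ℕ) {y : G} {ε : ℝ} (hε : 0 ≤ ε)
    (hy : ∀ χ : AddChar G ℂ, (T.card : ℝ) / 2 ≤ ‖∑ t ∈ T, χ t‖ → ‖χ y - 1‖ ≤ ε) :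
    |iterShift T t₀ (diffAvg D D' s) m y - iterShift T t₀ (diffAvg D D' s) m 0| ≤
      (2 * (1 / 2) ^ m + ε) * ((∑ x, s x ^ 2 + D.card) / (2 * D.card)) := by
  set I := iterShift T t₀ (diffAvg D D' s) m with hI
  have hDc : (0 : ℝ) < D.card := by exact_mod_cast hD.card_pos
  have hTc : (0 : ℝ) < T.card := by exact_mod_cast hT.card_pos
  have hG : (0 : ℝ) < Fintype.card G := by exact_mod_cast Fintype.card_pos
  have h1 : (Fintype.card G : ℂ) * ((I y - I 0 : ℝ) : ℂ) =
      ∑ χ : AddChar G ℂ, dft I χ * (χ (-y) - 1) := by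
    simp only [mul_sub, Finset.sum_sub_distrib, mul_one]
    have e1 := sum_dft_mul I 0
    simp only [neg_zero, AddChar.map_zero_eq_one, mul_one] at e1
    rw [sum_dft_mul, e1]
    push_cast
    ring
  have h2 : ∀ χ : AddChar G ℂ, ‖dft I χ * (χ (-y) - 1)‖ ≤
      (2 * (1 / 2) ^ m + ε) * ((‖dft s χ‖ ^ 2 + ‖dft (ofSet D) χ‖ ^ 2) / (2 * D.card)) := by
    intro χ
    have e1 : ‖dft (diffAvg D D' s) χ‖ ≤
        (‖dft s χ‖ ^ 2 + ‖dft (ofSet D) χ‖ ^ 2) / (2 * D.card) := by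
      refine (norm_dft_diffAvg_le D D' s χ).trans ?_
      rw [dft_ofSet, div_le_div_iff₀ hDc (by positivity)]
      nlinarith [sq_nonneg (‖dft s χ‖ - ‖∑ d ∈ D, χ d‖)]
    have e2 : (‖∑ t ∈ T, χ t‖ / T.card) ^ m * ‖χ (-y) - 1‖ ≤ 2 * (1 / 2) ^ m + ε := by
      have hr0 : 0 ≤ ‖∑ t ∈ T, χ t‖ / T.card := by positivity
      rw [norm_char_neg_sub_one]
      have hle2 : ‖χ y - 1‖ ≤ 2 := by
        refine (norm_sub_le _ _).trans ?_
        rw [AddChar.norm_apply, norm_one]; norm_num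
      rcases le_total ((T.card : ℝ) / 2) ‖∑ t ∈ T, χ t‖ with h | h
      · have hr1 : ‖∑ t ∈ T, χ t‖ / T.card ≤ 1 := by
          rw [div_le_one hTc]; exact norm_sum_char_le _ _
        calc _ ≤ 1 * ε := by
              gcongr
              · exact pow_le_one₀ hr0 hr1
              · exact hy χ h
          _ ≤ _ := by
              have : (0 : ℝ) ≤ 2 * (1 / 2) ^ m := by positivity
              linarith
      · have hr1 : ‖∑ t ∈ T, χ t‖ / T.card ≤ 1 / 2 := by
          rw [div_le_iff₀ hTc]; linarith
        calc (‖∑ t ∈ T, χ t‖ / T.card) ^ m * ‖χ y - 1‖ ≤ (1 / 2) ^ m * 2 := by gcongr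
          _ ≤ _ := by linarith
    rw [norm_mul, hI, norm_dft_iterShift]
    calc _ = ((‖∑ t ∈ T, χ t‖ / T.card) ^ m * ‖χ (-y) - 1‖) * ‖dft (diffAvg D D' s) χ‖ := by ring
      _ ≤ _ := by gcongr
  have h3 := congrArg norm h1
  rw [norm_mul, Complex.norm_natCast, Complex.norm_real, Real.norm_eq_abs] at h3
  have h4 := (norm_sum_le univ _).trans
    (Finset.sum_le_sum fun χ (_ : χ ∈ (univ : Finset (AddChar G ℂ))) => h2 χ)
  rw [← h3, ← Finset.mul_sum, ← Finset.sum_div, Finset.sum_add_distrib, sum_norm_dft_sq,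
    sum_norm_dft_sq] at h4
  have h5 : ∑ x, ofSet D x ^ 2 = D.card := by
    rw [← sum_ofSet]
    refine Finset.sum_congr rfl fun x _ => ?_
    unfold ofSet; split_ifs <;> norm_num
  rw [h5] at h4
  refine le_of_mul_le_mul_left (h4.trans (le_of_eq ?_)) hG
  ring

end Fourier

/-! ### The large spectrum of a dense subset of a Bohr set. -/

section Spectrum

variable {G : Type*} [AddCommGroup G] [Fintype G] [DecidableEq G]

/-- A Riesz product. -/
noncomputable def riesz (L : Finset (AddChar G ℂ)) (ω : AddChar G ℂ → ℂ) (x : G) : ℝ :=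
  ∏ l ∈ L, (1 + (ω l * l x).re / 8)

/-- Dissociativity relative to `U`, as a bound on the means of Riesz products. -/
def RelDissociated (U : Finset G) (M : ℕ) (L : Finset (AddChar G ℂ)) : Prop :=
  ∀ ω : AddChar G ℂ → ℂ, (∀ l, ‖ω l‖ ≤ 1) →
    ∑ x ∈ U, riesz L ω x ≤ (1 + (L.card : ℝ) / M) * U.card

theorem abs_re_mul_char_le {w : ℂ} (hw : ‖w‖ ≤ 1) (l : AddChar G ℂ) (x : G) :
    |(w * l x).re| ≤ 1 := by
  refine (Complex.abs_re_le_norm _).trans ?_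
  rwa [norm_mul, AddChar.norm_apply, mul_one]

theorem exp_le_one_add_div_eight {x : ℝ} (hx : |x| ≤ 1) :
    Real.exp (x / 8 - 1 / 40) ≤ 1 + x / 8 := by
  rw [abs_le] at hx
  have h1 : |x / 8 - 1 / 40| ≤ 1 := by rw [abs_le]; constructor <;> linarith
  have h2 := Real.abs_exp_sub_one_sub_id_le h1
  rw [abs_le] at h2
  nlinarith [h2.2]

theorem riesz_nonneg (L : Finset (AddChar G ℂ)) {ω : AddChar G ℂ → ℂ} (hω : ∀ l, ‖ω l‖ ≤ 1)
    (x : G) : 0 ≤ riesz L ω x := by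
  refine Finset.prod_nonneg fun l _ => ?_
  have := abs_re_mul_char_le (hω l) l x
  rw [abs_le] at this
  linarith

theorem riesz_le (L : Finset (AddChar G ℂ)) {ω : AddChar G ℂ → ℂ} (hω : ∀ l, ‖ω l‖ ≤ 1)
    (x : G) : riesz L ω x ≤ (9 / 8) ^ L.card := by
  rw [← Finset.prod_const]
  refine Finset.prod_le_prod (fun l _ => ?_) fun l _ => ?_
  all_goals
    have := abs_re_mul_char_le (hω l) l x
    rw [abs_le] at this
    linarith

theorem abs_prod_sub_prod_le {ι : Type*} (L : Finset ι) (a b : ι → ℝ) {c η : ℝ} (hc : 1 ≤ c)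
    (ha : ∀ i ∈ L, |a i| ≤ c) (hb : ∀ i ∈ L, |b i| ≤ c) (hab : ∀ i ∈ L, |a i - b i| ≤ η) :
    |∏ i ∈ L, a i - ∏ i ∈ L, b i| ≤ L.card * c ^ L.card * η := by
  classical
  induction L using Finset.induction_on with
  | empty => simp
  | insert i L hi ih =>
    rw [Finset.prod_insert hi, Finset.prod_insert hi, Finset.card_insert_of_notMem hi]
    have h1 := ih (fun j hj => ha j (Finset.mem_insert_of_mem hj))
      (fun j hj => hb j (Finset.mem_insert_of_mem hj))
      (fun j hj => hab j (Finset.mem_insert_of_mem hj))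
    have h2 : |∏ j ∈ L, b j| ≤ c ^ L.card := by
      rw [Finset.abs_prod, ← Finset.prod_const]
      exact Finset.prod_le_prod (fun _ _ => abs_nonneg _)
        fun j hj => hb j (Finset.mem_insert_of_mem hj)
    have h3 := ha i (Finset.mem_insert_self _ _)
    have h4 := hab i (Finset.mem_insert_self _ _)
    have hη : 0 ≤ η := (abs_nonneg _).trans h4
    have h5 : a i * ∏ j ∈ L, a j - b i * ∏ j ∈ L, b j =
        a i * (∏ j ∈ L, a j - ∏ j ∈ L, b j) + (a i - b i) * ∏ j ∈ L, b j := by ring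
    rw [h5]
    refine (abs_add_le _ _).trans ?_
    rw [abs_mul, abs_mul]
    have h6 : c ^ L.card ≤ c ^ (L.card + 1) := pow_le_pow_right₀ hc (by omega)
    calc |a i| * |∏ j ∈ L, a j - ∏ j ∈ L, b j| + |a i - b i| * |∏ j ∈ L, b j|
        ≤ c * (L.card * c ^ L.card * η) + η * c ^ (L.card + 1) := by
          gcongr
          exact h2.trans h6
      _ = _ := by push_cast; ring

/-- Choose phases aligning the Riesz product with `T`. Its logarithm then averages at least `(1/16 -
1/40) |L| = 3 |L| / 80` over `T`, so its mass on `T` is exponential in `|L|`, whereas dissociativity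
bounds its mass on `U`. -/
theorem exp_card_mul_le_of_relDissociated {U T : Finset G} (hTU : T ⊆ U) {M : ℕ}
    {L : Finset (AddChar G ℂ)} (hL : RelDissociated U M L) (hLM : L.card ≤ M)
    (hspec : ∀ l ∈ L, (T.card : ℝ) / 2 ≤ ‖∑ t ∈ T, l t‖) :
    Real.exp (3 * L.card / 80) * T.card ≤ 2 * U.card := by
  set ω : AddChar G ℂ → ℂ := fun l =>
    (starRingEnd ℂ) (∑ t ∈ T, l t) / (‖∑ t ∈ T, l t‖ : ℂ) with hω
  have hω1 : ∀ l, ‖ω l‖ ≤ 1 := by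
    intro l
    simp only [hω, norm_div, RCLike.norm_conj, Complex.norm_real, norm_norm]
    exact div_self_le_one _
  have hsum : ∀ l : AddChar G ℂ, ∑ t ∈ T, (ω l * l t).re = ‖∑ t ∈ T, l t‖ := by
    intro l
    rw [← Complex.re_sum, ← Finset.mul_sum]
    simp only [hω]
    rw [div_mul_eq_mul_div, Complex.conj_mul', sq, mul_self_div_self, Complex.ofReal_re]
  set c : ℝ := 3 * L.card / 80 with hc
  set g : G → ℝ := fun t => ∑ l ∈ L, ((ω l * l t).re / 8 - 1 / 40) with hg
  have h1 : ∀ t, Real.exp (g t) ≤ riesz L ω t := by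
    intro t
    rw [hg, Real.exp_sum]
    exact Finset.prod_le_prod (fun _ _ => (Real.exp_pos _).le) fun l _ =>
      exp_le_one_add_div_eight (abs_re_mul_char_le (hω1 l) l t)
  -- The tangent line of `exp` at `c`; summed over `T` it serves as Jensen's inequality.
  have h2 : ∀ t, Real.exp c * (1 + (g t - c)) ≤ Real.exp (g t) := by
    intro t
    have : Real.exp (g t) = Real.exp c * Real.exp (g t - c) := by rw [← Real.exp_add]; ring_nf
    rw [this]
    gcongr
    linarith [Real.add_one_le_exp (g t - c)]
  have h3 : c * T.card ≤ ∑ t ∈ T, g t := by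
    simp only [hg]
    rw [Finset.sum_comm]
    have : ∀ l ∈ L, 3 / 80 * (T.card : ℝ) ≤ ∑ t ∈ T, ((ω l * l t).re / 8 - 1 / 40) := by
      intro l hl
      rw [Finset.sum_sub_distrib, ← Finset.sum_div, hsum, Finset.sum_const, nsmul_eq_mul]
      linarith [hspec l hl]
    have h := Finset.card_nsmul_le_sum L _ _ this
    rw [nsmul_eq_mul] at h
    rw [hc]; linarith
  have h4 : Real.exp c * T.card ≤ ∑ t ∈ T, Real.exp c * (1 + (g t - c)) := by
    rw [← Finset.mul_sum]
    gcongr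
    rw [Finset.sum_add_distrib, Finset.sum_sub_distrib, Finset.sum_const, Finset.sum_const,
      nsmul_eq_mul, nsmul_eq_mul]
    linarith
  have h5 : ∑ t ∈ T, Real.exp c * (1 + (g t - c)) ≤ ∑ x ∈ U, riesz L ω x :=
    (Finset.sum_le_sum fun t _ => (h2 t).trans (h1 t)).trans
      (Finset.sum_le_sum_of_subset_of_nonneg hTU fun x _ _ => riesz_nonneg L hω1 x)
  refine h4.trans (h5.trans ((hL ω hω1).trans ?_))
  gcongr
  have : (L.card : ℝ) / M ≤ 1 :=
    div_le_one_of_le₀ (by exact_mod_cast hLM) (Nat.cast_nonneg _)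
  linarith

theorem norm_sum_add_sub_sum_le {U : Finset G} {y : G} {ε C : ℝ} (hC : 0 ≤ C) (Q : G → ℂ)
    (hQ : ∀ x, ‖Q x‖ ≤ C) (hy : ((U.filter fun u => u + y ∉ U).card : ℝ) ≤ ε * U.card) :
    ‖∑ x ∈ U, Q (x + y) - ∑ x ∈ U, Q x‖ ≤ 2 * ε * U.card * C := by
  set U' := U.image fun x => x + y with hU'
  have hinj : Function.Injective fun x : G => x + y := add_left_injective y
  have h1 : ∑ x ∈ U, Q (x + y) = ∑ x ∈ U', Q x := by
    rw [hU', Finset.sum_image fun a _ b _ h => hinj h]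
  have hcard : U'.card = U.card := Finset.card_image_of_injective _ hinj
  have h2 : U' \ U = (U.filter fun u => u + y ∉ U).image fun x => x + y := by
    ext x
    simp only [hU', Finset.mem_sdiff, Finset.mem_image, Finset.mem_filter]
    constructor
    · rintro ⟨⟨u, hu, rfl⟩, h⟩; exact ⟨u, ⟨hu, h⟩, rfl⟩
    · rintro ⟨u, ⟨hu, h⟩, rfl⟩; exact ⟨⟨u, hu, rfl⟩, h⟩
  have h3 : ((U' \ U).card : ℝ) ≤ ε * U.card := by
    rw [h2, Finset.card_image_of_injective _ hinj]; exact hy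
  have h4 : ((U \ U').card : ℝ) ≤ ε * U.card := by
    rw [Finset.card_sdiff_comm hcard.symm]; exact h3
  rw [h1, ← Finset.sum_sdiff_sub_sum_sdiff]
  have h5 : ∀ S : Finset G, ‖∑ x ∈ S, Q x‖ ≤ S.card * C := by
    intro S
    refine (norm_sum_le _ _).trans ?_
    rw [← nsmul_eq_mul]
    exact Finset.sum_le_card_nsmul _ _ _ fun x _ => hQ x
  refine (norm_sub_le _ _).trans ?_
  calc _ ≤ (U' \ U).card * C + (U \ U').card * C := add_le_add (h5 _) (h5 _)
    _ ≤ ε * U.card * C + ε * U.card * C := by gcongr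
    _ = _ := by ring

/-- When adding `γ` destroys dissociativity, `γ` correlates on `U` with some Riesz product over `L`,
by at least `|U| / M`. Translation by `y` barely changes `U` or the Riesz product, yet multiplies
`γ` by `γ y`; hence `γ y` must be close to `1`. -/
theorem norm_char_sub_one_le_of_not_relDissociated [DecidableEq (AddChar G ℂ)] {U : Finset G}
    (hU : U.Nonempty) {M : ℕ} (hM : 0 < M) {L : Finset (AddChar G ℂ)} (hL : RelDissociated U M L)
    (hLM : L.card ≤ M) {γ : AddChar G ℂ} (hγ : γ ∉ L) (hins : ¬ RelDissociated U M (insert γ L))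
    {y : G} {ε η : ℝ} (hη : 0 ≤ η) (hLy : ∀ l ∈ L, ‖l y - 1‖ ≤ η)
    (hy : ((U.filter fun u => u + y ∉ U).card : ℝ) ≤ ε * U.card) :
    ‖γ y - 1‖ ≤ M * (9 / 8) ^ M * (2 * ε + M * η) := by
  have hUc : (0 : ℝ) < U.card := by exact_mod_cast hU.card_pos
  have hMr : (0 : ℝ) < M := by exact_mod_cast hM
  unfold RelDissociated at hins
  push Not at hins
  obtain ⟨ω, hω, hlt⟩ := hins
  set P : G → ℝ := riesz L ω with hP
  have h1 : ∑ x ∈ U, riesz (insert γ L) ω x =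
      ∑ x ∈ U, P x + (∑ x ∈ U, P x * (ω γ * γ x).re) / 8 := by
    rw [Finset.sum_div, ← Finset.sum_add_distrib]
    refine Finset.sum_congr rfl fun x _ => ?_
    rw [riesz, Finset.prod_insert hγ, hP, riesz]
    ring
  have h2 := hL ω hω
  rw [h1, Finset.card_insert_of_notMem hγ] at hlt
  have h3 : (U.card : ℝ) / M ≤ ∑ x ∈ U, P x * (ω γ * γ x).re := by
    have e : (1 + ((L.card + 1 : ℕ) : ℝ) / M) * U.card =
        (1 + (L.card : ℝ) / M) * U.card + U.card / M := by push_cast; ring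
    rw [e] at hlt
    have : 0 ≤ (U.card : ℝ) / M := by positivity
    linarith
  set E : ℂ := ∑ x ∈ U, (P x : ℂ) * γ x with hE
  have h4 : (U.card : ℝ) / M ≤ ‖E‖ := by
    refine h3.trans ?_
    have e : ∑ x ∈ U, P x * (ω γ * γ x).re = (ω γ * E).re := by
      rw [hE, Finset.mul_sum, Complex.re_sum]
      refine Finset.sum_congr rfl fun x _ => ?_
      rw [mul_left_comm, Complex.re_ofReal_mul]
    rw [e]
    refine (Complex.re_le_norm _).trans ?_
    rw [norm_mul]
    nlinarith [hω γ, norm_nonneg E]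
  have hP0 : ∀ x, 0 ≤ P x := riesz_nonneg L hω
  have h98 : (9 / 8 : ℝ) ^ L.card ≤ (9 / 8) ^ M := pow_le_pow_right₀ (by norm_num) hLM
  have hP1 : ∀ x, P x ≤ (9 / 8) ^ M := fun x => (riesz_le L hω x).trans h98
  have hPd : ∀ x, |P x - P (x + y)| ≤ M * (9 / 8) ^ M * η := by
    intro x
    have hb : ∀ z, ∀ l ∈ L, |1 + (ω l * l z).re / 8| ≤ 9 / 8 := by
      intro z l _
      have := abs_re_mul_char_le (hω l) l z
      rw [abs_le] at this ⊢
      constructor <;> linarith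
    refine (abs_prod_sub_prod_le L _ _ (by norm_num) (hb x) (hb (x + y)) (η := η) ?_).trans ?_
    · intro l hl
      have e : 1 + (ω l * l x).re / 8 - (1 + (ω l * l (x + y)).re / 8) =
          (ω l * l x * (1 - l y)).re / 8 := by
        rw [AddChar.map_add_eq_mul, mul_sub, mul_one, Complex.sub_re, mul_assoc (ω l)]
        ring
      rw [e, abs_div]
      have e2 : |(ω l * l x * (1 - l y)).re| ≤ η := by
        refine (Complex.abs_re_le_norm _).trans ?_
        rw [norm_mul, norm_mul, AddChar.norm_apply, mul_one, norm_sub_rev]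
        calc ‖ω l‖ * ‖l y - 1‖ ≤ 1 * η := by gcongr; exacts [hω l, hLy l hl]
          _ = η := one_mul _
      rw [abs_of_pos (show (0 : ℝ) < 8 by norm_num)]
      linarith [abs_nonneg (ω l * l x * (1 - l y)).re]
    · have : (L.card : ℝ) ≤ M := by exact_mod_cast hLM
      gcongr
  have h5 : (γ y - 1) * E = ∑ x ∈ U, ((P x - P (x + y) : ℝ) : ℂ) * γ (x + y) +
      (∑ x ∈ U, (P (x + y) : ℂ) * γ (x + y) - ∑ x ∈ U, (P x : ℂ) * γ x) := by
    rw [← Finset.sum_sub_distrib, ← Finset.sum_add_distrib, hE, Finset.mul_sum]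
    refine Finset.sum_congr rfl fun x _ => ?_
    push_cast
    rw [AddChar.map_add_eq_mul]
    ring
  have h6 : ‖(γ y - 1) * E‖ ≤ U.card * (M * (9 / 8) ^ M * η) + 2 * ε * U.card * (9 / 8) ^ M := by
    rw [h5]
    refine (norm_add_le _ _).trans (add_le_add ?_ ?_)
    · refine (norm_sum_le _ _).trans ?_
      rw [← nsmul_eq_mul]
      refine Finset.sum_le_card_nsmul _ _ _ fun x _ => ?_
      rw [norm_mul, AddChar.norm_apply, mul_one, Complex.norm_real, Real.norm_eq_abs]
      exact hPd x
    · refine norm_sum_add_sub_sum_le (by positivity) (fun x => (P x : ℂ) * γ x) (fun x => ?_) hy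
      rw [norm_mul, AddChar.norm_apply, mul_one, Complex.norm_real, Real.norm_eq_abs,
        abs_of_nonneg (hP0 x)]
      exact hP1 x
  rw [norm_mul] at h6
  have h7 : ‖γ y - 1‖ * (U.card / M) ≤
      U.card * (M * (9 / 8) ^ M * η) + 2 * ε * U.card * (9 / 8) ^ M :=
    (mul_le_mul_of_nonneg_left h4 (norm_nonneg _)).trans h6
  have h8 : 0 < (U.card : ℝ) / M := by positivity
  refine le_of_mul_le_mul_right (h7.trans (le_of_eq ?_)) h8
  field_simp
  ring

/-- Take a largest dissociated subset of the spectrum with at most `M` elements. The density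
hypothesis excludes exactly `M` elements, so an insertion can fail only through dissociativity. -/
theorem exists_chars_controlling_spectrum {U T : Finset G} (hTU : T ⊆ U) (hT : T.Nonempty) {M : ℕ}
    (hM : 0 < M) (hMT : 2 * (U.card : ℝ) < Real.exp (3 * M / 80) * T.card) :
    ∃ L : Finset (AddChar G ℂ), L.card ≤ M ∧ ∀ (y : G) (ε η : ℝ), 0 ≤ η → 0 ≤ ε →
      (∀ l ∈ L, ‖l y - 1‖ ≤ η) → ((U.filter fun u => u + y ∉ U).card : ℝ) ≤ ε * U.card →
      ∀ γ : AddChar G ℂ, (T.card : ℝ) / 2 ≤ ‖∑ t ∈ T, γ t‖ →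
        ‖γ y - 1‖ ≤ M * (9 / 8) ^ M * (2 * ε + M * η) := by
  classical
  set F : Finset (Finset (AddChar G ℂ)) := univ.filter fun L =>
    L.card ≤ M ∧ RelDissociated U M L ∧ ∀ l ∈ L, (T.card : ℝ) / 2 ≤ ‖∑ t ∈ T, l t‖ with hF
  have hF0 : F.Nonempty := by
    refine ⟨∅, ?_⟩
    simp only [hF, Finset.mem_filter, Finset.mem_univ, true_and]
    refine ⟨by simp, fun ω _ => ?_, by simp⟩
    simp [riesz]
  obtain ⟨L, hLF, hmax⟩ := Finset.exists_max_image F Finset.card hF0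
  simp only [hF, Finset.mem_filter, Finset.mem_univ, true_and] at hLF
  obtain ⟨hLM, hLd, hLs⟩ := hLF
  have hlt : L.card < M := by
    rcases hLM.lt_or_eq with h | h
    · exact h
    · have := exp_card_mul_le_of_relDissociated hTU hLd hLM hLs
      rw [h] at this
      linarith
  refine ⟨L, hLM, fun y ε η hη hε hLy hy γ hγ => ?_⟩
  by_cases hγL : γ ∈ L
  · refine (hLy γ hγL).trans ?_
    have hM1 : (1 : ℝ) ≤ M := by exact_mod_cast hM
    have h1 : (1 : ℝ) ≤ (9 / 8) ^ M := one_le_pow₀ (by norm_num)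
    have h2 : (1 : ℝ) ≤ M * (9 / 8) ^ M := by nlinarith
    have h3 : η ≤ 2 * ε + M * η := by nlinarith
    nlinarith
  · refine norm_char_sub_one_le_of_not_relDissociated (hT.mono hTU) hM hLd hLM hγL ?_ hη hLy hy
    intro hdis
    have hmem : insert γ L ∈ F := by
      simp only [hF, Finset.mem_filter, Finset.mem_univ, true_and]
      refine ⟨by rw [Finset.card_insert_of_notMem hγL]; omega, hdis, ?_⟩
      intro l hl
      rcases Finset.mem_insert.1 hl with rfl | h
      · exact hγ
      · exact hLs l h
    have := hmax _ hmem
    rw [Finset.card_insert_of_notMem hγL] at this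
    omega

end Spectrum

/-! ### Restricting one factor of a difference set to a narrow Bohr translate. -/

section Localisation

variable {G : Type*} [AddCommGroup G] [Fintype G] [DecidableEq G]

theorem sum_sum_filter_sub_mem {D Y X : Finset G} (hX : ∀ z ∈ D, ∀ y ∈ Y, z - y ∈ X) (b : G → ℝ) :
    ∑ x ∈ X, ∑ z ∈ D.filter (fun z => z - x ∈ Y), b z = Y.card * ∑ z ∈ D, b z := by
  simp only [Finset.sum_filter]
  rw [Finset.sum_comm, Finset.mul_sum]
  refine Finset.sum_congr rfl fun z hz => ?_
  rw [← Finset.sum_filter, Finset.sum_const, nsmul_eq_mul]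
  have h : X.filter (fun x => z - x ∈ Y) = Y.image fun y => z - y := by
    ext x
    simp only [Finset.mem_filter, Finset.mem_image]
    constructor
    · rintro ⟨_, h⟩; exact ⟨z - x, h, by abel⟩
    · rintro ⟨y, hy, rfl⟩; exact ⟨hX z hz y hy, by simpa using hy⟩
  rw [h, Finset.card_image_of_injective _ (sub_right_injective)]

/-- Average over the translates of `Y` meeting `D`: each point of `D` is covered `|Y|` times. The
term `|D| |Y| / (2K)` added in the average secures density of the piece together with few bad pairs.
-/
theorem exists_local_piece {D Y X : Finset G} (hD : D.Nonempty) (hY : Y.Nonempty)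
    (hX : ∀ z ∈ D, ∀ y ∈ Y, z - y ∈ X) {w : G → ℝ} (hw : ∀ x, 0 ≤ w x) {K : ℝ} (hK : 0 < K)
    (hXD : (X.card : ℝ) ≤ 2 * K * D.card)
    (hbad : 1000 * ∑ z ∈ D, ∑ z' ∈ D, w (z' - z) ≤ (D.card : ℝ) ^ 2) :
    ∃ x, (Y.card : ℝ) ≤ 4 * K * (D.filter fun z => z - x ∈ Y).card ∧
      1000 * ∑ z ∈ D.filter (fun z => z - x ∈ Y), ∑ z' ∈ D, w (z' - z) ≤
        2 * D.card * (D.filter fun z => z - x ∈ Y).card := by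
  have hDc : (0 : ℝ) < D.card := by exact_mod_cast hD.card_pos
  have hYc : (0 : ℝ) < Y.card := by exact_mod_cast hY.card_pos
  have hX0 : X.Nonempty := by
    obtain ⟨z, hz⟩ := hD
    obtain ⟨y, hy⟩ := hY
    exact ⟨_, hX z hz y hy⟩
  have h1 := sum_sum_filter_sub_mem hX fun z => ∑ z' ∈ D, w (z' - z)
  have h2 := sum_sum_filter_sub_mem hX fun _ => (1 : ℝ)
  simp only [Finset.sum_const, nsmul_eq_mul, mul_one] at h2
  have h3 : ∑ x ∈ X, (1000 * ∑ z ∈ D.filter (fun z => z - x ∈ Y), ∑ z' ∈ D, w (z' - z) +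
      D.card * Y.card / (2 * K)) ≤
      ∑ x ∈ X, 2 * D.card * ((D.filter fun z => z - x ∈ Y).card : ℝ) := by
    rw [Finset.sum_add_distrib, ← Finset.mul_sum, h1, ← Finset.mul_sum, h2, Finset.sum_const,
      nsmul_eq_mul]
    have h4 : X.card * (D.card * Y.card / (2 * K)) ≤ (D.card : ℝ) ^ 2 * Y.card := by
      rw [mul_div_assoc', div_le_iff₀ (by positivity)]
      calc (X.card : ℝ) * (D.card * Y.card) ≤ (2 * K * D.card) * (D.card * Y.card) := by gcongr
        _ = _ := by ring
    have h5 := mul_le_mul_of_nonneg_left hbad hYc.le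
    nlinarith
  obtain ⟨x, -, hx⟩ := Finset.exists_le_of_sum_le hX0 h3
  refine ⟨x, ?_, ?_⟩
  · have h6 : 0 ≤ 1000 * ∑ z ∈ D.filter (fun z => z - x ∈ Y), ∑ z' ∈ D, w (z' - z) :=
      mul_nonneg (by norm_num) (Finset.sum_nonneg fun _ _ => Finset.sum_nonneg fun _ _ => hw _)
    have h7 : D.card * Y.card / (2 * K) ≤
        2 * D.card * ((D.filter fun z => z - x ∈ Y).card : ℝ) := by linarith
    rw [div_le_iff₀ (by positivity)] at h7
    refine le_of_mul_le_mul_left (h7.trans (le_of_eq ?_)) hDc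
    ring
  · have : 0 ≤ D.card * Y.card / (2 * K) := by positivity
    linarith

theorem one_sub_le_diffAvg_zero {D D' : Finset G} (hD : D.Nonempty) (hD' : D'.Nonempty)
    {s : G → ℝ} {κ : ℝ}
    (h : ∑ z ∈ D', ∑ z' ∈ D, (1 - s (z' - z)) ≤ κ * (D.card * D'.card)) :
    1 - κ ≤ diffAvg D D' s 0 := by
  have hDc : (0 : ℝ) < D.card := by exact_mod_cast hD.card_pos
  have hDc' : (0 : ℝ) < D'.card := by exact_mod_cast hD'.card_pos
  simp only [diffAvg, localAvg, zero_sub, ← sub_eq_add_neg]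
  rw [← Finset.sum_div, div_div, le_div_iff₀ (by positivity)]
  simp only [Finset.sum_sub_distrib, Finset.sum_const, nsmul_eq_mul, mul_one] at h
  linarith

end Localisation

/-! ### Numerical bounds for the sampling and spectral errors. -/

section Numerics

/-- With accuracy `1 / (4000 m)` this `n` makes the Hoeffding exponent `31.25 m`, enough to absorb
`2^e`. The bound `1 / (1000 m)` leaves a total drift `1 / 1000` after `m` averagings. -/
theorem exp_neg_sampling_le {e m n : ℕ} (hm : e + 14 ≤ m) (hn : n = 10 ^ 9 * m ^ 3) :
    2 * (1 / (4000 * m : ℝ)) +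
      64 * 2 ^ e * Real.exp (-(n * (1 / (4000 * m : ℝ)) ^ 2 / 2)) ≤ 1 / (1000 * m) := by
  have hm0 : (0 : ℝ) < m := by exact_mod_cast (by omega : 0 < m)
  have h1 : (n * (1 / (4000 * m : ℝ)) ^ 2 / 2) = 31.25 * m := by
    rw [hn]; push_cast; field_simp; norm_num
  have h2 : (2 : ℝ) ^ (31 * m) ≤ Real.exp (31.25 * m) := by
    have e1 : (2 : ℝ) ≤ Real.exp 1 := by linarith [Real.add_one_le_exp (1 : ℝ)]
    calc (2 : ℝ) ^ (31 * m) ≤ Real.exp 1 ^ (31 * m) := by gcongr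
      _ = Real.exp (31 * m) := by rw [← Real.exp_nat_mul]; push_cast; ring_nf
      _ ≤ _ := by gcongr; norm_num
  have h3 : 128000 * m * (2 : ℝ) ^ e ≤ 2 ^ (31 * m) := by
    have e1 : (m : ℝ) ≤ 2 ^ m := by exact_mod_cast Nat.lt_two_pow_self.le
    calc 128000 * m * (2 : ℝ) ^ e ≤ 2 ^ 17 * 2 ^ m * 2 ^ e := by gcongr; norm_num
      _ = 2 ^ (17 + m + e) := by rw [pow_add, pow_add]
      _ ≤ _ := by apply pow_le_pow_right₀ (by norm_num); omega
  rw [h1, Real.exp_neg]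
  have h4 : 64 * 2 ^ e * (Real.exp (31.25 * m))⁻¹ ≤ 1 / (2000 * m) := by
    rw [← div_eq_mul_inv, div_le_div_iff₀ (Real.exp_pos _) (by positivity)]
    calc 64 * 2 ^ e * (2000 * m : ℝ) = 128000 * m * (2 : ℝ) ^ e := by ring
      _ ≤ _ := by rw [one_mul]; exact h3.trans h2
  have h5 : 2 * (1 / (4000 * m : ℝ)) = 1 / (2000 * m) := by field_simp; norm_num
  have h6 : 1 / (1000 * m : ℝ) = 1 / (2000 * m) + 1 / (2000 * m) := by field_simp; norm_num
  linarith

theorem spectral_error_le {e M : ℕ} (hM : e + 12 ≤ M) :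
    M * (9 / 8 : ℝ) ^ M * (2 * (1 / 16) ^ M + M * (1 / 16) ^ M) ≤ 1 / (4096 * 2 ^ e) := by
  have h1 : (M : ℝ) ≤ 2 ^ M := by exact_mod_cast Nat.lt_two_pow_self.le
  have h2 : (M : ℝ) + 2 ≤ 2 ^ M * 2 := by
    have : (4 : ℝ) ≤ 2 ^ M := by
      calc (4 : ℝ) = 2 ^ 2 := by norm_num
        _ ≤ _ := pow_le_pow_right₀ (by norm_num) (by omega)
    linarith
  have h3 : (1 : ℝ) / (4096 * 2 ^ e) = (1 / 2) ^ (e + 12) := by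
    rw [pow_add, one_div_pow, one_div_pow]; field_simp; norm_num
  rw [h3]
  have h4 : (2 : ℝ) * (9 / 8) ^ M ≤ 2 ^ M := by
    have e1 : (2 : ℝ) ≤ (16 / 9) ^ M := by
      calc (2 : ℝ) ≤ (16 / 9) ^ 2 := by norm_num
        _ ≤ _ := pow_le_pow_right₀ (by norm_num) (by omega)
    calc (2 : ℝ) * (9 / 8) ^ M ≤ (16 / 9) ^ M * (9 / 8) ^ M := by gcongr
      _ = 2 ^ M := by rw [← mul_pow]; norm_num
  calc M * (9 / 8 : ℝ) ^ M * (2 * (1 / 16) ^ M + M * (1 / 16) ^ M)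
      = M * (9 / 8 : ℝ) ^ M * (M + 2) * (1 / 16) ^ M := by ring
    _ ≤ 2 ^ M * (9 / 8) ^ M * (2 ^ M * 2) * (1 / 16) ^ M := by gcongr
    _ = 2 ^ M * (2 * (9 / 8) ^ M) * 2 ^ M * (1 / 16) ^ M := by ring
    _ ≤ 2 ^ M * 2 ^ M * 2 ^ M * (1 / 16) ^ M := by gcongr
    _ = (1 / 2) ^ M := by rw [← mul_pow, ← mul_pow, ← mul_pow]; norm_num
    _ ≤ _ := pow_le_pow_of_le_one (by norm_num) (by norm_num) hM

end Numerics

/-! ### A Bohr translate consisting mostly of popular differences. -/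

section Increment

variable {G : Type*} [AddCommGroup G] [Fintype G] [DecidableEq G]

/-- The Bohr set of radius `r` grows by a factor at most `1 + ε` when `r` is increased slightly. -/
def RegularAt (Γ : Finset (AddChar G ℂ)) (d : ℕ) (ε r : ℝ) : Prop :=
  ((bohr Γ (r + ε * r / (28 * (d + 1)))).card : ℝ) ≤ (1 + ε) * (bohr Γ r).card

theorem RegularAt.card_le {Γ : Finset (AddChar G ℂ)} {d : ℕ} {ε r s : ℝ} (h : RegularAt Γ d ε r)
    (hs : s ≤ r + ε * r / (28 * (d + 1))) : ((bohr Γ s).card : ℝ) ≤ (1 + ε) * (bohr Γ r).card :=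
  le_trans (by exact_mod_cast Finset.card_le_card (bohr_mono (Finset.Subset.refl _) hs)) h

theorem RegularAt.card_filter_le {Γ : Finset (AddChar G ℂ)} {d : ℕ} {ε r s : ℝ}
    (h : RegularAt Γ d ε r) (hs0 : 0 ≤ s) (hs : s ≤ ε * r / (28 * (d + 1))) {y : G}
    (hy : y ∈ bohr Γ s) :
    (((bohr Γ r).filter fun b => b + y ∉ bohr Γ r).card : ℝ) ≤ ε * (bohr Γ r).card :=
  card_filter_add_notMem_bohr_le Γ hs0 hy (h.card_le (by linarith))

-- Start from the average of `s` over `D - D₂`, with `D₂` a local piece of `D`; it is close to `1`.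
-- Averaging further over `m` almost-periods changes it little at `0`. The result is nearly constant
-- on a Bohr set that annihilates the large spectrum of the almost-periods approximately, so some
-- translate of that set has large `s`-mass.
set_option maxHeartbeats 1000000 in
theorem exists_bohr_translate {Γ : Finset (AddChar G ℂ)} {d e m n M : ℕ} {ε ρ : ℝ}
    (hε : 0 < ε) (hε1 : ε ≤ 1) (hρ : 0 < ρ) (hρ2 : ρ ≤ 2) (hm : e + 14 ≤ m)
    (hn : n = 10 ^ 9 * m ^ 3) (hM : M = 27 * (n * (e + 1) + 4)) (hd : Γ.card + M ≤ d)
    (hreg : RegularAt Γ d ε ρ) {D : Finset G} (hD : D ⊆ bohr Γ ρ) (hD0 : D.Nonempty)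
    (hDc : ((bohr Γ ρ).card : ℝ) ≤ 2 ^ e * D.card) {s : G → ℝ} (hs0 : ∀ x, 0 ≤ s x)
    (hs1 : ∀ x, s x ≤ 1) (hbad : 1000 * ∑ z ∈ D, ∑ z' ∈ D, (1 - s (z' - z)) ≤ (D.card : ℝ) ^ 2) :
    ∃ (Γ' : Finset (AddChar G ℂ)) (ρ' : ℝ), Γ'.card ≤ Γ.card + M ∧ ρ' ≤ 2 ∧
      ρ * ((ε / (28 * (d + 1))) ^ 2 * (1 / 16) ^ M / (1792 * (d + 1) * (m + 1))) ≤ ρ' ∧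
      RegularAt Γ' d ε ρ' ∧
      ∃ x, 0.99 * ((bohr Γ' ρ').card : ℝ) ≤ ∑ w ∈ bohr Γ' ρ', s (x + w) := by
  classical
  have hm0 : (0 : ℝ) < m := by exact_mod_cast (by omega : 0 < m)
  have hm1 : (0 : ℝ) < m + 1 := by positivity
  have hn0 : 0 < n := by rw [hn]; have : 0 < m := by omega
                         positivity
  have hd0 : (0 : ℝ) < (d : ℝ) + 1 := by positivity
  have hDpos : (0 : ℝ) < D.card := by exact_mod_cast hD0.card_pos
  have hMe : e + 12 ≤ M := by rw [hM]; nlinarith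
  have hM0 : 0 < M := by omega
  set θ : ℝ := ε / (28 * (d + 1)) with hθ
  have hθ0 : 0 < θ := by positivity
  have hθ1 : θ ≤ 1 / 28 := by
    rw [hθ, div_le_div_iff₀ (by positivity) (by norm_num)]
    nlinarith [show (0 : ℝ) ≤ d from Nat.cast_nonneg d]
  have hθr : ∀ r : ℝ, ε * r / (28 * (d + 1)) = θ * r := fun r => by rw [hθ]; ring
  have hΓd : Γ.card ≤ d := by omega
  obtain ⟨ρ₂, hρ₂l, hρ₂u, hreg₂⟩ := exists_regular_radius Γ hΓd
    (show 0 < θ * ρ / 4 by positivity) hε hε1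
  have hreg₂' : RegularAt Γ d ε ρ₂ := hreg₂
  have hρ₂0 : 0 < ρ₂ := lt_of_lt_of_le (by positivity) hρ₂l
  set εU : ℝ := (1 / 16) ^ M with hεU
  have hεU0 : 0 < εU := by positivity
  have hεU1 : εU ≤ 1 := pow_le_one₀ (by norm_num) (by norm_num)
  -- The almost-periods live here. Regularity to precision `16^(-M)` is needed against the factor
  -- `(9/8)^M` in the spectral estimate, and the divisor `m + 1` leaves room for `m` shifts.
  obtain ⟨ρU, hρUl, hρUu, hregU⟩ := exists_regular_radius Γ hΓd
    (show 0 < θ * ρ₂ / (8 * (m + 1)) by positivity) hεU0 hεU1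
  have hregU' : RegularAt Γ d εU ρU := hregU
  have hρU0 : 0 < ρU := lt_of_lt_of_le (by positivity) hρUl
  have hρUm : ρU * (m + 1) ≤ θ * ρ₂ / 4 := by
    calc ρU * (m + 1) ≤ 2 * (θ * ρ₂ / (8 * (m + 1))) * (m + 1) := by gcongr
      _ = θ * ρ₂ / 4 := by field_simp; norm_num
  have hρUθ : ρU ≤ θ * ρ₂ / 4 := (le_mul_of_one_le_right hρU0.le (by linarith)).trans hρUm
  have hθρ0 : 0 < θ * ρ := by positivity
  have hθρ₂0 : 0 < θ * ρ₂ := by positivity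
  have hρ₂θ : ρ₂ ≤ θ * ρ := by linarith
  have hρ₂le : ρ₂ ≤ ρ := hρ₂θ.trans (mul_le_of_le_one_left hρ.le (by linarith))
  have hρUρ : ρU ≤ θ * ρ := by
    have : θ * ρ₂ ≤ θ * ρ := mul_le_mul_of_nonneg_left hρ₂le hθ0.le
    linarith
  have hρU1 : ρU ≤ 1 := by
    have : θ * ρ ≤ 1 / 28 * 2 := mul_le_mul hθ1 hρ2 hρ.le (by norm_num)
    linarith
  set Y := bohr Γ ρ with hY
  set Y₂ := bohr Γ ρ₂ with hY₂
  set X := bohr Γ (ρ + θ * ρ) with hX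
  have hXc : (X.card : ℝ) ≤ 2 * 2 ^ e * D.card := by
    have h1 := hreg.card_le (s := ρ + θ * ρ) (by rw [hθr])
    have h2 : (0 : ℝ) ≤ Y.card := Nat.cast_nonneg _
    calc (X.card : ℝ) ≤ (1 + ε) * Y.card := h1
      _ ≤ 2 * Y.card := by gcongr; linarith
      _ ≤ 2 * (2 ^ e * D.card) := by gcongr
      _ = _ := by ring
  have hcover : ∀ z ∈ D, ∀ y ∈ Y₂, z - y ∈ X := fun z hz y hy =>
    sub_mem_bohr (hD hz) hy (add_le_add_right hρ₂θ ρ)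
  obtain ⟨x₀, hx₀c, hx₀b⟩ := exists_local_piece hD0 (bohr_nonempty Γ hρ₂0.le) hcover
    (w := fun x => 1 - s x) (fun x => by linarith [hs1 x]) (K := 2 ^ e) (by positivity) hXc hbad
  set D₂ := D.filter fun z => z - x₀ ∈ Y₂ with hD₂
  have hY₂pos : (0 : ℝ) < Y₂.card := card_bohr_pos Γ hρ₂0.le
  have hD₂pos : (0 : ℝ) < D₂.card := by
    by_contra! h
    have : (4 * 2 ^ e * D₂.card : ℝ) ≤ 0 := mul_nonpos_of_nonneg_of_nonpos (by positivity) h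
    linarith
  have hD₂0 : D₂.Nonempty := by
    rw [← Finset.card_pos]; exact_mod_cast hD₂pos
  -- Truncation leaves the average at `0` unchanged. As `D₂` is narrow, `D - D₂` fits in a translate
  -- of `X`, so Parseval costs only a multiple of `2^e |D|`; `D - D` would cost the doubling of the
  -- Bohr set.
  set s' : G → ℝ := fun v => if v ∈ D - D₂ then s v else 0 with hs'
  have hs'0 : ∀ x, 0 ≤ s' x := fun x => by
    simp only [hs']; split_ifs; exacts [hs0 x, le_rfl]
  have hs's : ∀ x, s' x ≤ s x := fun x => by
    simp only [hs']; split_ifs; exacts [le_rfl, hs0 x]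
  have hs'1 : ∀ x, s' x ≤ 1 := fun x => (hs's x).trans (hs1 x)
  have hI0 : 1 - 2 / 1000 ≤ diffAvg D D₂ s' 0 := by
    refine one_sub_le_diffAvg_zero hD0 hD₂0 ?_
    have h1 : ∑ z ∈ D₂, ∑ z' ∈ D, (1 - s' (z' - z)) = ∑ z ∈ D₂, ∑ z' ∈ D, (1 - s (z' - z)) := by
      refine Finset.sum_congr rfl fun z hz => Finset.sum_congr rfl fun z' hz' => ?_
      simp only [hs']
      rw [if_pos (Finset.sub_mem_sub hz' hz)]
    rw [h1]
    linarith
  have hs'sq : ∑ x, s' x ^ 2 ≤ 2 * 2 ^ e * D.card := by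
    refine le_trans ?_ hXc
    have h1 : (D - D₂).card ≤ X.card := by
      refine Finset.card_le_card_of_injOn (fun v => v + x₀) ?_ fun a _ b _ h => by simpa using h
      intro v hv
      obtain ⟨a, ha, b, hb, rfl⟩ := Finset.mem_sub.1 (Finset.mem_coe.1 hv)
      have hb' := (Finset.mem_filter.1 hb).2
      have h1 := hcover a ha _ hb'
      rw [show a - (b - x₀) = a - b + x₀ by abel] at h1
      exact Finset.mem_coe.2 h1
    calc ∑ x, s' x ^ 2 ≤ ∑ x, ofSet (D - D₂) x := by
          refine Finset.sum_le_sum fun x _ => ?_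
          simp only [hs', ofSet]
          split_ifs
          · exact pow_le_one₀ (hs0 x) (hs1 x)
          · norm_num
      _ = (D - D₂).card := sum_ofSet _
      _ ≤ X.card := by exact_mod_cast h1
  set U := bohr Γ ρU with hU
  have hU0 : U.Nonempty := bohr_nonempty Γ hρU0.le
  have hDU : ((D + U).card : ℝ) ≤ 2 ^ (e + 1) * D.card := by
    have h1 : D + U ⊆ X := by
      intro v hv
      obtain ⟨a, ha, b, hb, rfl⟩ := Finset.mem_add.1 hv
      exact add_mem_bohr (hD ha) hb (add_le_add_right hρUρ ρ)
    calc ((D + U).card : ℝ) ≤ X.card := by exact_mod_cast Finset.card_le_card h1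
      _ ≤ _ := hXc
      _ = _ := by rw [pow_succ]; ring
  set Z : Finset G := univ.filter fun z => z + x₀ ∈ bohr Γ (ρ₂ + θ * ρ₂) with hZ
  have hZc : (Z.card : ℝ) ≤ 8 * 2 ^ e * D₂.card := by
    have h1 : Z.card ≤ (bohr Γ (ρ₂ + θ * ρ₂)).card := by
      refine Finset.card_le_card_of_injOn (fun z => z + x₀) ?_ fun a _ b _ h => by simpa using h
      intro z hz
      exact (Finset.mem_filter.1 (Finset.mem_coe.1 hz)).2
    have h2 := hreg₂'.card_le (s := ρ₂ + θ * ρ₂) (by rw [hθr])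
    calc (Z.card : ℝ) ≤ (bohr Γ (ρ₂ + θ * ρ₂)).card := by exact_mod_cast h1
      _ ≤ (1 + ε) * Y₂.card := h2
      _ ≤ 2 * (4 * 2 ^ e * D₂.card) := by gcongr; linarith
      _ = _ := by ring
  set ε₂ : ℝ := 1 / (4000 * m) with hε₂
  have hε₂0 : 0 ≤ ε₂ := by positivity
  obtain ⟨T, hTU, hTc, hT⟩ := exists_almost_periods hD0 hU0 Z hs'0 hs'1 hn0 hε₂0 hDU
  have hUpos : (0 : ℝ) < U.card := by exact_mod_cast hU0.card_pos
  have hT0 : T.Nonempty := by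
    rw [Finset.nonempty_iff_ne_empty]
    rintro rfl
    rw [Finset.card_empty, Nat.cast_zero, mul_zero] at hTc
    exact absurd hUpos hTc.not_gt
  obtain ⟨t₀, ht₀⟩ := hT0
  have hT0 : T.Nonempty := ⟨t₀, ht₀⟩
  have hTpos : (0 : ℝ) < T.card := by exact_mod_cast hT0.card_pos
  have hdrift := abs_iterShift_sub_le hT0 t₀ (diffAvg D D₂ s')
    (fun j => (bohr Γ (((m : ℝ) - j) * (2 * ρU)) : Set G)) m (κ := 1 / (1000 * m))
    (by
      intro j hj y hy t ht
      have h1 := sub_mem_bohr (hTU ht) (hTU ht₀) (t := 2 * ρU) (by linarith)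
      refine Finset.mem_coe.2 (add_mem_bohr (Finset.mem_coe.1 hy) h1 ?_)
      push_cast
      linarith)
    (by
      intro j hj y hy t ht
      have hjm : ((j + 1 : ℕ) : ℝ) ≤ m := by exact_mod_cast hj
      have hy' : y ∈ bohr Γ (θ * ρ₂ / 2) := by
        refine bohr_mono (Finset.Subset.refl _) ?_ (Finset.mem_coe.1 hy)
        have h1 : (m : ℝ) - (j + 1 : ℕ) ≤ m + 1 := by
          have : (0 : ℝ) ≤ ((j + 1 : ℕ) : ℝ) := Nat.cast_nonneg _
          linarith
        have h2 := mul_le_mul_of_nonneg_right h1 (show 0 ≤ 2 * ρU by positivity)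
        linarith
      have htt : t - t₀ ∈ bohr Γ (θ * ρ₂ / 2) := sub_mem_bohr (hTU ht) (hTU ht₀) (by linarith)
      have hytt : y + (t - t₀) ∈ bohr Γ (θ * ρ₂) := add_mem_bohr hy' htt (by linarith)
      have hy'' : y ∈ bohr Γ (θ * ρ₂) := bohr_mono (Finset.Subset.refl _)
        (by linarith) hy'
      have hmemZ : ∀ v ∈ bohr Γ (θ * ρ₂), ∀ b ∈ D₂, v - b ∈ Z := by
        intro v hv b hb
        have hb' := (Finset.mem_filter.1 hb).2
        refine Finset.mem_filter.2 ⟨Finset.mem_univ _, ?_⟩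
        have h1 := sub_mem_bohr hv hb' (add_comm _ _).le
        rwa [show v - (b - x₀) = v - b + x₀ by abel] at h1
      refine (abs_diffAvg_sub_le hD₂0 hs'0 hs'1 hε₂0 (hT t ht t₀ ht₀) (hmemZ y hy'')
        (hmemZ _ hytt)).trans ?_
      refine le_trans ?_ (exp_neg_sampling_le hm hn)
      rw [← hε₂]
      gcongr
      rw [div_le_iff₀ hD₂pos]
      calc 8 * Real.exp (-(n * ε₂ ^ 2 / 2)) * Z.card
          ≤ 8 * Real.exp (-(n * ε₂ ^ 2 / 2)) * (8 * 2 ^ e * D₂.card) := by gcongr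
        _ = _ := by ring)
    m le_rfl 0 (Finset.mem_coe.2 (zero_mem_bohr Γ (by simp)))
  have hmk : (m : ℝ) * (1 / (1000 * m)) = 1 / 1000 := by field_simp
  rw [hmk] at hdrift
  obtain ⟨L, hLM, hL⟩ := exists_chars_controlling_spectrum hTU hT0 hM0 (by
    -- The factor `27` in `M` is chosen because `27 * 3 / 80 > 1`.
    have h1 : (2 : ℝ) ^ (n * (e + 1) + 4) ≤ Real.exp (3 * M / 80) := by
      have e1 : (2 : ℝ) ≤ Real.exp 1 := by linarith [Real.add_one_le_exp (1 : ℝ)]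
      calc (2 : ℝ) ^ (n * (e + 1) + 4) ≤ Real.exp 1 ^ (n * (e + 1) + 4) := by gcongr
        _ = Real.exp ((n * (e + 1) + 4 : ℕ)) := by rw [← Real.exp_nat_mul, mul_one]
        _ ≤ _ := by
          gcongr
          rw [hM]; push_cast
          have : (0 : ℝ) ≤ (n : ℝ) * (e + 1) := by positivity
          linarith
    calc 2 * (U.card : ℝ) ≤ 2 * (2 * (2 ^ (e + 1)) ^ n * T.card) := by gcongr
      _ = 2 ^ (n * (e + 1) + 2) * T.card := by
          rw [← pow_mul, mul_comm (e + 1) n, pow_add]; ring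
      _ < 2 ^ (n * (e + 1) + 4) * T.card := by
          gcongr
          · norm_num
          · norm_num
      _ ≤ _ := by gcongr)
  set Γ' := Γ ∪ L with hΓ'
  have hΓ'c : Γ'.card ≤ Γ.card + M := (Finset.card_union_le _ _).trans (by omega)
  obtain ⟨ρ', hρ'l, hρ'u, hreg'⟩ := exists_regular_radius Γ' (hΓ'c.trans hd)
    (show 0 < εU * ρU / (56 * (d + 1)) by positivity) hε hε1
  have hρ'u2 : ρ' ≤ εU * ρU / (28 * (d + 1)) := by
    refine hρ'u.trans (le_of_eq ?_)
    field_simp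
    norm_num
  have hρ'0 : 0 < ρ' := lt_of_lt_of_le (by positivity) hρ'l
  have hρ'εU : ρ' ≤ εU := by
    refine hρ'u2.trans ?_
    refine div_le_of_le_mul₀ (by positivity) hεU0.le (mul_le_mul_of_nonneg_left ?_ hεU0.le)
    have : (0 : ℝ) ≤ d := Nat.cast_nonneg d
    linarith
  refine ⟨Γ', ρ', hΓ'c, by linarith, ?_, hreg', ?_⟩
  · refine le_trans ?_ hρ'l
    calc ρ * (θ ^ 2 * εU / (1792 * (d + 1) * (m + 1)))
        = εU * (θ * (θ * ρ / 4) / (8 * (m + 1))) / (56 * (d + 1)) := by field_simp; norm_num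
      _ ≤ εU * ρU / (56 * (d + 1)) := by
          gcongr
          refine le_trans ?_ hρUl
          gcongr
  · set W := bohr Γ' ρ' with hW
    have hWpos : (0 : ℝ) < W.card := card_bohr_pos Γ' hρ'0.le
    -- Three losses from `1`: `2/1000` from bad pairs, `1/1000` from the drift at `0`, and `1/1000`
    -- from the Fourier estimate.
    have hIW : ∀ w ∈ W, 0.996 ≤ iterShift T t₀ (diffAvg D D₂ s') m w := by
      intro w hw
      have hwΓ : w ∈ bohr Γ ρ' := bohr_mono Finset.subset_union_left le_rfl hw
      have h1 := hL w εU εU hεU0.le hεU0.le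
        (fun l hl => ((mem_bohr.1 hw) l (Finset.mem_union_right _ hl)).trans hρ'εU)
        (hregU'.card_filter_le hρ'0.le hρ'u2 hwΓ)
      have h2 := abs_iterShift_diffAvg_sub_le (D' := D₂) hD0 hT0 t₀ s' m (y := w) (by positivity)
        (fun χ hχ => (h1 χ hχ).trans (spectral_error_le hMe))
      have h3 : (∑ x, s' x ^ 2 + D.card) / (2 * D.card) ≤ 2 * 2 ^ e := by
        rw [div_le_iff₀ (by positivity)]
        have h1 : (1 : ℝ) ≤ 2 ^ e := one_le_pow₀ (by norm_num)
        have h2 := mul_le_mul_of_nonneg_right h1 hDpos.le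
        linarith
      have h4 : (2 : ℝ) * (1 / 2) ^ m ≤ 2 / (2 ^ e * 2 ^ 14) := by
        rw [one_div_pow, mul_one_div, ← pow_add]
        gcongr
        norm_num
      have h5 : (2 * (1 / 2) ^ m + 1 / (4096 * 2 ^ e)) *
          ((∑ x, s' x ^ 2 + D.card) / (2 * D.card)) ≤ 1 / 1000 := by
        calc _ ≤ (2 / (2 ^ e * 2 ^ 14) + 1 / (4096 * 2 ^ e)) * (2 * (2 : ℝ) ^ e) := by gcongr
          _ = 2 * 2 / 2 ^ 14 + 2 / 4096 := by field_simp
          _ ≤ _ := by norm_num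
      have h6 := h2.trans h5
      rw [abs_le] at h6 hdrift
      linarith [h6.1, hdrift.1]
    by_contra! hcon
    have h1 : ∀ x, ∑ w ∈ W, s' (x + w) ≤ 0.99 * W.card := fun x =>
      (Finset.sum_le_sum fun w _ => hs's _).trans (hcon x).le
    have h2 := sum_iterShift_le hT0 t₀ (sum_diffAvg_le hD0 hD₂0 h1) m 0
    simp only [zero_add] at h2
    have h3 := Finset.card_nsmul_le_sum W _ _ hIW
    rw [nsmul_eq_mul] at h3
    linarith

end Increment

/-! ### Counting progressions and passing to translates. -/

section Step

variable {G : Type*} [AddCommGroup G] [Fintype G] [DecidableEq G]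

/-- The number of solutions to `a + c = b + b` in `A`. -/
def apCount (A : Finset G) : ℝ := ∑ b ∈ A, sconv (ofSet A) (ofSet A) (b + b)

theorem sum_sconv_le_apCount {A A₁ A₂ : Finset G} {z : G} (h₁ : ∀ x ∈ A₁, z + x ∈ A)
    (h₂ : ∀ x ∈ A₂, z + x ∈ A) :
    ∑ b ∈ A₂, sconv (ofSet A₁) (ofSet A₁) (b + b) ≤ apCount A := by
  have hle : ∀ x, ofSet A₁ x ≤ ofSet A (z + x) := by
    intro x
    by_cases hx : x ∈ A₁
    · simp [ofSet, hx, h₁ x hx]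
    · simp only [ofSet, if_neg hx]
      split_ifs <;> norm_num
  have h3 : ∀ b, sconv (ofSet A₁) (ofSet A₁) (b + b) ≤
      sconv (ofSet A) (ofSet A) (z + b + (z + b)) := by
    intro b
    unfold sconv
    rw [← Equiv.sum_comp (Equiv.addLeft z) fun y => ofSet A y * ofSet A (z + b + (z + b) - y)]
    refine Finset.sum_le_sum fun y _ => ?_
    simp only [Equiv.coe_addLeft]
    rw [show z + b + (z + b) - (z + y) = z + (b + b - y) by abel]
    exact mul_le_mul (hle _) (hle _) (ofSet_nonneg _ _) (ofSet_nonneg _ _)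
  calc _ ≤ ∑ b ∈ A₂, sconv (ofSet A) (ofSet A) (z + b + (z + b)) :=
        Finset.sum_le_sum fun b _ => h3 b
    _ = ∑ b ∈ A₂.image fun b => z + b, sconv (ofSet A) (ofSet A) (b + b) := by
        rw [Finset.sum_image fun a _ b _ h => by simpa using h]
    _ ≤ apCount A := by
        refine Finset.sum_le_sum_of_subset_of_nonneg ?_ fun _ _ _ => sconv_nonneg _ _ _
        intro x hx
        obtain ⟨b, hb, rfl⟩ := Finset.mem_image.1 hx
        exact h₂ b hb

/-- The points of `S` which a translation by `z` moves into `A`. -/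
def translatePart (A : Finset G) (z : G) (S : Finset G) : Finset G := S.filter fun x => z + x ∈ A

theorem card_mul_card_translatePart_le {A B S X : Finset G} {z : G}
    (hX : ∀ b ∈ B, ∀ y ∈ S, b - y ∈ X) :
    (S.card : ℝ) * (translatePart A z B).card ≤
      ∑ x ∈ X, ((translatePart A (z + x) S).card : ℝ) := by
  have h := sum_sum_filter_sub_mem (D := translatePart A z B) (Y := S) (X := X)
    (fun b hb => hX b (Finset.mem_filter.1 hb).1) fun _ => (1 : ℝ)
  simp only [Finset.sum_const, nsmul_eq_mul, mul_one] at h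
  rw [← h]
  refine Finset.sum_le_sum fun x _ => ?_
  norm_cast
  refine Finset.card_le_card_of_injOn (fun v => v - x) ?_ fun a _ b _ h => by simpa using h
  intro v hv
  obtain ⟨hv1, hv2⟩ := Finset.mem_filter.1 (Finset.mem_coe.1 hv)
  refine Finset.mem_coe.2 (Finset.mem_filter.2 ⟨hv2, ?_⟩)
  rw [show z + x + (v - x) = z + v by abel]
  exact (Finset.mem_filter.1 hv1).2

/-- Averaged over `X`, the density of `A` on translates of `S`, and likewise of `S'`, is at least
`(1 - ε) a`; averaging the sum of the two finds one translate serving both. -/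
theorem exists_simultaneous_translate {A B S S' X : Finset G} {z : G} {a ε : ℝ} (ha : 0 ≤ a)
    (hB0 : B.Nonempty) (hS0 : S.Nonempty) (hS0' : S'.Nonempty)
    (hX : ∀ b ∈ B, ∀ y ∈ S, b - y ∈ X) (hX' : ∀ b ∈ B, ∀ y ∈ S', b - y ∈ X)
    (hXB : (X.card : ℝ) ≤ (1 + ε) * B.card)
    (hdens : a * B.card ≤ (translatePart A z B).card) :
    ∃ x, 2 * (1 - ε) * a ≤ (translatePart A x S).card / (S.card : ℝ) +
      (translatePart A x S').card / (S'.card : ℝ) := by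
  have hSc : (0 : ℝ) < S.card := by exact_mod_cast hS0.card_pos
  have hSc' : (0 : ℝ) < S'.card := by exact_mod_cast hS0'.card_pos
  have hBc : (0 : ℝ) < B.card := by exact_mod_cast hB0.card_pos
  have hX0 : X.Nonempty := by
    obtain ⟨b, hb⟩ := hB0
    obtain ⟨y, hy⟩ := hS0
    exact ⟨_, hX b hb y hy⟩
  have h1 := card_mul_card_translatePart_le (A := A) (z := z) hX
  have h2 := card_mul_card_translatePart_le (A := A) (z := z) hX'
  have h3 : ∑ x ∈ X, (2 * (1 - ε) * a) ≤
      ∑ x ∈ X, ((translatePart A (z + x) S).card / (S.card : ℝ) +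
        (translatePart A (z + x) S').card / (S'.card : ℝ)) := by
    rw [Finset.sum_add_distrib, ← Finset.sum_div, ← Finset.sum_div, Finset.sum_const, nsmul_eq_mul]
    have h4 : (translatePart A z B).card ≤
        (∑ x ∈ X, ((translatePart A (z + x) S).card : ℝ)) / S.card := by
      rw [le_div_iff₀ hSc]; linarith
    have h5 : (translatePart A z B).card ≤
        (∑ x ∈ X, ((translatePart A (z + x) S').card : ℝ)) / S'.card := by
      rw [le_div_iff₀ hSc']; linarith
    have h6 : (X.card : ℝ) * (1 - ε) ≤ B.card := by
      rcases le_total ε 1 with h | h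
      · calc (X.card : ℝ) * (1 - ε) ≤ ((1 + ε) * B.card) * (1 - ε) := by
              gcongr
          _ = (1 - ε ^ 2) * B.card := by ring
          _ ≤ 1 * B.card := by gcongr; nlinarith
          _ = B.card := one_mul _
      · have : (X.card : ℝ) * (1 - ε) ≤ 0 :=
          mul_nonpos_of_nonneg_of_nonpos (Nat.cast_nonneg _) (by linarith)
        linarith
    have h7 := mul_le_mul_of_nonneg_right h6 ha
    linarith
  obtain ⟨x, -, hx⟩ := Finset.exists_le_of_sum_le hX0 h3
  exact ⟨z + x, hx⟩

theorem exists_translate_of_sum_corr {A W : Finset G} {x : G} {κ : ℝ} (hA : A.Nonempty)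
    (h : κ * A.card ≤ ∑ w ∈ W, corr (ofSet A) (ofSet A) (x + w)) :
    ∃ b ∈ A, κ ≤ (W.filter fun w => b + (x + w) ∈ A).card := by
  have h1 : ∑ w ∈ W, corr (ofSet A) (ofSet A) (x + w) =
      ∑ b ∈ A, ((W.filter fun w => b + (x + w) ∈ A).card : ℝ) := by
    unfold corr
    rw [Finset.sum_comm, ← sum_ofSet_mul A fun b => ((W.filter fun w => b + (x + w) ∈ A).card : ℝ)]
    refine Finset.sum_congr rfl fun b _ => ?_
    rw [← Finset.mul_sum]
    congr 1
    simp [ofSet]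
  have h2 : ∑ _b ∈ A, κ ≤ ∑ b ∈ A, ((W.filter fun w => b + (x + w) ∈ A).card : ℝ) := by
    rw [Finset.sum_const, nsmul_eq_mul, ← h1]; linarith
  exact Finset.exists_le_of_sum_le hA h2

/-! ### Halving and its effect on Bohr sets. -/

section Half

/-- Pull back a set of characters along `hf`. -/
noncomputable def pullChars (hf : G →+ G) (Γ : Finset (AddChar G ℂ)) : Finset (AddChar G ℂ) :=
  Γ.image fun γ => γ.compAddMonoidHom hf

theorem mem_bohr_pullChars {hf : G →+ G} {Γ : Finset (AddChar G ℂ)} {r : ℝ} {x : G} :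
    x ∈ bohr (pullChars hf Γ) r ↔ hf x ∈ bohr Γ r := by
  simp [mem_bohr, pullChars]

theorem half_add_self {hf : G →+ G} (hh : ∀ x, hf x + hf x = x)
    (x : G) : hf (x + x) = x := by rw [map_add]; exact hh x

theorem add_self_injective {hf : G →+ G} (hh : ∀ x, hf x + hf x = x) :
    Function.Injective fun x : G => x + x := fun x y h => by
  rw [← half_add_self hh x, ← half_add_self hh y]; exact congrArg hf h

theorem bohr_pullChars_eq_image {hf : G →+ G} (hh : ∀ x, hf x + hf x = x)
    (Γ : Finset (AddChar G ℂ)) (r : ℝ) :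
    bohr (pullChars hf Γ) r = (bohr Γ r).image fun x => x + x := by
  ext x
  rw [mem_bohr_pullChars, Finset.mem_image]
  constructor
  · intro h; exact ⟨hf x, h, hh x⟩
  · rintro ⟨y, hy, rfl⟩; rwa [half_add_self hh]

theorem card_bohr_pullChars {hf : G →+ G} (hh : ∀ x, hf x + hf x = x)
    (Γ : Finset (AddChar G ℂ)) (r : ℝ) :
    (bohr (pullChars hf Γ) r).card = (bohr Γ r).card := by
  rw [bohr_pullChars_eq_image hh, Finset.card_image_of_injective _ (add_self_injective hh)]

theorem bohr_pullChars_subset {hf : G →+ G} (hh : ∀ x, hf x + hf x = x)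
    (Γ : Finset (AddChar G ℂ)) (r : ℝ) :
    bohr (pullChars hf Γ) r ⊆ bohr Γ (2 * r) := by
  intro x hx
  rw [mem_bohr_pullChars] at hx
  rw [← hh x]
  exact add_mem_bohr hx hx (two_mul r).ge

theorem RegularAt.pullChars {hf : G →+ G} (hh : ∀ x, hf x + hf x = x)
    {Γ : Finset (AddChar G ℂ)} {d : ℕ} {ε r : ℝ} (h : RegularAt Γ d ε r) :
    RegularAt (pullChars hf Γ) d ε r := by
  unfold RegularAt at *
  rwa [card_bohr_pullChars hh, card_bohr_pullChars hh]

end Half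

end Step

/-! ### The density increment and its iteration. -/

section Main

variable {G : Type*} [AddCommGroup G] [Fintype G] [DecidableEq G]

theorem card_le_of_density {a : ℝ} {ℓ : ℕ} (hℓ : 1 ≤ ℓ) (ha : (1 / 2) ^ (ℓ + 1) ≤ a) {y x : ℝ}
    (hy : 0 ≤ y) (h : a ^ (9 * (40 * ℓ)) / 2 * y ≤ x) : y ≤ 2 ^ (721 * ℓ ^ 2) * x := by
  have h1 : (1 / 2 : ℝ) ^ (721 * ℓ ^ 2) ≤ a ^ (9 * (40 * ℓ)) / 2 := by
    calc (1 / 2 : ℝ) ^ (721 * ℓ ^ 2) ≤ (1 / 2) ^ ((ℓ + 1) * (9 * (40 * ℓ)) + 1) := by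
          apply pow_le_pow_of_le_one (by norm_num) (by norm_num); nlinarith
      _ = ((1 / 2) ^ (ℓ + 1)) ^ (9 * (40 * ℓ)) / 2 := by rw [pow_succ, pow_mul]; ring
      _ ≤ _ := by gcongr
  have h2 : (1 / 2 : ℝ) ^ (721 * ℓ ^ 2) * y ≤ x := (mul_le_mul_of_nonneg_right h1 hy).trans h
  rw [one_div_pow, one_div, inv_mul_le_iff₀ (by positivity)] at h2
  exact h2

-- The doubled middle terms `C` lie in the Bohr set of the pulled-back characters, which is the
-- double of the original one and has the same size. Hence `C` is dense there, and `Y` is taken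
-- narrow in the same family so that `C - Y - Y` stays within a set comparable to `C`. The exponent
-- `p = 40 * ℓ` absorbs the density of `C`.
set_option maxHeartbeats 1000000 in
theorem increment_of_few {hf : G →+ G} (hh : ∀ x, hf x + hf x = x) {Γ : Finset (AddChar G ℂ)}
    {d ℓ m n M : ℕ} {ε ρ₁ ρX a : ℝ} (hℓ : 1 ≤ ℓ) (hε : 0 < ε) (hε1 : ε ≤ 1)
    (hm : m = 735 * ℓ ^ 2) (hn : n = 10 ^ 9 * m ^ 3)
    (hM : M = 27 * (n * (721 * ℓ ^ 2 + 1) + 4)) (hd : Γ.card + M ≤ d)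
    (hρ₁2 : ρ₁ ≤ 2) (hρX : 0 < ρX) (hρX1 : 2 * ρX ≤ ε / (28 * (d + 1)) * ρ₁)
    (hreg₁ : RegularAt Γ d ε ρ₁) (hregX : RegularAt Γ d ε ρX) {A₁ A₂ : Finset G}
    (hA₁ : A₁ ⊆ bohr Γ ρ₁) (hA₁c : (A₁.card : ℝ) = a * (bohr Γ ρ₁).card)
    (ha : (1 / 2) ^ (ℓ + 1) ≤ a) (ha1 : a ≤ 1) (hεa : ε ≤ a / 200)
    (hA₂ : A₂ ⊆ bohr Γ ρX) (hA₂c : (1 / 2) ^ (ℓ + 1) * ((bohr Γ ρX).card : ℝ) ≤ A₂.card)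
    (hfew : ∑ b ∈ A₂, sconv (ofSet A₁) (ofSet A₁) (b + b) ≤
      a ^ 2 * (bohr Γ ρ₁).card * A₂.card / 4) :
    ∃ (Γ' : Finset (AddChar G ℂ)) (ρ' : ℝ), Γ'.card ≤ Γ.card + M ∧ ρ' ≤ 2 ∧
      ε / (28 * (d + 1)) * ρX / 4 *
        ((ε / (28 * (d + 1))) ^ 2 * (1 / 16) ^ M / (1792 * (d + 1) * (m + 1))) ≤ ρ' ∧
      RegularAt Γ' d ε ρ' ∧
      ∃ x, 1.0098 * a * ((bohr Γ' ρ').card : ℝ) ≤ (translatePart A₁ x (bohr Γ' ρ')).card := by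
  classical
  have hd0 : (0 : ℝ) < (d : ℝ) + 1 := by positivity
  set θ : ℝ := ε / (28 * (d + 1)) with hθ
  have hθ0 : 0 < θ := by positivity
  have hθ1 : θ ≤ 1 / 28 := by
    rw [hθ, div_le_div_iff₀ (by positivity) (by norm_num)]
    nlinarith [show (0 : ℝ) ≤ d from Nat.cast_nonneg d]
  have hθr : ∀ r : ℝ, ε * r / (28 * (d + 1)) = θ * r := fun r => by rw [hθ]; ring
  have ha0 : 0 < a := lt_of_lt_of_le (by positivity) ha
  have hρ₁0 : 0 < ρ₁ := by
    by_contra! h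
    have : θ * ρ₁ ≤ 0 := mul_nonpos_of_nonneg_of_nonpos hθ0.le h
    linarith
  have hθρ₁ : θ * ρ₁ ≤ 1 / 28 * 2 := mul_le_mul hθ1 hρ₁2 hρ₁0.le (by norm_num)
  have hθρX : θ * ρX ≤ 1 / 28 * ρX := mul_le_mul_of_nonneg_right hθ1 hρX.le
  set Γh := pullChars hf Γ with hΓh
  have hΓhc : Γh.card ≤ Γ.card := Finset.card_image_le
  obtain ⟨ρY, hρYl, hρYu, hregY⟩ := exists_regular_radius Γh (hΓhc.trans (show Γ.card ≤ d by omega))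
    (show 0 < θ * ρX / 4 by positivity) hε hε1
  have hregY' : RegularAt Γh d ε ρY := hregY
  have hρY0 : 0 < ρY := lt_of_lt_of_le (by positivity) hρYl
  have hregXh : RegularAt Γh d ε ρX := hregX.pullChars hh
  set B := bohr Γ ρ₁ with hB
  set Y := bohr Γh ρY with hY
  set X := bohr Γh (ρX + θ * ρX) with hX
  set C := A₂.image fun x => x + x with hC
  have hCc : C.card = A₂.card := Finset.card_image_of_injective _ (add_self_injective hh)
  have hXpos : (0 : ℝ) < (bohr Γ ρX).card := card_bohr_pos Γ hρX.le
  have hA₂0 : (0 : ℝ) < A₂.card := lt_of_lt_of_le (by positivity) hA₂c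
  have hC0 : C.Nonempty := by
    rw [← Finset.card_pos, hCc]; exact_mod_cast hA₂0
  have hCX : C ⊆ bohr Γh ρX := by
    rw [hΓh, bohr_pullChars_eq_image hh]
    exact Finset.image_subset_image hA₂
  have hXc : (X.card : ℝ) ≤ 2 ^ (40 * ℓ) * C.card := by
    have h1 := hregXh.card_le (s := ρX + θ * ρX) (by rw [hθr])
    rw [hΓh, card_bohr_pullChars hh Γ ρX] at h1
    have h2 : ((bohr Γ ρX).card : ℝ) ≤ 2 ^ (ℓ + 1) * A₂.card := by
      rw [one_div_pow, one_div, inv_mul_le_iff₀ (by positivity)] at hA₂c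
      exact hA₂c
    calc (X.card : ℝ) ≤ (1 + ε) * (bohr Γ ρX).card := h1
      _ ≤ 2 * (2 ^ (ℓ + 1) * A₂.card) := by gcongr; linarith
      _ = 2 ^ (ℓ + 2) * A₂.card := by ring
      _ ≤ 2 ^ (40 * ℓ) * A₂.card := by
          gcongr
          · norm_num
          · omega
      _ = _ := by rw [hCc]
  have hsumC : ∑ x ∈ C, sconv (ofSet A₁) (ofSet A₁) x =
      ∑ b ∈ A₂, sconv (ofSet A₁) (ofSet A₁) (b + b) :=
    Finset.sum_image fun x _ y _ h => add_self_injective hh h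
  have hYpos : (0 : ℝ) < Y.card := card_bohr_pos Γh hρY0.le
  obtain ⟨D, hDY, hDc, hD0, hDbad⟩ := exists_sifted_of_few (A := A₁) (B := B) (Y := Y) (C := C)
    (X := X) (ε := ε) (p := 40 * ℓ) hA₁ (fun x hx => neg_mem_bohr hx) (bohr_nonempty Γh hρY0.le)
    ha0 hεa ha1 hA₁c (bohr_nonempty Γ hρ₁0.le)
    (by
      intro x hx
      have h1 := bohr_pullChars_subset hh Γ ρX (hCX hx)
      exact hreg₁.card_filter_le (s := 2 * ρX) (by positivity) (by rw [hθr]; exact hρX1)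
        (neg_mem_bohr h1))
    (by
      intro y hy y' hy'
      have h1 := sub_mem_bohr hy hy' (t := ρX) (by linarith)
      have h2 := bohr_pullChars_subset hh Γ ρX h1
      exact hreg₁.card_filter_le (s := 2 * ρX) (by positivity) (by rw [hθr]; exact hρX1) h2)
    hC0
    (by
      intro x hx y hy y' hy'
      refine sub_mem_bohr (sub_mem_bohr (hCX hx) hy le_rfl) hy' ?_
      linarith)
    ((by decide : Even 40).mul_right ℓ) (by omega) hXc
    (by rw [hsumC, hCc]; exact hfew)
  set s : G → ℝ := fun x =>
    if corr (ofSet A₁) (ofSet A₁) x ≤ 1.02 * (a * A₁.card) then 0 else 1 with hs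
  have hs0 : ∀ x, 0 ≤ s x := fun x => by simp only [hs]; split_ifs <;> norm_num
  have hs1 : ∀ x, s x ≤ 1 := fun x => by simp only [hs]; split_ifs <;> norm_num
  have hDbad' : 1000 * ∑ z ∈ D, ∑ z' ∈ D, (1 - s (z' - z)) ≤ (D.card : ℝ) ^ 2 := by
    refine le_trans (le_of_eq ?_) hDbad
    simp only [Finset.mul_sum]
    refine Finset.sum_congr rfl fun z _ => Finset.sum_congr rfl fun z' _ => ?_
    simp only [hs]
    split_ifs <;> norm_num
  obtain ⟨Γ', ρ', hΓ'c, hρ'2, hρ'l, hreg', x, hx⟩ := exists_bohr_translate (e := 721 * ℓ ^ 2)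
    hε hε1 hρY0 (by linarith) (by rw [hm]; nlinarith) hn hM (by omega) hregY' hDY
    (Finset.card_pos.1 hD0) (card_le_of_density hℓ ha hYpos.le hDc) hs0 hs1 hDbad'
  refine ⟨Γ', ρ', by omega, hρ'2, ?_, hreg', ?_⟩
  · refine le_trans ?_ hρ'l
    gcongr
  · set W := bohr Γ' ρ' with hW
    have hA₁0 : A₁.Nonempty := by
      rw [← Finset.card_pos]
      have h1 : (0 : ℝ) < A₁.card := by
        rw [hA₁c]
        exact mul_pos ha0 (card_bohr_pos Γ hρ₁0.le)
      exact_mod_cast h1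
    have h1 : ∀ v, 1.02 * (a * A₁.card) * s v ≤ corr (ofSet A₁) (ofSet A₁) v := by
      intro v
      simp only [hs]
      split_ifs with h
      · rw [mul_zero]; exact corr_nonneg _ _ _
      · rw [mul_one]; exact (not_le.1 h).le
    have h2 : 1.0098 * a * (W.card : ℝ) * A₁.card ≤
        ∑ w ∈ W, corr (ofSet A₁) (ofSet A₁) (x + w) := by
      -- The popularity threshold times the popular proportion of `W`.
      calc 1.0098 * a * (W.card : ℝ) * A₁.card = 1.02 * (a * A₁.card) * (0.99 * W.card) := by ring
        _ ≤ 1.02 * (a * A₁.card) * ∑ w ∈ W, s (x + w) := by gcongr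
        _ ≤ _ := by
          rw [Finset.mul_sum]
          exact Finset.sum_le_sum fun w _ => h1 _
    obtain ⟨b, -, hb⟩ := exists_translate_of_sum_corr hA₁0 h2
    refine ⟨b + x, hb.trans (le_of_eq ?_)⟩
    simp only [translatePart, add_assoc]

/-- The factor by which radii shrink in one step of the density increment. -/
noncomputable def stepRatio (d M m : ℕ) (ε : ℝ) : ℝ :=
  (ε / (28 * (d + 1))) ^ 5 * (1 / 16) ^ M / (57344 * (d + 1) * (m + 1))

theorem pow_three_mul_sq_le {ℓ : ℕ} {a₁ a₂ x b : ℝ} (h₁ : (1 / 2) ^ ℓ * 0.9 ≤ a₁)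
    (h₂ : (1 / 2) ^ ℓ * 0.9 ≤ a₂) (hx : 0 ≤ x) (hxb : x ≤ b) :
    (1 / 2) ^ (3 * ℓ + 3) * x ^ 2 ≤ a₁ ^ 2 * b * (a₂ * x) / 4 := by
  have hb : 0 ≤ b := hx.trans hxb
  calc (1 / 2) ^ (3 * ℓ + 3) * x ^ 2 = ((1 / 2) ^ ℓ) ^ 3 * (1 / 8) * x ^ 2 := by
        rw [← pow_mul, pow_add, mul_comm ℓ 3]; norm_num
    _ ≤ ((1 / 2) ^ ℓ) ^ 3 * (0.9 ^ 3 / 4) * x ^ 2 :=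
        mul_le_mul_of_nonneg_right (mul_le_mul_of_nonneg_left (by norm_num) (by positivity))
          (by positivity)
    _ = ((1 / 2) ^ ℓ * 0.9) ^ 2 * x * (((1 / 2) ^ ℓ * 0.9) * x) / 4 := by ring
    _ ≤ a₁ ^ 2 * b * (a₂ * x) / 4 := by gcongr

-- Outer terms are sought in the piece at scale `ρ₁` and middle terms at the smaller scale `ρX`. If
-- either piece already gains a factor `1.001` the step is done. Otherwise both densities are at
-- least `0.997 a`, and either the progressions are plentiful or `increment_of_few` gives `1.0098 *
-- 0.997 > 1.001`.
set_option maxHeartbeats 1000000 in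
theorem density_step {hf : G →+ G} (hh : ∀ x, hf x + hf x = x) {A : Finset G}
    {Γ : Finset (AddChar G ℂ)} {d ℓ m n M : ℕ} {ε ρ a : ℝ} (hℓ : 1 ≤ ℓ)
    (hε : ε = (1 / 2) ^ ℓ / 1000)
    (hm : m = 735 * ℓ ^ 2) (hn : n = 10 ^ 9 * m ^ 3)
    (hM : M = 27 * (n * (721 * ℓ ^ 2 + 1) + 4)) (hd : Γ.card + M ≤ d)
    (hρ : 0 < ρ) (hρ2 : ρ ≤ 2) (hreg : RegularAt Γ d ε ρ) (ha : (1 / 2) ^ ℓ ≤ a) {z : G}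
    (hdens : a * (bohr Γ ρ).card ≤ (translatePart A z (bohr Γ ρ)).card) :
    (∃ (Γ' : Finset (AddChar G ℂ)) (ρ' : ℝ), Γ'.card ≤ d ∧ stepRatio d M m ε * ρ ≤ ρ' ∧
      (1 / 2) ^ (3 * ℓ + 3) * ((bohr Γ' ρ').card : ℝ) ^ 2 ≤ apCount A) ∨
    ∃ (Γ' : Finset (AddChar G ℂ)) (ρ' : ℝ) (z' : G), Γ'.card ≤ Γ.card + M ∧ ρ' ≤ 2 ∧
      stepRatio d M m ε * ρ ≤ ρ' ∧ RegularAt Γ' d ε ρ' ∧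
      1.001 * a * ((bohr Γ' ρ').card : ℝ) ≤ (translatePart A z' (bohr Γ' ρ')).card := by
  have hd0 : (0 : ℝ) < (d : ℝ) + 1 := by positivity
  have hε0 : 0 < ε := by rw [hε]; positivity
  have hhalf : (1 / 2 : ℝ) ^ ℓ ≤ 1 := pow_le_one₀ (by norm_num) (by norm_num)
  have hε1000 : ε ≤ 1 / 1000 := by rw [hε]; gcongr
  have hεa : ε ≤ a / 1000 := by rw [hε]; gcongr
  have ha0 : 0 < a := lt_of_lt_of_le (by positivity) ha
  set θ : ℝ := ε / (28 * (d + 1)) with hθ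
  have hθ0 : 0 < θ := by positivity
  have hθ1 : θ ≤ 1 / 28 := by
    rw [hθ, div_le_div_iff₀ (by positivity) (by norm_num)]
    nlinarith [show (0 : ℝ) ≤ d from Nat.cast_nonneg d]
  have hθr : ∀ r : ℝ, ε * r / (28 * (d + 1)) = θ * r := fun r => by rw [hθ]; ring
  have hΓd : Γ.card ≤ d := by omega
  obtain ⟨ρ₁, hρ₁l, hρ₁u, hreg₁⟩ := exists_regular_radius Γ hΓd
    (show 0 < θ * ρ / 2 by positivity) hε0 (by linarith)
  have hreg₁' : RegularAt Γ d ε ρ₁ := hreg₁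
  have hρ₁0 : 0 < ρ₁ := lt_of_lt_of_le (by positivity) hρ₁l
  obtain ⟨ρX, hρXl, hρXu, hregX⟩ := exists_regular_radius Γ hΓd
    (show 0 < θ * ρ₁ / 4 by positivity) hε0 (by linarith)
  have hregX' : RegularAt Γ d ε ρX := hregX
  have hρX0 : 0 < ρX := lt_of_lt_of_le (by positivity) hρXl
  have hθρ : θ * ρ ≤ 1 / 28 * 2 := mul_le_mul hθ1 hρ2 hρ.le (by norm_num)
  have hθρ₁ : θ * ρ₁ ≤ 1 / 28 * ρ₁ := mul_le_mul_of_nonneg_right hθ1 hρ₁0.le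
  have hρX₁ : ρX ≤ ρ₁ := by linarith
  have hratX : θ ^ 2 / 8 * ρ ≤ ρX := by
    refine le_trans ?_ hρXl
    calc θ ^ 2 / 8 * ρ = θ * (θ * ρ / 2) / 4 := by ring
      _ ≤ _ := by gcongr
  have hrat : stepRatio d M m ε ≤ θ ^ 2 / 8 := by
    unfold stepRatio
    rw [← hθ]
    have h1 : (1 / 16 : ℝ) ^ M ≤ 1 := pow_le_one₀ (by norm_num) (by norm_num)
    have h2 : θ ^ 5 ≤ θ ^ 2 := pow_le_pow_of_le_one hθ0.le (by linarith) (by norm_num)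
    have h3 : (8 : ℝ) ≤ 57344 * (d + 1) * (m + 1) := by
      have h4 : (1 : ℝ) ≤ (d + 1) * (m + 1) := by
        have e1 : (0 : ℝ) ≤ d := Nat.cast_nonneg d
        have e2 : (0 : ℝ) ≤ m := Nat.cast_nonneg m
        nlinarith [mul_nonneg e1 e2]
      linarith
    calc θ ^ 5 * (1 / 16) ^ M / (57344 * (d + 1) * (m + 1)) ≤ θ ^ 2 * 1 / 8 := by gcongr
      _ = _ := by ring
  have hratX' : stepRatio d M m ε * ρ ≤ ρX :=
    (mul_le_mul_of_nonneg_right hrat hρ.le).trans hratX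
  have hX : ((bohr Γ (ρ + θ * ρ)).card : ℝ) ≤ (1 + ε) * (bohr Γ ρ).card :=
    hreg.card_le (by rw [hθr])
  obtain ⟨x, hx⟩ := exists_simultaneous_translate (S := bohr Γ ρ₁) (S' := bohr Γ ρX) ha0.le
    (bohr_nonempty Γ hρ.le) (bohr_nonempty Γ hρ₁0.le) (bohr_nonempty Γ hρX0.le)
    (fun b hb y hy => sub_mem_bohr hb hy (t := ρ + θ * ρ) (by linarith))
    (fun b hb y hy => sub_mem_bohr hb hy (t := ρ + θ * ρ) (by linarith)) hX hdens
  set B := bohr Γ ρ₁ with hB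
  set X := bohr Γ ρX with hXdef
  set A₁ := translatePart A x B with hA₁
  set A₂ := translatePart A x X with hA₂
  have hBpos : (0 : ℝ) < B.card := card_bohr_pos Γ hρ₁0.le
  have hXpos : (0 : ℝ) < X.card := card_bohr_pos Γ hρX0.le
  set a₁ : ℝ := A₁.card / B.card with ha₁
  set a₂ : ℝ := A₂.card / X.card with ha₂
  have hA₁c : (A₁.card : ℝ) = a₁ * B.card := (div_mul_cancel₀ _ hBpos.ne').symm
  have hA₂c : (A₂.card : ℝ) = a₂ * X.card := (div_mul_cancel₀ _ hXpos.ne').symm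
  by_cases h1 : 1.001 * a ≤ a₁
  · right
    refine ⟨Γ, ρ₁, x, by omega, by linarith, by linarith, hreg₁', ?_⟩
    rw [← hB, ← hA₁, hA₁c]
    exact mul_le_mul_of_nonneg_right h1 hBpos.le
  by_cases h2 : 1.001 * a ≤ a₂
  · right
    refine ⟨Γ, ρX, x, by omega, by linarith, by linarith, hregX', ?_⟩
    rw [← hXdef, ← hA₂, hA₂c]
    exact mul_le_mul_of_nonneg_right h2 hXpos.le
  push Not at h1 h2
  have h3 : 2 * (1 - ε) * a ≥ 1.998 * a := by
    have := mul_le_mul_of_nonneg_right hε1000 ha0.le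
    linarith
  have ha₁l : 0.997 * a ≤ a₁ := by linarith
  have ha₂l : 0.997 * a ≤ a₂ := by linarith
  have hpow : (1 / 2 : ℝ) ^ (ℓ + 1) = (1 / 2) ^ ℓ / 2 := by rw [pow_succ]; ring
  have ha₁' : (1 / 2 : ℝ) ^ (ℓ + 1) ≤ a₁ := by linarith
  have ha₂' : (1 / 2 : ℝ) ^ (ℓ + 1) ≤ a₂ := by linarith
  have hpp : (0 : ℝ) < (1 / 2) ^ (ℓ + 1) := by positivity
  have ha₁1 : a₁ ≤ 1 := by
    rw [ha₁, div_le_one hBpos]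
    exact_mod_cast Finset.card_le_card (Finset.filter_subset _ _)
  have hmemA₁ : ∀ y ∈ A₁, x + y ∈ A := fun y hy => (Finset.mem_filter.1 hy).2
  have hmemA₂ : ∀ y ∈ A₂, x + y ∈ A := fun y hy => (Finset.mem_filter.1 hy).2
  have hcount := sum_sconv_le_apCount hmemA₁ hmemA₂
  by_cases hfew : ∑ b ∈ A₂, sconv (ofSet A₁) (ofSet A₁) (b + b) ≤ a₁ ^ 2 * B.card * A₂.card / 4
  · right
    obtain ⟨Γ', ρ', hΓ', hρ'2, hρ'l, hreg', y, hy⟩ := increment_of_few hh hℓ hε0 (by linarith) hm hn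
      hM hd (by linarith) hρX0 (by rw [← hθ]; linarith) hreg₁' hregX' (Finset.filter_subset _ _)
      hA₁c ha₁' ha₁1 (by linarith) (Finset.filter_subset _ _)
      (hA₂c.symm ▸ mul_le_mul_of_nonneg_right ha₂' hXpos.le) hfew
    refine ⟨Γ', ρ', x + y, hΓ', hρ'2, ?_, hreg', ?_⟩
    · refine le_trans ?_ hρ'l
      rw [← hθ]
      -- The constant `57344` in `stepRatio` is `8 * 4 * 1792`, collected from the successive
      -- changes of radius.
      calc stepRatio d M m ε * ρ = θ * (θ ^ 2 / 8 * ρ) / 4 *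
            (θ ^ 2 * (1 / 16) ^ M / (1792 * (d + 1) * (m + 1))) := by
            unfold stepRatio; rw [← hθ]; field_simp; norm_num
        _ ≤ _ := by gcongr
    · have h5 : (translatePart A₁ y (bohr Γ' ρ')).card ≤
          (translatePart A (x + y) (bohr Γ' ρ')).card := by
        refine Finset.card_le_card fun w hw => ?_
        obtain ⟨hw1, hw2⟩ := Finset.mem_filter.1 hw
        refine Finset.mem_filter.2 ⟨hw1, ?_⟩
        rw [add_assoc]
        exact hmemA₁ _ hw2
      have h6 : ((translatePart A₁ y (bohr Γ' ρ')).card : ℝ) ≤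
          (translatePart A (x + y) (bohr Γ' ρ')).card := by exact_mod_cast h5
      refine le_trans ?_ (hy.trans h6)
      exact mul_le_mul_of_nonneg_right (by linarith) (Nat.cast_nonneg _)
  · left
    push Not at hfew
    refine ⟨Γ, ρX, hΓd, hratX', le_trans ?_ (hfew.le.trans hcount)⟩
    rw [← hXdef]
    have hXB : (X.card : ℝ) ≤ B.card := by
      exact_mod_cast Finset.card_le_card (bohr_mono (Finset.Subset.refl _) hρX₁)
    have ha₁e : (1 / 2) ^ ℓ * 0.9 ≤ a₁ := by linarith
    have ha₂e : (1 / 2) ^ ℓ * 0.9 ≤ a₂ := by linarith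
    rw [hA₂c]
    exact pow_three_mul_sq_le ha₁e ha₂e hXpos.le hXB

/-- Starting from the whole group, viewed as the Bohr set of no characters and radius `2`, suppose
every step increments. After `K` steps the density would exceed `1`. -/
theorem exists_bohr_of_iteration {hf : G →+ G} (hh : ∀ x, hf x + hf x = x) {A : Finset G}
    {d ℓ m n M K : ℕ} {ε : ℝ} (hℓ : 1 ≤ ℓ)
    (hε : ε = (1 / 2) ^ ℓ / 1000) (hm : m = 735 * ℓ ^ 2) (hn : n = 10 ^ 9 * m ^ 3)
    (hM : M = 27 * (n * (721 * ℓ ^ 2 + 1) + 4)) (hK : K = 1001 * ℓ) (hd : (K + 1) * M ≤ d)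
    (hA : (1 / 2) ^ ℓ * (Fintype.card G : ℝ) ≤ A.card) :
    ∃ (Γ : Finset (AddChar G ℂ)) (ρ : ℝ), Γ.card ≤ d ∧ 2 * stepRatio d M m ε ^ (K + 1) ≤ ρ ∧
      (1 / 2) ^ (3 * ℓ + 3) * ((bohr Γ ρ).card : ℝ) ^ 2 ≤ apCount A := by
  by_contra! hcon
  have hε0 : 0 < ε := by rw [hε]; positivity
  have hr0 : 0 < stepRatio d M m ε := by unfold stepRatio; positivity
  have hr1 : stepRatio d M m ε ≤ 1 := by
    unfold stepRatio
    have hhalf : (1 / 2 : ℝ) ^ ℓ ≤ 1 := pow_le_one₀ (by norm_num) (by norm_num)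
    have e1 : (0 : ℝ) ≤ d := Nat.cast_nonneg d
    have e2 : (0 : ℝ) ≤ m := Nat.cast_nonneg m
    have h1 : ε / (28 * (d + 1)) ≤ 1 := by
      rw [div_le_one (by positivity)]
      have : ε ≤ 1 := by rw [hε]; linarith
      linarith
    have h2 : (1 / 16 : ℝ) ^ M ≤ 1 := pow_le_one₀ (by norm_num) (by norm_num)
    have h3 : (ε / (28 * (d + 1))) ^ 5 ≤ 1 := pow_le_one₀ (by positivity) h1
    have h4 : (1 : ℝ) ≤ 57344 * (d + 1) * (m + 1) := by nlinarith [mul_nonneg e1 e2]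
    rw [div_le_one (by positivity)]
    calc _ ≤ (1 : ℝ) * 1 := by gcongr
      _ ≤ _ := by linarith
  have hmain : ∀ i ≤ K, ∃ (Γ : Finset (AddChar G ℂ)) (ρ : ℝ) (z : G), Γ.card ≤ i * M ∧ ρ ≤ 2 ∧
      2 * stepRatio d M m ε ^ i ≤ ρ ∧ RegularAt Γ d ε ρ ∧
      1.001 ^ i * (1 / 2) ^ ℓ * ((bohr Γ ρ).card : ℝ) ≤ (translatePart A z (bohr Γ ρ)).card := by
    intro i
    induction i with
    | zero =>
      intro _
      refine ⟨∅, 2, 0, by simp, le_rfl, by simp, ?_, ?_⟩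
      · unfold RegularAt
        rw [bohr_empty, bohr_empty]
        have : (0 : ℝ) ≤ (univ : Finset G).card := Nat.cast_nonneg _
        nlinarith
      · rw [bohr_empty, translatePart]
        simpa using hA
    | succ i ih =>
      intro hi
      obtain ⟨Γ, ρ, z, hΓ, hρ2, hρl, hreg, hdens⟩ := ih (by omega)
      have hρ0 : 0 < ρ := lt_of_lt_of_le (by positivity) hρl
      have hΓd : Γ.card + M ≤ d := by
        calc Γ.card + M ≤ i * M + M := by omega
          _ = (i + 1) * M := by ring
          _ ≤ (K + 1) * M := Nat.mul_le_mul_right _ (by omega)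
          _ ≤ d := hd
      have ha : (1 / 2 : ℝ) ^ ℓ ≤ 1.001 ^ i * (1 / 2) ^ ℓ :=
        le_mul_of_one_le_left (by positivity) (one_le_pow₀ (by norm_num))
      have hnext : 2 * stepRatio d M m ε ^ (i + 1) ≤ stepRatio d M m ε * ρ := by
        calc 2 * stepRatio d M m ε ^ (i + 1) =
              stepRatio d M m ε * (2 * stepRatio d M m ε ^ i) := by ring
          _ ≤ _ := by gcongr
      rcases density_step hh hℓ hε hm hn hM hΓd hρ0 hρ2 hreg ha hdens with
        ⟨Γ', ρ', h1, h2, h3⟩ | ⟨Γ', ρ', z', h1, h2, h3, h4, h5⟩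
      · exfalso
        refine absurd h3 (not_le.2 (hcon Γ' ρ' h1 (le_trans ?_ (hnext.trans h2))))
        have : stepRatio d M m ε ^ (K + 1) ≤ stepRatio d M m ε ^ (i + 1) :=
          pow_le_pow_of_le_one hr0.le hr1 (by omega)
        linarith
      · refine ⟨Γ', ρ', z', ?_, h2, hnext.trans h3, h4, le_trans (le_of_eq ?_) h5⟩
        · calc Γ'.card ≤ Γ.card + M := h1
            _ ≤ i * M + M := by omega
            _ = (i + 1) * M := by ring
        · rw [pow_succ]; ring
  obtain ⟨Γ, ρ, z, -, -, hρl, -, hdens⟩ := hmain K le_rfl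
  have hρ0 : 0 < ρ := lt_of_lt_of_le (by positivity) hρl
  have hpos := card_bohr_pos Γ hρ0.le
  have h1 : ((translatePart A z (bohr Γ ρ)).card : ℝ) ≤ (bohr Γ ρ).card := by
    exact_mod_cast Finset.card_le_card (Finset.filter_subset _ _)
  -- Bernoulli gives `1.001^1001 > 2`, so `1001` increments outweigh one factor `1/2`; this is why
  -- `K = 1001 * ℓ`.
  have h2 : (1 : ℝ) < 1.001 ^ K * (1 / 2) ^ ℓ := by
    rw [hK, pow_mul, ← mul_pow]
    refine one_lt_pow₀ ?_ (by omega)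
    have h3 := one_add_mul_le_pow (show (-2 : ℝ) ≤ 0.001 by norm_num) 1001
    rw [show (1 : ℝ) + 0.001 = 1.001 by norm_num] at h3
    generalize (1.001 : ℝ) ^ 1001 = t at h3 ⊢
    norm_num at h3
    linarith
  nlinarith

end Main

/-! ### Explicit exponents and translation to the normalised count. -/

section Final

/-- The number of characters added in one step of the density increment. -/
def rankStep (ℓ : ℕ) : ℕ := 27 * (10 ^ 9 * (735 * ℓ ^ 2) ^ 3 * (721 * ℓ ^ 2 + 1) + 4)

/-- The bound for the rank of all Bohr sets in the density increment. -/
def rankBound (ℓ : ℕ) : ℕ := 1002 * ℓ * rankStep ℓ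

/-- The exponent in the final count of progressions. -/
def countExponent (ℓ : ℕ) : ℕ :=
  3 * ℓ + 3 + 14 * (rankBound ℓ * (20 * rankBound ℓ * (1001 * ℓ + 1)))

/-- One step adds `O(ℓ^8)` characters, so the rank is `O(ℓ^9)`; the number of radius halvings is
`O(ℓ)` times the rank, and rank times halvings gives `ℓ^19`. -/
theorem exists_countExponent_le : ∃ C : ℕ, ∀ ℓ, 1 ≤ ℓ → countExponent ℓ ≤ C * ℓ ^ 19 := by
  obtain ⟨c, hc⟩ : ∃ c, c = 27 * (10 ^ 9 * 735 ^ 3 * 722 + 4) := ⟨_, rfl⟩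
  refine ⟨6 + 14 * (1002 * c * (20 * (1002 * c) * 1002)), fun ℓ hℓ => ?_⟩
  have h1 : rankStep ℓ ≤ c * ℓ ^ 8 := by
    have h2 : 1 ≤ ℓ ^ 2 := Nat.one_le_pow _ _ hℓ
    have h3 : 1 ≤ ℓ ^ 8 := Nat.one_le_pow _ _ hℓ
    calc rankStep ℓ ≤ 27 * (10 ^ 9 * (735 * ℓ ^ 2) ^ 3 * (721 * ℓ ^ 2 + ℓ ^ 2) + 4 * ℓ ^ 8) := by
          unfold rankStep
          gcongr
          omega
      _ = c * ℓ ^ 8 := by rw [hc]; ring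
  have h4 : rankBound ℓ ≤ 1002 * c * ℓ ^ 9 := by
    calc rankBound ℓ ≤ 1002 * ℓ * (c * ℓ ^ 8) := by unfold rankBound; gcongr
      _ = _ := by ring
  have h5 : ℓ ≤ ℓ ^ 19 := Nat.le_self_pow (by norm_num) ℓ
  calc countExponent ℓ ≤ 6 * ℓ ^ 19 +
        14 * (1002 * c * ℓ ^ 9 * (20 * (1002 * c * ℓ ^ 9) * (1002 * ℓ))) := by
        unfold countExponent
        gcongr
        · omega
        · omega
    _ = _ := by ring

theorem half_pow_le_stepRatio {d M m ℓ : ℕ} {ε : ℝ} (hε : ε = (1 / 2) ^ ℓ / 1000) (hℓ : ℓ ≤ d)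
    (hM : M ≤ d) (hm : m ≤ d) (hd : 100 ≤ d) : (1 / 2) ^ (20 * d) ≤ stepRatio d M m ε := by
  have hd1 : ((d : ℝ) + 1) ≤ 2 ^ d := by exact_mod_cast Nat.lt_two_pow_self
  have hm1 : ((m : ℝ) + 1) ≤ 2 ^ m := by exact_mod_cast Nat.lt_two_pow_self
  have h1 : (1 / 2 : ℝ) ^ (15 + ℓ + d) ≤ ε / (28 * (d + 1)) := by
    rw [hε, le_div_iff₀ (by positivity), le_div_iff₀ (by norm_num)]
    calc (1 / 2 : ℝ) ^ (15 + ℓ + d) * (28 * (d + 1)) * 1000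
        ≤ (1 / 2 : ℝ) ^ (15 + ℓ + d) * (28 * 2 ^ d) * 1000 := by gcongr
      _ = (1 / 2) ^ ℓ * ((1 / 2) ^ d * 2 ^ d) * (28000 / 2 ^ 15) := by ring
      _ = (1 / 2) ^ ℓ * (28000 / 2 ^ 15) := by rw [← mul_pow]; norm_num
      _ ≤ (1 / 2) ^ ℓ * 1 := by gcongr; norm_num
      _ = _ := mul_one _
  unfold stepRatio
  rw [le_div_iff₀ (by positivity)]
  calc (1 / 2 : ℝ) ^ (20 * d) * (57344 * (d + 1) * (m + 1))
      ≤ (1 / 2 : ℝ) ^ ((15 + ℓ + d) * 5 + 4 * M + 16 + d + m) * (2 ^ 16 * 2 ^ d * 2 ^ m) := by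
        gcongr ?_ * (?_ * ?_ * ?_)
        · exact pow_le_pow_of_le_one (by norm_num) (by norm_num) (by omega)
        · norm_num
    _ = ((1 / 2) ^ (15 + ℓ + d)) ^ 5 * ((1 / 2) ^ 4) ^ M *
        (((1 / 2) ^ 16 * 2 ^ 16) * ((1 / 2) ^ d * 2 ^ d) * ((1 / 2) ^ m * 2 ^ m)) := by
        rw [← pow_mul, ← pow_mul]; ring
    _ = ((1 / 2) ^ (15 + ℓ + d)) ^ 5 * (1 / 16) ^ M := by
        rw [← mul_pow, ← mul_pow, ← mul_pow]; norm_num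
    _ ≤ (ε / (28 * (d + 1))) ^ 5 * (1 / 16) ^ M := by gcongr

variable {G : Type*} [AddCommGroup G] [Fintype G] [DecidableEq G]

/-- The final radius is at least `2 / 2^k`, and each halving costs at most `81 < 2^7` per character;
squaring the size of the Bohr set gives the `14` in `countExponent`. -/
theorem half_pow_mul_card_sq_le_apCount {hf : G →+ G} (hh : ∀ x, hf x + hf x = x) {A : Finset G}
    {ℓ : ℕ} (hℓ : 1 ≤ ℓ) (hA : (1 / 2) ^ ℓ * (Fintype.card G : ℝ) ≤ A.card) :
    (1 / 2) ^ countExponent ℓ * (Fintype.card G : ℝ) ^ 2 ≤ apCount A := by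
  obtain ⟨m, hm⟩ : ∃ m, m = 735 * ℓ ^ 2 := ⟨_, rfl⟩
  obtain ⟨n, hn⟩ : ∃ n, n = 10 ^ 9 * m ^ 3 := ⟨_, rfl⟩
  obtain ⟨M, hM⟩ : ∃ M, M = 27 * (n * (721 * ℓ ^ 2 + 1) + 4) := ⟨_, rfl⟩
  obtain ⟨ε, hε⟩ : ∃ ε : ℝ, ε = (1 / 2) ^ ℓ / 1000 := ⟨_, rfl⟩
  obtain ⟨d, hd⟩ : ∃ d, d = 1002 * ℓ * M := ⟨_, rfl⟩
  have hMr : rankStep ℓ = M := by rw [hM, hn, hm, rankStep]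
  have hdr : rankBound ℓ = d := by rw [rankBound, hMr, hd]
  have hM108 : 108 ≤ M := by rw [hM]; omega
  have hMd : M ≤ d := by rw [hd]; nlinarith
  have hmM : m ≤ M := by
    have h1 : 1 ≤ m := by rw [hm]; nlinarith
    have h2 : m ≤ m ^ 3 := Nat.le_self_pow (by norm_num) m
    have h3 : m ^ 3 ≤ n := by rw [hn]; omega
    have h4 : n ≤ n * (721 * ℓ ^ 2 + 1) := Nat.le_mul_of_pos_right _ (by omega)
    rw [hM]; omega
  have hℓd : ℓ ≤ d := by rw [hd]; nlinarith
  obtain ⟨Γ, ρ, hΓ, hρ, hcount⟩ := exists_bohr_of_iteration (d := d) hh hℓ hε hm hn hM rfl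
    (by rw [hd]; exact Nat.mul_le_mul_right _ (by omega)) hA
  have hratio := half_pow_le_stepRatio hε hℓd hMd (hmM.trans hMd) (by omega : 100 ≤ d)
  set k := 20 * d * (1001 * ℓ + 1) with hk
  have h1 : (2 : ℝ) / 2 ^ k ≤ ρ := by
    refine le_trans ?_ hρ
    calc (2 : ℝ) / 2 ^ k = 2 * ((1 / 2) ^ (20 * d)) ^ (1001 * ℓ + 1) := by
          rw [← pow_mul, ← hk, one_div_pow, mul_one_div]
      _ ≤ _ := by gcongr
  have h2 : (Fintype.card G : ℝ) ≤ 2 ^ (7 * (d * k)) * (bohr Γ ρ).card := by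
    have h3 : (Fintype.card G : ℝ) ≤ 81 ^ (Γ.card * k) * (bohr Γ (2 / 2 ^ k)).card := by
      exact_mod_cast card_univ_le_card_bohr Γ k
    have h4 : ((bohr Γ (2 / 2 ^ k)).card : ℝ) ≤ (bohr Γ ρ).card := by
      exact_mod_cast Finset.card_le_card (bohr_mono (Finset.Subset.refl _) h1)
    calc (Fintype.card G : ℝ) ≤ 81 ^ (Γ.card * k) * (bohr Γ (2 / 2 ^ k)).card := h3
      _ ≤ 128 ^ (d * k) * (bohr Γ ρ).card := by
          gcongr ?_ * ?_
          calc (81 : ℝ) ^ (Γ.card * k) ≤ 128 ^ (Γ.card * k) := by gcongr; norm_num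
            _ ≤ 128 ^ (d * k) :=
              pow_le_pow_right₀ (by norm_num) (Nat.mul_le_mul_right _ hΓ)
      _ = _ := by rw [pow_mul (2 : ℝ) 7 (d * k), show (2 : ℝ) ^ 7 = 128 by norm_num]
  refine le_trans ?_ hcount
  have h5 : (1 / 2 : ℝ) ^ (7 * (d * k)) * Fintype.card G ≤ (bohr Γ ρ).card := by
    rw [one_div_pow, one_div, inv_mul_le_iff₀ (by positivity)]
    exact h2
  calc (1 / 2 : ℝ) ^ countExponent ℓ * (Fintype.card G : ℝ) ^ 2
      = (1 / 2) ^ (3 * ℓ + 3) * ((1 / 2) ^ (7 * (d * k)) * Fintype.card G) ^ 2 := by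
        have e : countExponent ℓ = (3 * ℓ + 3) + 7 * (d * k) * 2 := by
          rw [countExponent, hdr, hk]; ring
        rw [e, pow_add, pow_mul, mul_pow, mul_assoc]
    _ ≤ _ := by gcongr

/-- With `y` the first term and `b` the middle one, put `x = y - 2b`; then `-x` is the third term
and `b` is recovered by halving `y - x`. -/
theorem apCount_div_eq_innerL2 {hf : G →+ G} (hh : ∀ x, hf x + hf x = x) (A : Finset G) :
    apCount A / (Fintype.card G : ℝ) ^ 2 =
      innerL2 (conv (ind (A : Set G)) (ind (-dilate 2 (A : Set G)))) (ind (-(A : Set G))) := by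
  have hind_iff : ∀ {S : Set G} {x y : G}, (x ∈ S ↔ y ∈ A) → ind S x = ofSet A y := by
    intro S x y h
    by_cases hx : y ∈ A
    · rw [ind, Set.indicator_of_mem (h.2 hx), ofSet, if_pos hx]
    · rw [ind, Set.indicator_of_notMem (mt h.1 hx), ofSet, if_neg hx]
  have hind : ∀ x, ind (A : Set G) x = ofSet A x := fun x => hind_iff Finset.mem_coe
  have hneg : ∀ x, ind (-(A : Set G)) x = ofSet A (-x) := fun x => hind_iff (by simp)
  have hdil : ∀ x, ind (-dilate 2 (A : Set G)) x = ofSet A (hf (-x)) := by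
    intro x
    have : x ∈ -dilate 2 (A : Set G) ↔ hf (-x) ∈ A := by
      rw [Set.mem_neg, dilate, Set.mem_image]
      constructor
      · rintro ⟨a, ha, hax⟩
        rw [← hax]
        rw [two_smul, half_add_self hh]
        exact ha
      · intro h
        refine ⟨hf (-x), h, ?_⟩
        rw [two_smul, hh]
    exact hind_iff this
  have hsum : apCount A = ∑ x, ∑ y, ofSet A y * ofSet A (hf (-(x - y))) * ofSet A (-x) := by
    have h1 : apCount A = ∑ y, ∑ b, ofSet A y * ofSet A b * ofSet A (b + b - y) := by
      unfold apCount sconv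
      rw [← sum_ofSet_mul, Finset.sum_comm]
      refine Finset.sum_congr rfl fun b _ => ?_
      rw [Finset.mul_sum]
      refine Finset.sum_congr rfl fun y _ => ?_
      ring
    rw [h1, Finset.sum_comm (f := fun x y => ofSet A y * ofSet A (hf (-(x - y))) * ofSet A (-x))]
    refine Finset.sum_congr rfl fun y _ => ?_
    refine Finset.sum_bij' (fun b _ => y - (b + b)) (fun x _ => hf (y - x)) (by simp) (by simp)
      (fun b _ => ?_) (fun x _ => ?_) fun b _ => ?_
    · rw [sub_sub_cancel, half_add_self hh]
    · rw [hh, sub_sub_cancel]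
    · rw [sub_sub_cancel_left, neg_neg, half_add_self hh, neg_sub]
  rw [hsum]
  simp only [innerL2, RCLike.wInner_cWeight_eq_expect, conv, hind, hneg, hdil,
    Fintype.expect_eq_sum_div_card]
  rw [Finset.sum_div, Finset.sum_div]
  refine Finset.sum_congr rfl fun x _ => ?_
  rw [← Finset.sum_mul]
  simp only [RCLike.inner_apply, conj_trivial]
  rw [mul_div_assoc', div_div, mul_comm, sq]

end Final

end Roth

theorem mainTheorem2 :
    ∃ C : ℝ, 0 < C ∧
      ∀ (G : Type*) [AddCommGroup G] [Fintype G], Odd (Fintype.card G) →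
        ∀ (A : Finset G) (α : ℝ), α = (A.card : ℝ) / (Fintype.card G : ℝ) → 0 < α →
          Real.exp (-(C * (α⁻¹ * Real.log (2 / α) ^ 5))) ≤
            Roth.innerL2
              (Roth.conv (Roth.ind (A : Set G))
                (Roth.ind (-Roth.dilate 2 (A : Set G))))
              (Roth.ind (-(A : Set G))) := by
  obtain ⟨C, hC⟩ := Roth.exists_countExponent_le
  -- The factors come from `ℓ ≤ 4 L` and `L^14 ≤ 14! * 2 / α`; `C + 1` ensures positivity.
  refine ⟨(C + 1) * 4 ^ 19 * (2 * Nat.factorial 14), by positivity, ?_⟩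
  intro G _ _ hodd A α hα hα0
  classical
  have hG : (0 : ℝ) < Fintype.card G := by exact_mod_cast Fintype.card_pos
  have hα1 : α ≤ 1 := by
    rw [hα, div_le_one hG]
    exact_mod_cast Finset.card_le_univ A
  obtain ⟨hf, hh⟩ : ∃ hf : G →+ G, ∀ x, hf x + hf x = x := by
    obtain ⟨k, hk⟩ := hodd
    -- When `|G| = 2k + 1`, halving is multiplication by `k + 1`.
    refine ⟨nsmulAddMonoidHom (k + 1), fun x => ?_⟩
    have h1 : Fintype.card G • x = 0 := card_nsmul_eq_zero
    rw [nsmulAddMonoidHom_apply, ← add_nsmul, show k + 1 + (k + 1) = (2 * k + 1) + 1 by ring, ← hk,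
      succ_nsmul, h1, zero_add]
  set L := Real.log (2 / α) with hL
  have hL2 : Real.log 2 ≤ L := by
    apply Real.log_le_log (by norm_num)
    rw [le_div_iff₀ hα0]; linarith
  have hlog2 := Real.log_two_gt_d9
  have hL0 : 1 / 2 ≤ L := by linarith
  have hexpL : Real.exp L = 2 / α := Real.exp_log (by positivity)
  set ℓ := ⌈2 * L⌉₊ with hℓ
  have hℓl : 2 * L ≤ ℓ := Nat.le_ceil _
  have hℓu : (ℓ : ℝ) ≤ 4 * L := by
    have := (Nat.ceil_lt_add_one (show 0 ≤ 2 * L by linarith)).le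
    rw [← hℓ] at this
    linarith
  have hℓ1 : 1 ≤ ℓ := by
    have : (1 : ℝ) ≤ ℓ := by linarith
    exact_mod_cast this
  have hhalf : (1 / 2 : ℝ) ^ ℓ ≤ α := by
    have h1 : 2 / α ≤ 2 ^ ℓ := by
      rw [← hexpL]
      calc Real.exp L ≤ Real.exp (ℓ * Real.log 2) := by
            gcongr
            nlinarith
        _ = 2 ^ ℓ := by rw [Real.exp_nat_mul, Real.exp_log (by norm_num)]
    rw [div_le_iff₀ hα0] at h1
    rw [one_div_pow, div_le_iff₀ (by positivity)]
    linarith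
  have hA : (1 / 2) ^ ℓ * (Fintype.card G : ℝ) ≤ A.card := by
    rw [hα, le_div_iff₀ hG] at hhalf
    exact hhalf
  have hmain := Roth.half_pow_mul_card_sq_le_apCount hh hℓ1 hA
  rw [← Roth.apCount_div_eq_innerL2 hh, le_div_iff₀ (by positivity)]
  refine le_trans ?_ hmain
  gcongr
  have h2 : Real.exp (-(Roth.countExponent ℓ : ℝ)) ≤ (1 / 2) ^ Roth.countExponent ℓ := by
    rw [Real.exp_neg, one_div_pow, one_div]
    have e1 : (2 : ℝ) ≤ Real.exp 1 := by linarith [Real.add_one_le_exp (1 : ℝ)]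
    have e2 : (2 : ℝ) ^ Roth.countExponent ℓ ≤ Real.exp (Roth.countExponent ℓ) := by
      calc (2 : ℝ) ^ Roth.countExponent ℓ ≤ Real.exp 1 ^ Roth.countExponent ℓ := by gcongr
        _ = _ := by rw [← Real.exp_nat_mul, mul_one]
    gcongr
  refine le_trans ?_ h2
  gcongr
  have h3 : (Roth.countExponent ℓ : ℝ) ≤ C * (ℓ : ℝ) ^ 19 := by exact_mod_cast hC ℓ hℓ1
  -- Here the polylogarithmic exponent `L^19 = L^14 * L^5` is weakened to `α⁻¹ L^5`, using `exp L =
  -- 2 / α`.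
  have h4 : L ^ 14 ≤ Nat.factorial 14 * (2 * α⁻¹) := by
    have h5 := Real.pow_div_factorial_le_exp L (by linarith) 14
    rw [hexpL, div_le_iff₀ (by positivity)] at h5
    rw [← div_eq_mul_inv]
    linarith
  calc (Roth.countExponent ℓ : ℝ) ≤ C * (ℓ : ℝ) ^ 19 := h3
    _ ≤ (C + 1) * (4 * L) ^ 19 := by gcongr; linarith
    _ = (C + 1) * 4 ^ 19 * (L ^ 14 * L ^ 5) := by ring
    _ ≤ (C + 1) * 4 ^ 19 * ((Nat.factorial 14 * (2 * α⁻¹)) * L ^ 5) := by gcongr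
    _ = _ := by ring
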